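/- Let $n\ge 3$. A convex body is a nonempty compact convex subset of $\mathbb{R}^n$; write $|\cdot|_k$ for $k$-dimensional Hausdorff measure, normalized to agree with Lebesgue measure on $k$-dimensional Euclidean spaces. For a convex body $C$ of dimension $d\ge 2$ put $$\mathrm{Isop}(C)=\frac{|\partial C|_{d-1}}{d\,|C|_d},$$ where $\partial C$ is the boundary of $C$ relative to its affine hull. Let $$V_n(L_1,\dots,L_n)=\frac1{n!}\sum_{\emptyset\ne J\subset\{1,\dots,n\}}(-1)^{n-|J|}\Big|\sum_{i\in J}L_i\Big|_n$$ be the mixed volume (with $L[k]$ meaning that $L$ is repeated $k$ times, and $V_n(K)=V_n(K[n])=|K|_n$), let $$F_K(A,B)=V_n(A,K[n-1])\,V_n(B,K[n-1])-V_n(A,B,K[n-2])\,V_n(K),$$ and let the Bezout constant be $$b_2(K)=\sup_{L_1,L_2}\frac{V_n(L_1,L_2,K[n-2])\,V_n(K)}{V_n(L_1,K[n-1])\,V_n(L_2,K[n-1])},$$ the supremum being over pairs of convex bodies (with the quotient read as $0$ if its denominator is $0$). **Theorem.** Let $K\subset\mathbb{R}^n$ be a convex body with nonempty interior, let $u_0$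 be a unit vector, and suppose that $F=\{y\in K:\langle y,u_0\rangle=\max_{z\in K}\langle z,u_0\rangle\}$ is a facet of $K$, that is, $\dim F=n-1$. Assume that $\mathrm{Isop}(F)>\mathrm{Isop}(K)$. Then: 1. $F_K\ge 0$ fails: there are convex bodies $A,B\subset\mathbb{R}^n$ with nonempty interior such that $F_K(A,B)<0$. 2. $b_2(K)>1$. 3. There is a neighbourhood $U$ of $u_0$ in $S^{n-1}$ such that, for every continuous $f:S^{n-1}\to[0,1]$ with $f(u_0)=1$ and $f=0$ outside $U$, one has $F_K(A_t,B)<0$ for all sufficiently small $t>0$, where $A_t=\bigcap_{u\in S^{n-1}}\{x:\langle x,u\rangle\le h_K(u)+t f(u)\}$ is the Wulff shape of $h_K+tf$, with $h_K(u)=\max_{y\in K}\langle y,u\rangle$, and $B=\{x:|x|\le 1,\ \langle x,u_0\rangle\le 0\}$ is the half-ball whose facet has outer normal $u_0$. -/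

import Mathlib

open MeasureTheory Filter Topology

noncomputable section

namespace BezoutForm

/-- Euclidean space `ℝⁿ`. -/
abbrev E (n : ℕ) : Type := EuclideanSpace ℝ (Fin n)

/-- The mixed volume `V_n(L₁, …, L_n)` of nonempty compact convex sets in `ℝⁿ`, by the
polarization formula `(1/n!) ∑_{J ⊆ [n]} (-1)^{n-|J|} |∑_{i ∈ J} L_i|_n`. The sum of bodies is
the Minkowski sum; the empty sum is `{0}`, which contributes `0` for `n ≥ 1`. -/
def mixedVolume {n : ℕ} (L : Fin n → ConvexBody (E n)) : ℝ :=
  ((n.factorial : ℝ))⁻¹ *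
    ∑ J : Finset (Fin n),
      (-1 : ℝ) ^ (n - J.card) * (volume : Measure (E n)).real ((∑ i ∈ J, L i : ConvexBody (E n)) : Set (E n))

/-- `V_n(K) = V_n(K[n])`. -/
def mixedVol₀ {n : ℕ} (K : ConvexBody (E n)) : ℝ :=
  mixedVolume fun _ : Fin n => K

/-- `V_n(A, K[n-1])`. -/
def mixedVol₁ {n : ℕ} (K A : ConvexBody (E n)) : ℝ :=
  mixedVolume fun i : Fin n => if i.val = 0 then A else K

/-- `V_n(A, B, K[n-2])`. -/
def mixedVol₂ {n : ℕ} (K A B : ConvexBody (E n)) : ℝ :=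
  mixedVolume fun i : Fin n => if i.val = 0 then A else if i.val = 1 then B else K

/-- `F_K(A, B) = V_n(A, K[n-1]) V_n(B, K[n-1]) - V_n(A, B, K[n-2]) V_n(K)`. -/
def bezoutForm {n : ℕ} (K A B : ConvexBody (E n)) : ℝ :=
  mixedVol₁ K A * mixedVol₁ K B - mixedVol₂ K A B * mixedVol₀ K

/-- The Bezout constant `b₂(K)`: the supremum, taken in the extended reals, of
`V_n(L₁, L₂, K[n-2]) V_n(K) / (V_n(L₁, K[n-1]) V_n(L₂, K[n-1]))` over pairs of convex bodies.
For a body `K` with interior points the denominator vanishes only if `L₁` or `L₂` is a point; the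
numerator is then `0` too, and the quotient counts as `0`, which does not affect the supremum. -/
def bezoutConstant {n : ℕ} (K : ConvexBody (E n)) : EReal :=
  ⨆ (L₁ : ConvexBody (E n)) (L₂ : ConvexBody (E n)),
    ((mixedVol₂ K L₁ L₂ * mixedVol₀ K / (mixedVol₁ K L₁ * mixedVol₁ K L₂) : ℝ) : EReal)

/-- The dimension of the affine hull of a (nonempty) set. -/
def affineDim {n : ℕ} (C : Set (E n)) : ℕ :=
  Module.finrank ℝ (vectorSpan ℝ C)

/-- `Isop(C) = |∂C|_{d-1} / (d |C|_d)`, where `d` is the dimension of `C`. The boundary is taken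
relative to the affine hull of `C`, and `|·|_k` is the `k`-dimensional Hausdorff measure, normalized
to agree with Lebesgue measure on `k`-dimensional Euclidean spaces. -/
def isop {n : ℕ} (C : Set (E n)) : ℝ :=
  (Measure.euclideanHausdorffMeasure (affineDim C - 1) : Measure (E n)).real
      (intrinsicFrontier ℝ C) /
    ((affineDim C : ℝ) *
      (Measure.euclideanHausdorffMeasure (affineDim C) : Measure (E n)).real C)

/-- The face `K^u = {y ∈ K : ⟨y, u⟩ = max_{z ∈ K} ⟨z, u⟩}`. -/
def supportFace {n : ℕ} (K : ConvexBody (E n)) (u : E n) : Set (E n) :=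
  {y | y ∈ K ∧ ∀ z ∈ K, inner ℝ z u ≤ inner ℝ y u}

/-- `F` is the facet of `K` with outer unit normal `u`: the face `K^u`, of dimension `n - 1`. -/
def IsFacet {n : ℕ} (K : ConvexBody (E n)) (u : Metric.sphere (0 : E n) 1)
    (F : Set (E n)) : Prop :=
  F = supportFace K u ∧ affineDim F + 1 = n

/-- The support function `h_K(u) = max_{y ∈ K} ⟨y, u⟩`. -/
def supportFunction {n : ℕ} (K : ConvexBody (E n)) (u : E n) : ℝ :=
  sSup ((fun y : E n => inner ℝ y u) '' (K : Set (E n)))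

/-- The Wulff shape `W(g) = ⋂_{u ∈ S^{n-1}} {x : ⟨x, u⟩ ≤ g(u)}`. -/
def wulffShape {n : ℕ} (g : Metric.sphere (0 : E n) 1 → ℝ) : Set (E n) :=
  {x | ∀ u : Metric.sphere (0 : E n) 1, inner ℝ x (u : E n) ≤ g u}

/-- The half-ball `{x : |x| ≤ 1, ⟨x, u⟩ ≤ 0}`. -/
def halfBall {n : ℕ} (u : Metric.sphere (0 : E n) 1) : Set (E n) :=
  {x | ‖x‖ ≤ 1 ∧ inner ℝ x (u : E n) ≤ 0}

end BezoutForm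

end

noncomputable section

open scoped Pointwise

namespace BezoutForm

section

variable {n : ℕ}

/-! ### The Laplace transform of a convex body and its gradient map -/

/-! Write `n = m + 2`, and let `C i j` be the coefficients of the volume polynomial `|c K + a A + b
B| = ∑ C i j a^i b^j c^(n-i-j)`. The polarization formula gives `C 1 0 = n V(A, K[n-1])`, `C 0 1 = n
V(B, K[n-1])` and `C 1 1 = n (n-1) V(A, B, K[n-2])`. The form vanishes at `A = K`, so only the
excess of `A` over `K` matters. With the gap coefficients `g j = C 1 j - (n-j) C 0 j`, one has `n²
(n-1) F_K(A, B) = (n-1) g 0 * C 0 1 - n |K| g 1` (`IsVolumePolynomial.bezoutForm_eq`).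

Take `A = A_t` and let `B` be the half-ball. To first order in `t`, `g 0` is at most `t |F|`,
because the perturbation only adds a thin layer over `F` (`volume_wulffPerturb_le`). Also `C 0 1 ≤
|∂K|`, because `B` lies in the unit ball (`combVol_parallel_le`). The half-ball has support number
`0` at `u₀`. Adding `b B` therefore leaves the height of the facet unchanged, but widens the facet
to its parallel body of radius `b`, whose area is at least `|F| + b |∂F|`. Passing from `a K` to `a
A_t` then puts a prism of height about `a t` over it (`combVol_add_prism_le`), which makes `g 1` at
least about `t |∂F|`. Hence the form is negative as soon as `(n-1) |F| |∂K| < n |K| |∂F|`, which is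
`Isop(K) < Isop(F)`.

To read off `g 1`, the polynomial `∑ g j b^j` is bounded below by the prism estimate and above by `g
0 + g 1 b + O(t b²)`. The implied constant does not depend on `t` or on the neighbourhood
(`exists_sum_pow_le`), so a fixed small `b` can be chosen first, then a small angular error, and `t`
last.

Two classical facts are proved on the way. The volume is polynomial because the gradient of `∑ l i
log ∫_(L i) exp ⟨x, y⟩ dy` maps space injectively onto the Minkowski combination up to a null set,
with a Jacobian polynomial in `l` (`exists_volume_polynomial`). Surface area controls outer parallel
volumes through circumscribed polytopes (`volume_add_frontier_le`, `volume_add_closedBall_le`). The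
Bezout constant exceeds one because the mixed volumes in the denominator are positive
(`mixedVol₁_pos`). -/

/-- The Laplace transform `x ↦ ∫_L exp ⟨x, y⟩ dy` of a set. -/
def laplace (L : Set (E n)) (x : E n) : ℝ := ∫ y in L, Real.exp (inner ℝ x y)

/-- The vector-valued Laplace transform `x ↦ ∫_L exp ⟨x, y⟩ y dy`. -/
def laplaceVec (L : Set (E n)) (x : E n) : E n := ∫ y in L, Real.exp (inner ℝ x y) • y

/-- The gradient of `log ∘ laplace L`: the barycentre of the exponentially tilted uniform
measure of `L`. -/
def gradMap (L : Set (E n)) (x : E n) : E n := (laplace L x)⁻¹ • laplaceVec L x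

lemma integrableOn_of_isCompact {G : Type*} [NormedAddCommGroup G] [NormedSpace ℝ G]
    {L : Set (E n)} (hL : IsCompact L) {g : E n → G} (hg : Continuous g) : IntegrableOn g L :=
  hg.continuousOn.integrableOn_compact hL

/-- Differentiation under the integral sign: `L` is bounded, so the derivative of the integrand is
dominated by a constant on the unit ball around `x`. Allowing vector-valued `g` covers both
`laplace` (`g = 1`) and `laplaceVec` (`g = id`). -/
lemma hasFDerivAt_integral_exp_smul {G : Type*} [NormedAddCommGroup G] [NormedSpace ℝ G]
    {L : Set (E n)} (hL : IsCompact L) {g : E n → G} (hg : Continuous g) (x : E n) :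
    HasFDerivAt (fun x : E n => ∫ y in L, Real.exp (inner ℝ x y) • g y)
      (∫ y in L, Real.exp (inner ℝ x y) • (innerSL ℝ y).smulRight (g y)) x := by
  obtain ⟨R, hR⟩ := hL.isBounded.exists_norm_le
  obtain ⟨c, hc⟩ := hL.exists_bound_of_continuousOn hg.continuousOn
  have hfin : IsFiniteMeasure (volume.restrict L) :=
    ⟨by simpa using hL.measure_lt_top⟩
  have hcont : ∀ x : E n, Continuous fun y : E n => Real.exp (inner ℝ x y) • g y := by
    intro x; fun_prop
  refine hasFDerivAt_integral_of_dominated_of_fderiv_le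
    (F' := fun x y => Real.exp (inner ℝ x y) • (innerSL ℝ y).smulRight (g y))
    (bound := fun _ => Real.exp ((‖x‖ + 1) * R) * (R * c)) (Metric.ball_mem_nhds x one_pos)
    (Eventually.of_forall fun x => (hcont x).aestronglyMeasurable)
    ((hcont x).continuousOn.integrableOn_compact hL) ?_ ?_ (integrable_const _) ?_
  · have h2 : Continuous fun y : E n => (innerSL ℝ y).smulRight (g y) :=
      (ContinuousLinearMap.smulRightL ℝ (E n) G).continuous₂.comp
        ((innerSL ℝ).continuous.prodMk hg)
    have h1 : Continuous fun y : E n => Real.exp (inner ℝ x y) := by fun_prop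
    have := secondCountableTopologyEither_of_left (E n) (E n →L[ℝ] G)
    exact (h1.smul h2).aestronglyMeasurable
  · refine (ae_restrict_iff' hL.isClosed.measurableSet).2 (Eventually.of_forall fun y hy z hz => ?_)
    have hyR := hR y hy
    have hR0 : 0 ≤ R := (norm_nonneg _).trans hyR
    rw [norm_smul, ContinuousLinearMap.norm_smulRight_apply, Real.norm_of_nonneg (Real.exp_pos _).le,
      innerSL_apply_norm]
    have hz1 : ‖z‖ ≤ ‖x‖ + 1 := by
      have := norm_sub_norm_le z x
      rw [Metric.mem_ball, dist_eq_norm] at hz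
      linarith
    refine mul_le_mul (Real.exp_le_exp.2 ?_) (mul_le_mul hyR (hc y hy) (norm_nonneg _) hR0)
      (by positivity) (Real.exp_pos _).le
    calc inner ℝ z y ≤ ‖z‖ * ‖y‖ := real_inner_le_norm _ _
      _ ≤ (‖x‖ + 1) * R := mul_le_mul hz1 hyR (norm_nonneg _) (by positivity)
  · refine Eventually.of_forall fun y z _ => ?_
    have h1 : HasFDerivAt (fun z : E n => (inner ℝ z y : ℝ)) (innerSL ℝ y) z := by
      have := (innerSL ℝ y).hasFDerivAt (x := z)
      simpa [real_inner_comm] using this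
    have h2 := h1.exp.smul_const (g y)
    convert h2 using 1
    ext v
    simp [mul_smul]

lemma integrableOn_exp_smul {G : Type*} [NormedAddCommGroup G] [NormedSpace ℝ G]
    {L : Set (E n)} (hL : IsCompact L) {g : E n → G} (hg : Continuous g) (x : E n) :
    IntegrableOn (fun y : E n => Real.exp (inner ℝ x y) • g y) L :=
  integrableOn_of_isCompact hL (by fun_prop)

lemma laplace_pos {L : Set (E n)} (hL : IsCompact L) (hint : (interior L).Nonempty) (x : E n) :
    0 < laplace L x := by
  have hi : IntegrableOn (fun y : E n => Real.exp (inner ℝ x y)) L :=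
    integrableOn_of_isCompact hL (by fun_prop)
  rw [laplace, setIntegral_pos_iff_support_of_nonneg_ae
    (Eventually.of_forall fun y => (Real.exp_pos _).le) hi]
  have : Function.support (fun y : E n => Real.exp (inner ℝ x y)) = Set.univ :=
    Set.eq_univ_of_forall fun y => (Real.exp_pos _).ne'
  rw [this, Set.univ_inter]
  exact (isOpen_interior.measure_pos volume hint).trans_le (measure_mono interior_subset)

lemma hasFDerivAt_laplace {L : Set (E n)} (hL : IsCompact L) (x : E n) :
    HasFDerivAt (laplace L) (innerSL ℝ (laplaceVec L x)) x := by
  have h := hasFDerivAt_integral_exp_smul hL (g := fun _ : E n => (1 : ℝ)) continuous_const x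
  have e1 : (fun x : E n => ∫ y in L, Real.exp (inner ℝ x y) • (1 : ℝ)) = laplace L := by
    funext x; simp [laplace]
  rw [e1] at h
  have e2 : innerSL ℝ (laplaceVec L x) =
      ∫ y in L, Real.exp (inner ℝ x y) • (innerSL ℝ y).smulRight (1 : ℝ) := by
    refine (ContinuousLinearMap.integral_comp_comm (innerSL ℝ)
      (integrableOn_exp_smul hL (g := fun y : E n => y) continuous_id x)).symm.trans ?_
    refine integral_congr_ae (Eventually.of_forall fun y => ?_)
    ext v
    simp
    rfl
  rw [e2]
  exact h

lemma differentiable_laplaceVec {L : Set (E n)} (hL : IsCompact L) :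
    Differentiable ℝ (laplaceVec L) := fun x =>
  (hasFDerivAt_integral_exp_smul hL (g := fun y : E n => y) continuous_id x).differentiableAt

lemma differentiable_gradMap {L : Set (E n)} (hL : IsCompact L) (hint : (interior L).Nonempty) :
    Differentiable ℝ (gradMap L) := fun x =>
  DifferentiableAt.smul ((hasFDerivAt_laplace hL x).differentiableAt.inv (laplace_pos hL hint x).ne')
    (differentiable_laplaceVec hL x)

lemma hasFDerivAt_log_laplace {L : Set (E n)} (hL : IsCompact L) (hint : (interior L).Nonempty)
    (x : E n) : HasFDerivAt (fun x => Real.log (laplace L x)) (innerSL ℝ (gradMap L x)) x := by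
  have := (hasFDerivAt_laplace hL x).log (laplace_pos hL hint x).ne'
  rwa [gradMap, map_smul]

lemma gradMap_mem {L : Set (E n)} (hL : IsCompact L) (hconv : Convex ℝ L)
    (hint : (interior L).Nonempty) (x : E n) : gradMap L x ∈ L := by
  have hfin : IsFiniteMeasure (volume.restrict L) := ⟨by simpa using hL.measure_lt_top⟩
  have hpos := laplace_pos hL hint x
  by_contra hmem
  obtain ⟨f, u, h1, h2⟩ := geometric_hahn_banach_closed_point hconv hL.isClosed hmem
  have hi := integrableOn_exp_smul hL (g := fun y : E n => y) continuous_id x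
  have e1 : f (laplaceVec L x) = ∫ y in L, Real.exp (inner ℝ x y) * f y := by
    rw [laplaceVec, ← f.integral_comp_comm hi]
    simp
  have hle : ∫ y in L, Real.exp (inner ℝ x y) * f y ≤ ∫ y in L, Real.exp (inner ℝ x y) * u := by
    refine setIntegral_mono_on
      (integrableOn_of_isCompact hL (by fun_prop))
      (integrableOn_of_isCompact hL (by fun_prop)) hL.isClosed.measurableSet ?_
    intro y hy
    exact mul_le_mul_of_nonneg_left (h1 y hy).le (Real.exp_pos _).le
  rw [integral_mul_const] at hle
  rw [gradMap, map_smul, e1, smul_eq_mul] at h2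
  have : (laplace L x)⁻¹ * ∫ y in L, Real.exp (inner ℝ x y) * f y ≤ u := by
    rw [inv_mul_le_iff₀ hpos]
    exact hle
  linarith

lemma volume_hyperplane_eq_zero {e : E n} (he : e ≠ 0) (c : ℝ) :
    volume {y : E n | inner ℝ e y = c} = 0 := by
  by_cases hne : ∃ y₀ : E n, inner ℝ e y₀ = c
  · obtain ⟨y₀, hy₀⟩ := hne
    have hset : {y : E n | inner ℝ e y = c} =
        (AffineSubspace.mk' y₀ (LinearMap.ker (innerSL ℝ e : E n →ₗ[ℝ] ℝ)) : Set (E n)) := by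
      ext y
      simp [inner_sub_right, ← hy₀, sub_eq_zero]
    rw [hset]
    refine Measure.addHaar_affineSubspace _ _ ?_
    intro htop
    have h1 : (y₀ + e) ∈ AffineSubspace.mk' y₀ (LinearMap.ker (innerSL ℝ e : E n →ₗ[ℝ] ℝ)) := by
      rw [htop]; exact AffineSubspace.mem_top _ _ _
    simp at h1
    exact he h1
  · push Not at hne
    have : {y : E n | inner ℝ e y = c} = ∅ := Set.eq_empty_of_forall_notMem fun y hy => hne y hy
    rw [this, measure_empty]

/-- A Chebyshev-type correlation inequality. With `e = x - x'` and `m` the `x'`-tilted mean of `⟨e,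
y⟩`, the integrand `exp ⟨x', y⟩ (exp ⟨e, y⟩ - exp m) (⟨e, y⟩ - m)` is nonnegative and vanishes only
on a hyperplane, which is null. -/
lemma gradMap_strictMono {L : Set (E n)} (hL : IsCompact L) (hint : (interior L).Nonempty)
    {x x' : E n} (hne : x ≠ x') : 0 < inner ℝ (gradMap L x - gradMap L x') (x - x') := by
  set e := x - x' with he
  have he0 : e ≠ 0 := sub_ne_zero.2 hne
  have hp := laplace_pos hL hint x
  have hp' := laplace_pos hL hint x'
  have key : ∀ z : E n, inner ℝ (laplaceVec L z) e =
      ∫ y in L, Real.exp (inner ℝ z y) * inner ℝ e y := by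
    intro z
    rw [real_inner_comm, laplaceVec,
      ← integral_inner (integrableOn_exp_smul hL (g := fun y : E n => y) continuous_id z)]
    simp [inner_smul_right]
  set m : ℝ := inner ℝ (gradMap L x') e with hm
  have hm' : ∫ y in L, Real.exp (inner ℝ x' y) * (inner ℝ e y - m) = 0 := by
    simp only [mul_sub]
    rw [integral_sub, integral_mul_const, ← key, hm, gradMap, inner_smul_left]
    · simp only [laplace, conj_trivial] at hp' ⊢
      field_simp
      ring
    · exact integrableOn_of_isCompact hL (by fun_prop)
    · exact integrableOn_of_isCompact hL (by fun_prop)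
  have hpos : 0 < ∫ y in L, (Real.exp (inner ℝ x y) * (inner ℝ e y - m)
      - Real.exp m * (Real.exp (inner ℝ x' y) * (inner ℝ e y - m))) := by
    have hnn : ∀ y : E n, 0 ≤ Real.exp (inner ℝ x y) * (inner ℝ e y - m)
        - Real.exp m * (Real.exp (inner ℝ x' y) * (inner ℝ e y - m)) ∧
        (inner ℝ e y ≠ m → Real.exp (inner ℝ x y) * (inner ℝ e y - m)
        - Real.exp m * (Real.exp (inner ℝ x' y) * (inner ℝ e y - m)) ≠ 0) := by
      intro y
      have hx : (inner ℝ x y : ℝ) = inner ℝ e y + inner ℝ x' y := by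
        rw [he, inner_sub_left]; ring
      have hfac : Real.exp (inner ℝ x y) * (inner ℝ e y - m)
        - Real.exp m * (Real.exp (inner ℝ x' y) * (inner ℝ e y - m)) =
        Real.exp (inner ℝ x' y) * ((Real.exp (inner ℝ e y) - Real.exp m) * (inner ℝ e y - m)) := by
        rw [hx, Real.exp_add]; ring
      rw [hfac]
      rcases lt_trichotomy (inner ℝ e y : ℝ) m with h | h | h
      · have := Real.exp_lt_exp.2 h
        have h3 := mul_pos (Real.exp_pos (inner ℝ x' y))
          (mul_pos_of_neg_of_neg (sub_neg.2 this) (sub_neg.2 h))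
        exact ⟨h3.le, fun _ => h3.ne'⟩
      · rw [h]; simp
      · have := Real.exp_lt_exp.2 h
        have h3 := mul_pos (Real.exp_pos (inner ℝ x' y))
          (mul_pos (sub_pos.2 this) (sub_pos.2 h))
        exact ⟨h3.le, fun _ => h3.ne'⟩
    rw [setIntegral_pos_iff_support_of_nonneg_ae (Eventually.of_forall fun y => (hnn y).1)
      (integrableOn_of_isCompact hL (by fun_prop))]
    have hvL : 0 < volume L :=
      (isOpen_interior.measure_pos volume hint).trans_le (measure_mono interior_subset)
    have hd : volume (L \ {y : E n | inner ℝ e y = m}) = volume L :=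
      measure_sdiff_null (volume_hyperplane_eq_zero he0 m)
    rw [← hd] at hvL
    refine hvL.trans_le (measure_mono fun y hy => ⟨(hnn y).2 hy.2, hy.1⟩)
  rw [integral_sub (integrableOn_of_isCompact hL (by fun_prop))
    (integrableOn_of_isCompact hL (by fun_prop)), integral_const_mul, hm', mul_zero,
    sub_zero] at hpos
  simp only [mul_sub] at hpos
  rw [integral_sub (integrableOn_of_isCompact hL (by fun_prop))
    (integrableOn_of_isCompact hL (by fun_prop)), integral_mul_const, ← key] at hpos
  rw [inner_sub_left, ← hm, gradMap, inner_smul_left]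
  simp only [conj_trivial]
  have : m < (laplace L x)⁻¹ * inner ℝ (laplaceVec L x) e := by
    rw [lt_inv_mul_iff₀ hp]
    exact sub_pos.1 hpos
  linarith

/-- `log ∘ laplace L` is bounded below by the support function of `L` up to sublinear error. -/
lemma exists_le_log_laplace {L : Set (E n)} (hL : IsCompact L) (hconv : Convex ℝ L)
    (hint : (interior L).Nonempty) {κ : ℝ} (hκ : 0 < κ) :
    ∃ c : ℝ, ∀ x : E n, ∀ y ∈ L, inner ℝ x y - κ * ‖x‖ - c ≤ Real.log (laplace L x) := by
  obtain ⟨R, hR⟩ := hL.isBounded.exists_norm_le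
  set D := 2 * |R| + 1
  have hD : 0 < D := by positivity
  set θ := min 1 (κ / D)
  have hθ : 0 < θ := lt_min one_pos (by positivity)
  have hvL : 0 < volume.real L := ENNReal.toReal_pos
    ((isOpen_interior.measure_pos volume hint).trans_le (measure_mono interior_subset)).ne'
    hL.measure_lt_top.ne
  refine ⟨-Real.log (θ ^ n * volume.real L), fun x y hy => ?_⟩
  -- A copy of `L` shrunk about `y` stays in `L` and has volume `θ ^ n |L|`. On it `⟨x, ·⟩` drops
  -- below `⟨x, y⟩` by at most `θ D ‖x‖ ≤ κ ‖x‖`.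
  set S : Set (E n) := (fun z => y + θ • (z - y)) '' L with hS
  have hSL : S ⊆ L := by
    rintro _ ⟨z, hz, rfl⟩
    have := hconv.add_smul_sub_mem hy hz ⟨hθ.le, min_le_left _ _⟩
    simpa using this
  have hScomp : IsCompact S := hL.image (by fun_prop)
  have hSv : volume.real S = θ ^ n * volume.real L := by
    have : S = AffineMap.homothety y θ '' L := by
      rw [hS]; refine Set.image_congr fun z _ => ?_
      simp [AffineMap.homothety_apply, add_comm]
    rw [this, measureReal_def, Measure.addHaar_image_homothety]
    simp only [ENNReal.toReal_mul, finrank_euclideanSpace_fin]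
    rw [ENNReal.toReal_ofReal (abs_nonneg _), abs_of_nonneg (by positivity), measureReal_def]
  have hlow : ∀ z ∈ S, Real.exp (inner ℝ x y - κ * ‖x‖) ≤ Real.exp (inner ℝ x z) := by
    rintro _ ⟨z, hz, rfl⟩
    refine Real.exp_le_exp.2 ?_
    rw [inner_add_right, inner_smul_right]
    have h1 : |(inner ℝ x (z - y) : ℝ)| ≤ ‖x‖ * D := by
      refine (abs_real_inner_le_norm _ _).trans (mul_le_mul_of_nonneg_left ?_ (norm_nonneg _))
      have := norm_sub_le z y
      have := hR z hz; have := hR y hy; have := le_abs_self R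
      simp only [D]; linarith
    have h2 : θ * D ≤ κ := by
      calc θ * D ≤ κ / D * D := mul_le_mul_of_nonneg_right (min_le_right _ _) hD.le
        _ = κ := by field_simp
    have h3 := (abs_le.1 h1).1
    nlinarith [norm_nonneg x, mul_le_mul_of_nonneg_left h3 hθ.le,
      mul_le_mul_of_nonneg_right h2 (norm_nonneg x)]
  have hlap : Real.exp (inner ℝ x y - κ * ‖x‖) * (θ ^ n * volume.real L) ≤ laplace L x := by
    rw [← hSv, mul_comm]
    calc volume.real S * Real.exp (inner ℝ x y - κ * ‖x‖)
        = ∫ z in S, Real.exp (inner ℝ x y - κ * ‖x‖) := by simp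
      _ ≤ ∫ z in S, Real.exp (inner ℝ x z) := by
        refine setIntegral_mono_on (continuousOn_const.integrableOn_compact hScomp)
          (integrableOn_of_isCompact hScomp (by fun_prop))
          hScomp.isClosed.measurableSet hlow
      _ ≤ laplace L x := by
        refine setIntegral_mono_set (integrableOn_of_isCompact hL (by fun_prop))
          (Eventually.of_forall fun z => (Real.exp_pos _).le) hSL.eventuallyLE
  have hpos : 0 < θ ^ n * volume.real L := by positivity
  have := Real.log_le_log (mul_pos (Real.exp_pos _) hpos) hlap
  rw [Real.log_mul (Real.exp_pos _).ne' hpos.ne', Real.log_exp] at this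
  linarith

end

section

variable {n : ℕ}

/-! ### Volumes of Minkowski sums by change of variables -/

/-- Along the segment from `A` to the identity the determinant would change sign. At a zero with
weight `s > 0` a kernel vector `v` gives `(1 - s) ⟨A v, v⟩ + s ‖v‖² = 0`, which is impossible. -/
lemma det_nonneg_of_inner_nonneg (A : E n →L[ℝ] E n) (hA : ∀ v, 0 ≤ (inner ℝ (A v) v : ℝ)) :
    0 ≤ A.det := by
  by_contra! hneg
  let f : ℝ → ℝ := fun s => ((1 - s) • A + s • ContinuousLinearMap.id ℝ (E n)).det
  have hf : Continuous f := ContinuousLinearMap.continuous_det.comp (by fun_prop)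
  have hA0 : (1 - (0 : ℝ)) • A + (0 : ℝ) • ContinuousLinearMap.id ℝ (E n) = A := by
    ext v; simp
  have h0 : f 0 < 0 := by simpa only [f, hA0] using hneg
  have h1 : f 1 = 1 := by simp [f, ContinuousLinearMap.det]
  obtain ⟨s, hs, hs0⟩ := intermediate_value_Icc zero_le_one hf.continuousOn
    ⟨h0.le, by rw [h1]; exact zero_le_one⟩
  have hspos : 0 < s := lt_of_le_of_ne hs.1 fun h => by rw [← h] at hs0; exact h0.ne hs0
  have hker := LinearMap.bot_lt_ker_of_det_eq_zero
    (f := (((1 - s) • A + s • ContinuousLinearMap.id ℝ (E n) : E n →L[ℝ] E n) : E n →ₗ[ℝ] E n)) hs0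
  obtain ⟨v, hv, hv0⟩ := (Submodule.ne_bot_iff _).1 hker.ne'
  have h2 : (1 - s) • A v + s • v = 0 := by simpa using hv
  have h3 : (1 - s) * inner ℝ (A v) v + s * inner ℝ v v = (0 : ℝ) := by
    have := congrArg (fun w => (inner ℝ w v : ℝ)) h2
    simpa [inner_add_left, inner_smul_left] using this
  have h4 : 0 < (inner ℝ v v : ℝ) := real_inner_self_pos.2 hv0
  nlinarith [mul_nonneg (sub_nonneg.2 hs.2) (hA v), mul_pos hspos h4]

lemma inner_fderiv_nonneg_of_monotone {T : E n → E n}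
    (hT : ∀ x x', 0 ≤ (inner ℝ (T x - T x') (x - x') : ℝ)) {A : E n →L[ℝ] E n} {x : E n}
    (hA : HasFDerivAt T A x) (v : E n) : 0 ≤ (inner ℝ (A v) v : ℝ) := by
  have h1 := hA.hasLineDerivAt v
  have h2 : Tendsto (fun t : ℝ => (inner ℝ (t⁻¹ • (T (x + t • v) - T x)) v : ℝ)) (𝓝[≠] 0)
      (𝓝 (inner ℝ (A v) v)) :=
    (h1.tendsto_slope_zero).inner tendsto_const_nhds
  refine ge_of_tendsto (h2.mono_left (nhdsWithin_mono 0 fun t (ht : 0 < t) => ht.ne' :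
    𝓝[>] (0 : ℝ) ≤ 𝓝[≠] 0)) ?_
  filter_upwards [self_mem_nhdsWithin] with t ht
  have h3 := hT (x + t • v) x
  rw [add_sub_cancel_left, inner_smul_right] at h3
  rw [inner_smul_left]
  exact mul_nonneg (by simpa using (inv_pos.2 (Set.mem_Ioi.1 ht)).le) (nonneg_of_mul_nonneg_right h3 ht)

variable {ι : Type*} [Fintype ι]

/-- The gradient map of `∑ i, l i • log ∘ laplace (L i)`. -/
def sumGradMap (L : ι → Set (E n)) (l : ι → ℝ) (x : E n) : E n := ∑ i, l i • gradMap (L i) x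

section

variable {L : ι → Set (E n)} (hL : ∀ i, IsCompact (L i)) (hconv : ∀ i, Convex ℝ (L i))
  (hint : ∀ i, (interior (L i)).Nonempty) {l : ι → ℝ} (hl : ∀ i, 0 ≤ l i) (hl0 : ∃ i, 0 < l i)

include hL hint hl in
lemma sumGradMap_monotone (x x' : E n) :
    0 ≤ (inner ℝ (sumGradMap L l x - sumGradMap L l x') (x - x') : ℝ) := by
  rw [sumGradMap, sumGradMap, ← Finset.sum_sub_distrib, sum_inner]
  refine Finset.sum_nonneg fun i _ => ?_
  rw [← smul_sub, inner_smul_left]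
  refine mul_nonneg (by simpa using hl i) ?_
  rcases eq_or_ne x x' with rfl | hne
  · simp
  · exact (gradMap_strictMono (hL i) (hint i) hne).le

include hL hint hl hl0 in
lemma sumGradMap_injective : Function.Injective (sumGradMap L l) := by
  intro x x' hxx
  by_contra hne
  obtain ⟨j, hj⟩ := hl0
  have : 0 < (inner ℝ (sumGradMap L l x - sumGradMap L l x') (x - x') : ℝ) := by
    rw [sumGradMap, sumGradMap, ← Finset.sum_sub_distrib, sum_inner]
    refine Finset.sum_pos' (fun i _ => ?_) ⟨j, Finset.mem_univ _, ?_⟩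
    · rw [← smul_sub, inner_smul_left]
      exact mul_nonneg (by simpa using hl i) (gradMap_strictMono (hL i) (hint i) hne).le
    · rw [← smul_sub, inner_smul_left]
      exact mul_pos (by simpa using hj) (gradMap_strictMono (hL j) (hint j) hne)
  rw [hxx, sub_self, inner_zero_left] at this
  exact lt_irrefl _ this

include hL hint in
lemma hasFDerivAt_sumGradMap (x : E n) :
    HasFDerivAt (sumGradMap L l) (∑ i, l i • fderiv ℝ (gradMap (L i)) x) x := by
  refine HasFDerivAt.fun_sum fun i _ => ?_
  exact ((differentiable_gradMap (hL i) (hint i)) x).hasFDerivAt.const_smul (l i)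

/-- The Minkowski combination `∑ i, l i • L i`. -/
def minkowskiSum (L : ι → Set (E n)) (l : ι → ℝ) : Set (E n) :=
  {x | ∃ y : ι → E n, (∀ i, y i ∈ L i) ∧ ∑ i, l i • y i = x}

include hL hconv hint in
lemma sumGradMap_mem (x : E n) : sumGradMap L l x ∈ minkowskiSum L l :=
  ⟨fun i => gradMap (L i) x, fun i => gradMap_mem (hL i) (hconv i) (hint i) x, rfl⟩

include hL hconv hint hl in
-- A point `p` is attained when the convex potential minus `⟨x, p⟩` has a critical point. For `p`
-- interior this function is coercive, since the potential grows like the support function of the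
-- combination, which exceeds `⟨x, p⟩` by `ε ‖x‖`; its minimum is the desired preimage.
lemma interior_minkowskiSum_subset :
    interior (minkowskiSum L l) ⊆ Set.range (sumGradMap L l) := by
  intro p hp
  obtain ⟨ε, hε, hball⟩ := Metric.nhds_basis_closedBall.mem_iff.1 (mem_interior_iff_mem_nhds.1 hp)
  set Λ : ℝ := ∑ i, l i
  have hΛ : 0 ≤ Λ := Finset.sum_nonneg fun i _ => hl i
  -- Chosen so that the total sublinear error `Λ κ ‖x‖` uses at most half of the margin `ε ‖x‖`; the
  -- `+ 1` avoids dividing by zero when all coefficients vanish.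
  set κ : ℝ := ε / (2 * (Λ + 1))
  have hκ : 0 < κ := by positivity
  choose c hc using fun i => exists_le_log_laplace (hL i) (hconv i) (hint i) hκ
  let Ψ : E n → ℝ := fun x => ∑ i, l i * Real.log (laplace (L i) x) - inner ℝ x p
  have hder : ∀ x, HasFDerivAt Ψ (innerSL ℝ (sumGradMap L l x - p)) x := by
    intro x
    have h1 : HasFDerivAt (fun x => ∑ i, l i * Real.log (laplace (L i) x))
        (∑ i, l i • innerSL ℝ (gradMap (L i) x)) x :=
      HasFDerivAt.fun_sum fun i _ => (hasFDerivAt_log_laplace (hL i) (hint i) x).const_smul (l i)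
    have h2 : HasFDerivAt (fun x : E n => (inner ℝ x p : ℝ)) (innerSL ℝ p) x := by
      simpa [real_inner_comm] using (innerSL ℝ p).hasFDerivAt (x := x)
    have h3 := h1.fun_sub h2
    have h4 : innerSL ℝ (sumGradMap L l x - p) =
        ∑ i, l i • innerSL ℝ (gradMap (L i) x) - innerSL ℝ p := by
      rw [map_sub, sumGradMap, map_sum]
      simp only [map_smul]
    rw [h4]
    exact h3
  have hlow : ∀ x, ε / 2 * ‖x‖ - ∑ i, l i * c i ≤ Ψ x := by
    intro x
    have hmem : p + (ε / ‖x‖) • x ∈ minkowskiSum L l := by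
      apply hball
      rw [Metric.mem_closedBall, dist_eq_norm, add_sub_cancel_left, norm_smul, norm_div, norm_norm,
        Real.norm_of_nonneg hε.le]
      rcases eq_or_ne ‖x‖ 0 with h | h
      · rw [h]; simpa using hε.le
      · rw [div_mul_cancel₀ _ h]
    obtain ⟨y, hy, hsum⟩ := hmem
    have hin : ∑ i, l i * inner ℝ x (y i) = inner ℝ x p + ε * ‖x‖ := by
      have := congrArg (fun w => (inner ℝ x w : ℝ)) hsum
      simp only [inner_sum, inner_smul_right, inner_add_right, real_inner_self_eq_norm_sq] at this
      rw [this]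
      rcases eq_or_ne ‖x‖ 0 with h | h
      · simp [h]
      · field_simp
    have hs : ∑ i, l i * (inner ℝ x (y i) - κ * ‖x‖ - c i) ≤
        ∑ i, l i * Real.log (laplace (L i) x) :=
      Finset.sum_le_sum fun i _ => mul_le_mul_of_nonneg_left (hc i x (y i) (hy i)) (hl i)
    simp only [mul_sub, Finset.sum_sub_distrib, ← Finset.sum_mul] at hs
    rw [hin] at hs
    have hκΛ : Λ * κ ≤ ε / 2 := by
      have : Λ * κ = ε / 2 * (Λ / (Λ + 1)) := by simp only [κ]; field_simp
      rw [this]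
      exact mul_le_of_le_one_right (by positivity) ((div_le_one (by positivity)).2 (by linarith))
    have := mul_le_mul_of_nonneg_right hκΛ (norm_nonneg x)
    simp only [Ψ]
    nlinarith
  have hcoer : Tendsto Ψ (cocompact (E n)) atTop := by
    refine tendsto_atTop_mono hlow ?_
    have := (tendsto_norm_cocompact_atTop (E := E n)).const_mul_atTop (half_pos hε)
    exact tendsto_atTop_add_const_right _ _ this
  have hcontΨ : Continuous Ψ := continuous_iff_continuousAt.2 fun x => (hder x).continuousAt
  obtain ⟨x, hx⟩ := hcontΨ.exists_forall_le hcoer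
  have hmin : IsLocalMin Ψ x := Eventually.of_forall hx
  have h0 := hmin.hasFDerivAt_eq_zero (hder x)
  refine ⟨x, ?_⟩
  have h1 := congrArg (fun f => f (sumGradMap L l x - p)) h0
  simp only [innerSL_apply_apply, zero_apply] at h1
  exact sub_eq_zero.1 (inner_self_eq_zero.1 h1)

include hconv in
lemma convex_minkowskiSum : Convex ℝ (minkowskiSum L l) := by
  rintro _ ⟨y, hy, rfl⟩ _ ⟨z, hz, rfl⟩ a b ha hb hab
  refine ⟨fun i => a • y i + b • z i, fun i => hconv i (hy i) (hz i) ha hb hab, ?_⟩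
  simp only [smul_add, Finset.sum_add_distrib, Finset.smul_sum]
  congr 1 <;> exact Finset.sum_congr rfl fun i _ => smul_comm _ _ _

include hL in
lemma isCompact_minkowskiSum : IsCompact (minkowskiSum L l) := by
  have : minkowskiSum L l = (fun y : ι → E n => ∑ i, l i • y i) '' Set.univ.pi L := by
    ext x
    simp [minkowskiSum]
  rw [this]
  exact (isCompact_univ_pi hL).image (by fun_prop)

include hL hint hl in
lemma det_sum_fderiv_nonneg (x : E n) :
    0 ≤ (∑ i, l i • fderiv ℝ (gradMap (L i)) x).det :=
  det_nonneg_of_inner_nonneg _ fun v =>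
    inner_fderiv_nonneg_of_monotone (sumGradMap_monotone hL hint hl)
      (hasFDerivAt_sumGradMap hL hint x) v

include hL hconv hint hl hl0 in
/-- The volume of a Minkowski combination as the integral of a determinant. -/
lemma lintegral_det_eq_volume_minkowskiSum :
    ∫⁻ x, ENNReal.ofReal (∑ i, l i • fderiv ℝ (gradMap (L i)) x).det =
      volume (minkowskiSum L l) := by
  have h1 := lintegral_abs_det_fderiv_eq_addHaar_image (volume : Measure (E n)) MeasurableSet.univ
    (fun x _ => (hasFDerivAt_sumGradMap (l := l) hL hint x).hasFDerivWithinAt)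
    (sumGradMap_injective hL hint hl hl0).injOn
  rw [Measure.restrict_univ, Set.image_univ] at h1
  simp only [abs_of_nonneg (det_sum_fderiv_nonneg hL hint hl _)] at h1
  rw [h1]
  -- The range lies between the interior of the combination and the combination itself, and the
  -- frontier of a convex set is null.
  refine le_antisymm (measure_mono (Set.range_subset_iff.2 (sumGradMap_mem hL hconv hint))) ?_
  calc volume (minkowskiSum L l)
      ≤ volume (closure (minkowskiSum L l)) := measure_mono subset_closure
    _ ≤ volume (interior (minkowskiSum L l)) + volume (frontier (minkowskiSum L l)) := by
        rw [closure_eq_interior_union_frontier]; exact measure_union_le _ _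
    _ = volume (interior (minkowskiSum L l)) := by
        rw [(convex_minkowskiSum hconv).addHaar_frontier volume, add_zero]
    _ ≤ _ := measure_mono (interior_minkowskiSum_subset hL hconv hint hl)

include hL hconv hint hl hl0 in
lemma integrable_det_sum_fderiv :
    Integrable (fun x => (∑ i, l i • fderiv ℝ (gradMap (L i)) x).det) ∧
    ∫ x, (∑ i, l i • fderiv ℝ (gradMap (L i)) x).det = volume.real (minkowskiSum L l) := by
  have hmeas : AEStronglyMeasurable (fun x => (∑ i, l i • fderiv ℝ (gradMap (L i)) x).det)
      (volume : Measure (E n)) := by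
    refine (Measurable.comp (g := fun A : E n →L[ℝ] E n => A.det)
      ContinuousLinearMap.continuous_det.measurable ?_).aestronglyMeasurable
    exact Finset.measurable_fun_sum _ fun i _ => (measurable_fderiv ℝ (gradMap (L i))).const_smul (l i)
  have hnn := fun x => det_sum_fderiv_nonneg hL hint hl x
  have hlint := lintegral_det_eq_volume_minkowskiSum hL hconv hint hl hl0
  constructor
  · refine (lintegral_ofReal_ne_top_iff_integrable hmeas (Eventually.of_forall hnn)).1 ?_
    rw [hlint]
    exact (isCompact_minkowskiSum hL).measure_lt_top.ne
  · rw [integral_eq_lintegral_of_nonneg_ae (Eventually.of_forall hnn) hmeas, hlint, measureReal_def]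

end

end

section

variable {n : ℕ}

/-! ### Polynomiality of the volume of Minkowski combinations -/

/-- The determinant of the matrix whose `r`-th row is the `r`-th row of `M (φ r)`. -/
def rowDet {ι : Type*} (M : ι → Matrix (Fin n) (Fin n) ℝ) (φ : Fin n → ι) : ℝ :=
  (Matrix.of fun r => M (φ r) r).det

lemma det_sum_smul_eq {ι : Type*} [Fintype ι] (M : ι → Matrix (Fin n) (Fin n) ℝ) (l : ι → ℝ) :
    (∑ i, l i • M i).det = ∑ φ : Fin n → ι, (∏ r, l (φ r)) * rowDet M φ := by
  classical
  have h1 : (∑ i, l i • M i).det =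
      (Matrix.detRowAlternating : (Fin n → ℝ) [⋀^Fin n]→ₗ[ℝ] ℝ).toMultilinearMap
        (fun r => ∑ i, l i • M i r) := by
    have : (∑ i, l i • M i) = Matrix.of (fun r => ∑ i, l i • M i r) := by
      ext r c
      simp [Matrix.sum_apply]
    rw [this]; rfl
  rw [h1, MultilinearMap.map_sum]
  refine Finset.sum_congr rfl fun φ _ => ?_
  rw [MultilinearMap.map_smul_univ]
  rfl

lemma exists_det_expansion {ι : Type*} [Fintype ι] (A : ι → E n →L[ℝ] E n) :
    ∃ d : (Fin n → ι) → ℝ, ∀ l : ι → ℝ,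
      (∑ i, l i • A i).det = ∑ φ : Fin n → ι, (∏ r, l (φ r)) * d φ := by
  let b := (EuclideanSpace.basisFun (Fin n) ℝ).toBasis
  refine ⟨rowDet fun i => LinearMap.toMatrix b b (A i : E n →ₗ[ℝ] E n), fun l => ?_⟩
  rw [← det_sum_smul_eq, ContinuousLinearMap.det, ← LinearMap.det_toMatrix b]
  congr 1
  have : ((∑ i, l i • A i : E n →L[ℝ] E n) : E n →ₗ[ℝ] E n) =
      ∑ i, l i • (A i : E n →ₗ[ℝ] E n) := by
    ext v; simp
  rw [this, map_sum]
  simp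

/-- By Lagrange interpolation each coefficient is a fixed linear combination of the values at `0, …,
N`. Integrability of the values therefore suffices, and no measurability of the coefficients has to
be known beforehand. -/
lemma integrable_coeff {X : Type*} [MeasurableSpace X] {μ : Measure X} {N : ℕ}
    (P : X → Polynomial ℝ) (hdeg : ∀ x, (P x).natDegree ≤ N)
    (hP : ∀ s : ℕ, Integrable (fun x => (P x).eval (s : ℝ)) μ) (k : ℕ) :
    Integrable (fun x => (P x).coeff k) μ := by
  have hinj : Set.InjOn (fun s : ℕ => (s : ℝ)) (Finset.range (N + 1)) :=
    fun a _ b _ h => Nat.cast_injective h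
  have h : ∀ x, (P x).coeff k = ∑ s ∈ Finset.range (N + 1), (P x).eval (s : ℝ) *
      (Lagrange.basis (Finset.range (N + 1)) (fun s : ℕ => (s : ℝ)) s).coeff k := by
    intro x
    have hd : (P x).degree < (Finset.range (N + 1)).card := by
      rw [Finset.card_range]
      exact (Polynomial.degree_le_of_natDegree_le (hdeg x)).trans_lt
        (by exact_mod_cast Nat.lt_succ_self N)
    conv_lhs => rw [Lagrange.eq_interpolate hinj hd, Lagrange.interpolate_apply]
    simp
  simp_rw [h]
  exact integrable_finsetSum _ fun s _ => (hP s).mul_const _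

/-- The number of occurrences of `k` among the values of `φ`. -/
def occ (φ : Fin n → Fin 3) (k : Fin 3) : ℕ := (Finset.univ.filter fun r => φ r = k).card

lemma occ_sum (φ : Fin n → Fin 3) : occ φ 0 + occ φ 1 + occ φ 2 = n := by
  have := Finset.card_eq_sum_card_fiberwise (s := (Finset.univ : Finset (Fin n)))
    (t := (Finset.univ : Finset (Fin 3))) (f := φ) (fun _ _ => Finset.mem_coe.2 (Finset.mem_univ _))
  rw [Fin.sum_univ_three, Finset.card_univ, Fintype.card_fin] at this
  exact this.symm

lemma prod_comp_eq_occ (φ : Fin n → Fin 3) {R : Type*} [CommMonoid R] (l : Fin 3 → R) :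
    ∏ r, l (φ r) = l 0 ^ occ φ 0 * l 1 ^ occ φ 1 * l 2 ^ occ φ 2 := by
  rw [← Finset.prod_fiberwise (s := (Finset.univ : Finset (Fin n))) (g := φ), Fin.prod_univ_three]
  congr 1
  · congr 1 <;>
    · rw [occ, Finset.prod_congr rfl (g := fun _ => l _), Finset.prod_const]
      intro r hr; rw [(Finset.mem_filter.1 hr).2]
  · rw [occ, Finset.prod_congr rfl (g := fun _ => l _), Finset.prod_const]
    intro r hr; rw [(Finset.mem_filter.1 hr).2]

/-- The individual `d x φ` are arbitrary choices and need not be measurable in `x`. Only the sums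
over all `φ` with prescribed occurrence numbers of `1` and `2` are integrated; these are
coefficients of an integrable family of polynomials. -/
lemma integral_eq_poly {X : Type*} [MeasurableSpace X] {μ : Measure X}
    (d : X → (Fin n → Fin 3) → ℝ)
    (hint : ∀ l : Fin 3 → ℝ, (∀ i, 0 ≤ l i) → 0 < l 0 →
      Integrable (fun x => ∑ φ, (∏ r, l (φ r)) * d x φ) μ) :
    ∃ c : ℕ → ℕ → ℝ, (∀ i j, n < i + j → c i j = 0) ∧ ∀ l : Fin 3 → ℝ,
      ∫ x, ∑ φ, (∏ r, l (φ r)) * d x φ ∂μ =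
        ∑ i ∈ Finset.range (n + 1), ∑ j ∈ Finset.range (n + 1),
          c i j * l 1 ^ i * l 2 ^ j * l 0 ^ (n - i - j) := by
  classical
  let D : ℕ → ℕ → X → ℝ := fun i j x =>
    ∑ φ ∈ Finset.univ.filter (fun φ : Fin n → Fin 3 => occ φ 1 = i ∧ occ φ 2 = j), d x φ
  -- Kronecker substitution: both occurrence numbers are below `n + 1`, so they are the digits of `e
  -- φ` in base `n + 1`, and two variables are reduced to one.
  let e : (Fin n → Fin 3) → ℕ := fun φ => occ φ 1 + (n + 1) * occ φ 2
  let P : X → Polynomial ℝ := fun x => ∑ φ, Polynomial.monomial (e φ) (d x φ)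
  have hle : ∀ (φ : Fin n → Fin 3), occ φ 1 < n + 1 ∧ occ φ 2 < n + 1 := by
    intro φ; have := occ_sum φ; omega
  have hPdeg : ∀ x, (P x).natDegree ≤ n + (n + 1) * n := by
    intro x
    refine Polynomial.natDegree_sum_le_of_forall_le _ _ fun φ _ => ?_
    refine (Polynomial.natDegree_monomial_le _).trans ?_
    have h1 := hle φ
    exact Nat.add_le_add (by omega) (Nat.mul_le_mul_left _ (by omega))
  have hPeval : ∀ s : ℕ, Integrable (fun x => (P x).eval (s : ℝ)) μ := by
    intro s
    refine (hint ![1, (s : ℝ), (s : ℝ) ^ (n + 1)] ?_ (by simp)).congr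
      (Eventually.of_forall fun x => ?_)
    · intro i; fin_cases i <;> simp
    · simp only [P, Polynomial.eval_finsetSum, Polynomial.eval_monomial, prod_comp_eq_occ, e]
      refine Finset.sum_congr rfl fun φ _ => ?_
      simp [pow_add, pow_mul, mul_comm]
  have hPD : ∀ i j x, i < n + 1 → (P x).coeff (i + (n + 1) * j) = D i j x := by
    intro i j x hi
    simp only [P, D, Polynomial.finsetSum_coeff, Polynomial.coeff_monomial, Finset.sum_filter]
    refine Finset.sum_congr rfl fun φ _ => ?_
    have h1 := hle φ
    have : e φ = i + (n + 1) * j ↔ occ φ 1 = i ∧ occ φ 2 = j := by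
      constructor
      · intro h
        have hm := congrArg (· % (n + 1)) h
        have hd := congrArg (· / (n + 1)) h
        simp only [e, Nat.add_mul_mod_self_left, Nat.mod_eq_of_lt h1.1, Nat.mod_eq_of_lt hi] at hm
        simp only [e, Nat.add_mul_div_left _ _ (Nat.succ_pos n), Nat.div_eq_of_lt h1.1,
          Nat.div_eq_of_lt hi, zero_add] at hd
        exact ⟨hm, hd⟩
      · rintro ⟨rfl, rfl⟩; rfl
    simp only [this]
  have hDint : ∀ i j, i < n + 1 → Integrable (D i j) μ := by
    intro i j hi
    refine (integrable_coeff P hPdeg hPeval (i + (n + 1) * j)).congr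
      (Eventually.of_forall fun x => hPD i j x hi)
  refine ⟨fun i j => ∫ x, D i j x ∂μ, ?_, ?_⟩
  · intro i j hij
    have : ∀ x, D i j x = 0 := by
      intro x
      refine Finset.sum_eq_zero fun φ hφ => ?_
      have h1 := (Finset.mem_filter.1 hφ).2
      have h2 := occ_sum φ
      omega
    simp [this]
  · intro l
    have hpt : ∀ x, ∑ φ, (∏ r, l (φ r)) * d x φ =
        ∑ i ∈ Finset.range (n + 1), ∑ j ∈ Finset.range (n + 1),
          D i j x * (l 1 ^ i * l 2 ^ j * l 0 ^ (n - i - j)) := by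
      intro x
      rw [← Finset.sum_product', ← Finset.sum_fiberwise_of_maps_to
        (g := fun φ : Fin n → Fin 3 => (occ φ 1, occ φ 2))
        (t := Finset.range (n + 1) ×ˢ Finset.range (n + 1))]
      · refine Finset.sum_congr rfl fun ij _ => ?_
        obtain ⟨i, j⟩ := ij
        simp only [D, Finset.sum_mul, Prod.mk.injEq]
        refine Finset.sum_congr rfl fun φ hφ => ?_
        obtain ⟨rfl, rfl⟩ := (Finset.mem_filter.1 hφ).2
        have h2 := occ_sum φ
        rw [prod_comp_eq_occ, show n - occ φ 1 - occ φ 2 = occ φ 0 by omega]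
        ring
      · intro φ _
        simpa using hle φ
    simp_rw [hpt]
    rw [integral_finsetSum]
    · refine Finset.sum_congr rfl fun i hi => ?_
      rw [integral_finsetSum]
      · refine Finset.sum_congr rfl fun j _ => ?_
        rw [integral_mul_const]
        ring
      · intro j _
        exact (hDint i j (Finset.mem_range.1 hi)).mul_const _
    · intro i hi
      exact integrable_finsetSum _ fun j _ => (hDint i j (Finset.mem_range.1 hi)).mul_const _

lemma coe_combination_eq_minkowskiSum (K A B : ConvexBody (E n)) (c a b : ℝ) :
    ((c • K + a • A + b • B : ConvexBody (E n)) : Set (E n)) =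
      minkowskiSum ![(K : Set (E n)), A, B] ![c, a, b] := by
  ext x
  simp only [ConvexBody.coe_add, ConvexBody.coe_smul, Set.mem_add, Set.mem_smul_set]
  constructor
  · rintro ⟨_, ⟨_, ⟨y, hy, rfl⟩, _, ⟨z, hz, rfl⟩, rfl⟩, _, ⟨w, hw, rfl⟩, rfl⟩
    refine ⟨![y, z, w], ?_, ?_⟩
    · intro i; fin_cases i <;> simpa
    · simp [Fin.sum_univ_three]
  · rintro ⟨y, hy, rfl⟩
    refine ⟨_, ⟨_, ⟨y 0, hy 0, rfl⟩, _, ⟨y 1, hy 1, rfl⟩, rfl⟩, _, ⟨y 2, hy 2, rfl⟩, ?_⟩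
    simp [Fin.sum_univ_three]

/-- **Minkowski's theorem**: the volume of a nonnegative combination of three bodies with interior
points is a homogeneous polynomial in the coefficients. -/
theorem exists_volume_polynomial (hn : 0 < n) (K A B : ConvexBody (E n))
    (hK : (interior (K : Set (E n))).Nonempty) (hA : (interior (A : Set (E n))).Nonempty)
    (hB : (interior (B : Set (E n))).Nonempty) :
    ∃ C : ℕ → ℕ → ℝ, (∀ i j, n < i + j → C i j = 0) ∧ ∀ c a b : ℝ, 0 ≤ c → 0 ≤ a → 0 ≤ b →
      volume.real ((c • K + a • A + b • B : ConvexBody (E n)) : Set (E n)) =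
        ∑ i ∈ Finset.range (n + 1), ∑ j ∈ Finset.range (n + 1),
          C i j * a ^ i * b ^ j * c ^ (n - i - j) := by
  set L : Fin 3 → Set (E n) := ![(K : Set (E n)), A, B]
  have hL : ∀ i, IsCompact (L i) := by
    intro i; fin_cases i
    exacts [K.isCompact, A.isCompact, B.isCompact]
  have hconv : ∀ i, Convex ℝ (L i) := by
    intro i; fin_cases i
    exacts [K.convex, A.convex, B.convex]
  have hint : ∀ i, (interior (L i)).Nonempty := by
    intro i; fin_cases i
    exacts [hK, hA, hB]
  choose d hd using fun x : E n => exists_det_expansion fun i => fderiv ℝ (gradMap (L i)) x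
  obtain ⟨C, hC0, hC⟩ := integral_eq_poly (μ := (volume : Measure (E n))) d (by
    intro l hl hl0
    refine (integrable_det_sum_fderiv hL hconv hint hl ⟨0, hl0⟩).1.congr
      (Eventually.of_forall fun x => hd x l))
  refine ⟨C, hC0, fun c a b hc ha hb => ?_⟩
  rw [coe_combination_eq_minkowskiSum]
  have hl : ∀ i, 0 ≤ (![c, a, b] : Fin 3 → ℝ) i := by
    intro i; fin_cases i <;> simpa
  by_cases hpos : ∃ i, 0 < (![c, a, b] : Fin 3 → ℝ) i
  · have h1 := (integrable_det_sum_fderiv hL hconv hint hl hpos).2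
    simp_rw [hd, hC] at h1
    simpa using h1.symm
  -- With all coefficients zero the gradient map is constant and the change of variables is
  -- unavailable. Both sides vanish here because `n > 0`.
  · push Not at hpos
    have hc0 : c = 0 := le_antisymm (hpos 0) hc
    have ha0 : a = 0 := le_antisymm (hpos 1) ha
    have hb0 : b = 0 := le_antisymm (hpos 2) hb
    subst hc0 ha0 hb0
    have hz : minkowskiSum L ![(0 : ℝ), 0, 0] ⊆ {0} := by
      rintro _ ⟨y, _, rfl⟩
      simp [Fin.sum_univ_three]
    have : Nontrivial (E n) := by
      have : Nonempty (Fin n) := ⟨⟨0, hn⟩⟩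
      infer_instance
    rw [measureReal_def, measure_mono_null hz (measure_singleton _), ENNReal.toReal_zero]
    symm
    refine Finset.sum_eq_zero fun i _ => Finset.sum_eq_zero fun j _ => ?_
    rcases Nat.eq_zero_or_pos i with rfl | hi
    · rcases Nat.eq_zero_or_pos j with rfl | hj
      · simp [hn.ne']
      · simp [hj.ne']
    · simp [hi.ne']

end

section

variable {n : ℕ}

/-! ### Mixed volumes as coefficients of the volume polynomial -/

lemma nsmul_eq_smul (k : ℕ) (K : ConvexBody (E n)) : k • K = (k : ℝ) • K := by
  have h1 : k • K = (k : NNReal) • K := (Nat.cast_smul_eq_nsmul NNReal k K).symm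
  rw [h1]
  refine ConvexBody.ext ?_
  rw [ConvexBody.coe_smul', ConvexBody.coe_smul]
  rfl

lemma add_smul_body {c d : ℝ} (hc : 0 ≤ c) (hd : 0 ≤ d) (K : ConvexBody (E n)) :
    (c + d) • K = c • K + d • K :=
  ConvexBody.ext (K.convex.add_smul hc hd)

lemma zero_smul_body (K : ConvexBody (E n)) : (0 : ℝ) • K = 0 :=
  ConvexBody.ext (Set.zero_smul_set K.nonempty)

/-- The volume of `c • K + a • A + b • B`. -/
def combVol (K A B : ConvexBody (E n)) (c a b : ℝ) : ℝ :=
  volume.real ((c • K + a • A + b • B : ConvexBody (E n)) : Set (E n))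

/-- The subsets in the polarization formula are sorted by whether they contain the indices `0` and
`1`, and by the number `k` of remaining indices, each of which contributes a copy of `K`. -/
lemma mixedVol₂_eq_sum (m : ℕ) (K A B : ConvexBody (E (m + 2))) :
    ((m + 2).factorial : ℝ) * mixedVol₂ K A B =
      ∑ k ∈ Finset.range (m + 1), ((-1 : ℝ) ^ (m - k) * m.choose k) *
        (combVol K A B k 1 1 - combVol K A B k 1 0 - combVol K A B k 0 1 + combVol K A B k 0 0) := by
  classical
  set L : Fin (m + 2) → ConvexBody (E (m + 2)) :=
    fun i => if i.val = 0 then A else if i.val = 1 then B else K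
  set R : Finset (Fin (m + 2)) := Finset.univ \ {0, 1} with hR
  have h0R : (0 : Fin (m + 2)) ∉ insert 1 R := by
    simp [hR]
  have h1R : (1 : Fin (m + 2)) ∉ R := by simp [hR]
  have huniv : (Finset.univ : Finset (Fin (m + 2))) = insert 0 (insert 1 R) := by
    ext i; simp only [hR, Finset.mem_univ, Finset.mem_insert, Finset.mem_sdiff,
      Finset.mem_singleton, true_and, true_iff]; tauto
  have hcard : R.card = m := by
    have := congrArg Finset.card huniv
    rw [Finset.card_insert_of_notMem h0R, Finset.card_insert_of_notMem h1R, Finset.card_univ,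
      Fintype.card_fin] at this
    omega
  have hL0 : L 0 = A := by simp [L]
  have hL1 : L 1 = B := by simp [L]
  have hLR : ∀ S ⊆ R, ∑ i ∈ S, L i = (S.card : ℝ) • K := by
    intro S hS
    rw [← nsmul_eq_smul, ← Finset.sum_const]
    refine Finset.sum_congr rfl fun i hi => ?_
    have := hS hi
    simp only [hR, Finset.mem_sdiff, Finset.mem_insert, Finset.mem_singleton, not_or] at this
    have h0 : i.val ≠ 0 := fun h => this.2.1 (Fin.ext h)
    have h1 : i.val ≠ 1 := fun h => this.2.2 (Fin.ext (by simpa using h))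
    simp only [L, h0, h1, if_false]
  rw [mixedVol₂, mixedVolume, mul_inv_cancel_left₀ (by positivity)]
  set G : Finset (Fin (m + 2)) → ℝ := fun J => (-1 : ℝ) ^ (m + 2 - J.card) *
    volume.real ((∑ i ∈ J, L i : ConvexBody (E (m + 2))) : Set (E (m + 2)))
  have hsum : ∑ J, G J = ∑ S ∈ R.powerset,
      (G S + G (insert 1 S) + (G (insert 0 S) + G (insert 0 (insert 1 S)))) := by
    rw [← Finset.powerset_univ, huniv, Finset.sum_powerset_insert h0R,
      Finset.sum_powerset_insert h1R, Finset.sum_powerset_insert h1R]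
    simp only [Finset.sum_add_distrib]
  have hterm : ∀ S ∈ R.powerset,
      G S + G (insert 1 S) + (G (insert 0 S) + G (insert 0 (insert 1 S))) =
      (-1 : ℝ) ^ (m - S.card) * (combVol K A B S.card 1 1 - combVol K A B S.card 1 0
        - combVol K A B S.card 0 1 + combVol K A B S.card 0 0) := by
    intro S hS
    have hSR := Finset.mem_powerset.1 hS
    have h1S : (1 : Fin (m + 2)) ∉ S := fun h => h1R (hSR h)
    have h0S : (0 : Fin (m + 2)) ∉ S := fun h => h0R (Finset.mem_insert_of_mem (hSR h))
    have h01S : (0 : Fin (m + 2)) ∉ insert 1 S :=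
      fun h => h0R (Finset.insert_subset_insert _ hSR h)
    have hSm : S.card ≤ m := (Finset.card_le_card hSR).trans_eq hcard
    simp only [G, Finset.sum_insert h1S, Finset.sum_insert h0S, Finset.sum_insert h01S,
      Finset.card_insert_of_notMem h1S, Finset.card_insert_of_notMem h0S,
      Finset.card_insert_of_notMem h01S, hLR S hSR, hL0, hL1]
    rw [show m + 2 - S.card = (m - S.card) + 2 by omega,
      show m + 2 - (S.card + 1) = (m - S.card) + 1 by omega,
      show m + 2 - (S.card + 1 + 1) = m - S.card by omega]
    have e00 : combVol K A B S.card 0 0 = volume.real (((S.card : ℝ) • K : ConvexBody (E (m + 2))) : Set (E (m + 2))) := by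
      simp only [combVol, zero_smul_body, add_zero]
    have e10 : combVol K A B S.card 1 0 =
        volume.real ((A + (S.card : ℝ) • K : ConvexBody (E (m + 2))) : Set (E (m + 2))) := by
      simp only [combVol, zero_smul_body, add_zero, one_smul, add_comm A]
    have e01 : combVol K A B S.card 0 1 =
        volume.real ((B + (S.card : ℝ) • K : ConvexBody (E (m + 2))) : Set (E (m + 2))) := by
      simp only [combVol, zero_smul_body, add_zero, one_smul, add_comm B]
    have e11 : combVol K A B S.card 1 1 =
        volume.real ((A + (B + (S.card : ℝ) • K) : ConvexBody (E (m + 2))) : Set (E (m + 2))) := by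
      simp only [combVol, one_smul]
      congr 2
      abel
    rw [e00, e10, e01, e11]
    ring
  change ∑ J, G J = _
  rw [hsum, Finset.sum_congr rfl hterm]
  rw [Finset.sum_powerset_apply_card (fun k => (-1 : ℝ) ^ (m - k) * (combVol K A B k 1 1
    - combVol K A B k 1 0 - combVol K A B k 0 1 + combVol K A B k 0 0)), hcard]
  refine Finset.sum_congr rfl fun k _ => ?_
  rw [nsmul_eq_mul]
  ring

/-! ### Finite differences of powers, and the extraction of coefficients of the volume polynomial.
-/

lemma fwdDiff_iter_zero_eq_sum (f : ℝ → ℝ) (m : ℕ) :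
    ((fwdDiff (1 : ℝ))^[m] f) 0 =
      ∑ k ∈ Finset.range (m + 1), ((-1 : ℝ) ^ (m - k) * m.choose k) * f k := by
  rw [fwdDiff_iter_eq_sum_shift]
  refine Finset.sum_congr rfl fun k _ => ?_
  simp

lemma sum_choose_mul_pow (m : ℕ) {p : ℕ} (hp : p ≤ m) :
    ∑ k ∈ Finset.range (m + 1), ((-1 : ℝ) ^ (m - k) * m.choose k) * (k : ℝ) ^ p =
      if p = m then (m.factorial : ℝ) else 0 := by
  rw [← fwdDiff_iter_zero_eq_sum (fun r => r ^ p)]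
  split_ifs with h
  · subst h; rw [fwdDiff_iter_eq_factorial]; rfl
  · rw [fwdDiff_iter_pow_eq_zero_of_lt (lt_of_le_of_ne hp h)]; rfl

lemma sum_choose_mul_sub_pow (m : ℕ) {p : ℕ} (hp : p ≤ m + 1) :
    ∑ k ∈ Finset.range (m + 1), ((-1 : ℝ) ^ (m - k) * m.choose k) *
      (((k : ℝ) + 1) ^ p - (k : ℝ) ^ p) =
      if p = m + 1 then ((m + 1).factorial : ℝ) else 0 := by
  have := fwdDiff_iter_zero_eq_sum (fun r => (r + 1) ^ p - r ^ p) m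
  rw [← this]
  have h2 : (fun r : ℝ => (r + 1) ^ p - r ^ p) = fwdDiff (1 : ℝ) (fun r : ℝ => r ^ p) := rfl
  rw [h2, ← Function.iterate_succ_apply]
  split_ifs with h
  · subst h; rw [fwdDiff_iter_eq_factorial]; rfl
  · rw [fwdDiff_iter_pow_eq_zero_of_lt (lt_of_le_of_ne hp h)]; rfl

lemma sum_choose_mul_second_difference_pow (m : ℕ) :
    ∑ k ∈ Finset.range (m + 1), ((-1 : ℝ) ^ (m - k) * m.choose k) *
      (((k : ℝ) + 1 + 1) ^ (m + 2) - ((k : ℝ) + 1) ^ (m + 2) -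
        (((k : ℝ) + 1) ^ (m + 2) - (k : ℝ) ^ (m + 2))) = ((m + 2).factorial : ℝ) := by
  have := fwdDiff_iter_zero_eq_sum (fun r => (r + 1 + 1) ^ (m + 2) - (r + 1) ^ (m + 2) -
        ((r + 1) ^ (m + 2) - r ^ (m + 2))) m
  rw [← this]
  have h2 : (fun r : ℝ => (r + 1 + 1) ^ (m + 2) - (r + 1) ^ (m + 2) -
        ((r + 1) ^ (m + 2) - r ^ (m + 2))) =
      fwdDiff (1 : ℝ) (fwdDiff (1 : ℝ) (fun r : ℝ => r ^ (m + 2))) := rfl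
  rw [h2, ← Function.iterate_succ_apply, ← Function.iterate_succ_apply, fwdDiff_iter_eq_factorial]
  rfl

/-- `C` is the coefficient array of the volume polynomial of `K`, `A`, `B`. -/
def IsVolumePolynomial (K A B : ConvexBody (E n)) (C : ℕ → ℕ → ℝ) : Prop :=
  (∀ i j, n < i + j → C i j = 0) ∧ ∀ c a b : ℝ, 0 ≤ c → 0 ≤ a → 0 ≤ b →
    combVol K A B c a b = ∑ i ∈ Finset.range (n + 1), ∑ j ∈ Finset.range (n + 1),
      C i j * a ^ i * b ^ j * c ^ (n - i - j)

lemma IsVolumePolynomial.swap {K A B : ConvexBody (E n)} {C : ℕ → ℕ → ℝ}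
    (h : IsVolumePolynomial K A B C) : IsVolumePolynomial K B A fun i j => C j i := by
  refine ⟨fun i j hij => h.1 j i (by omega), fun c a b hc ha hb => ?_⟩
  have h1 : combVol K B A c a b = combVol K A B c b a := by
    simp only [combVol, add_right_comm]
  rw [h1, h.2 c b a hc hb ha, Finset.sum_comm]
  refine Finset.sum_congr rfl fun i _ => Finset.sum_congr rfl fun j _ => ?_
  rw [Nat.sub_right_comm]
  ring

lemma IsVolumePolynomial.combVol_zero_right {K A B : ConvexBody (E n)} {C : ℕ → ℕ → ℝ}
    (h : IsVolumePolynomial K A B C) {c a : ℝ} (hc : 0 ≤ c) (ha : 0 ≤ a) :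
    combVol K A B c a 0 = ∑ i ∈ Finset.range (n + 1), C i 0 * a ^ i * c ^ (n - i) := by
  rw [h.2 c a 0 hc ha le_rfl]
  refine Finset.sum_congr rfl fun i _ => ?_
  rw [Finset.sum_eq_single 0]
  · simp
  · intro j _ hj; simp [hj]
  · simp

lemma IsVolumePolynomial.combVol_zero_zero {K A B : ConvexBody (E n)} {C : ℕ → ℕ → ℝ}
    (h : IsVolumePolynomial K A B C) {c : ℝ} (hc : 0 ≤ c) :
    combVol K A B c 0 0 = C 0 0 * c ^ n := by
  rw [h.combVol_zero_right hc le_rfl, Finset.sum_eq_single 0]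
  · simp
  · intro j _ hj; simp [hj]
  · simp

lemma IsVolumePolynomial.coeff_zero_zero {K A B : ConvexBody (E n)} {C : ℕ → ℕ → ℝ}
    (h : IsVolumePolynomial K A B C) : C 0 0 = volume.real (K : Set (E n)) := by
  have := h.combVol_zero_zero (c := 1) zero_le_one
  simpa [combVol, zero_smul_body] using this.symm

lemma mixedVol₁_eq (K A : ConvexBody (E n)) : mixedVol₁ K A = mixedVol₂ K A K := by
  simp only [mixedVol₁, mixedVol₂, ite_self]

lemma mixedVol₀_eq (K : ConvexBody (E n)) : mixedVol₀ K = mixedVol₂ K K K := by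
  simp only [mixedVol₀, mixedVol₂, ite_self]

/-- The difference in `a` and `b` kills all terms with `i = 0` or `j = 0`. What remains has exponent
`m + 2 - i - j ≤ m` in `k`, and the `m`-th difference kills every exponent below `m`. Only `i = j =
1` survives. -/
lemma IsVolumePolynomial.mixedVol₂_eq {m : ℕ} {K A B : ConvexBody (E (m + 2))} {C : ℕ → ℕ → ℝ}
    (h : IsVolumePolynomial K A B C) :
    ((m : ℝ) + 2) * (m + 1) * mixedVol₂ K A B = C 1 1 := by
  have hf : ((m + 2).factorial : ℝ) = ((m : ℝ) + 2) * (m + 1) * m.factorial := by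
    rw [Nat.factorial_succ, Nat.factorial_succ]; push_cast; ring
  have key : ((m + 2).factorial : ℝ) * mixedVol₂ K A B = m.factorial * C 1 1 := by
    rw [mixedVol₂_eq_sum]
    have hbr : ∀ k : ℕ, combVol K A B k 1 1 - combVol K A B k 1 0 - combVol K A B k 0 1
        + combVol K A B k 0 0 = ∑ i ∈ Finset.range (m + 2 + 1), ∑ j ∈ Finset.range (m + 2 + 1),
          C i j * ((1 - 0 ^ i) * (1 - 0 ^ j)) * (k : ℝ) ^ (m + 2 - i - j) := by
      intro k
      rw [h.2 k 1 1 (by positivity) zero_le_one zero_le_one,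
        h.2 k 1 0 (by positivity) zero_le_one le_rfl, h.2 k 0 1 (by positivity) le_rfl zero_le_one,
        h.2 k 0 0 (by positivity) le_rfl le_rfl]
      simp only [← Finset.sum_sub_distrib, ← Finset.sum_add_distrib]
      refine Finset.sum_congr rfl fun i _ => Finset.sum_congr rfl fun j _ => ?_
      simp only [one_pow]
      ring
    simp_rw [hbr, Finset.mul_sum]
    rw [Finset.sum_comm]
    have hswap : ∀ i ∈ Finset.range (m + 2 + 1), ∑ k ∈ Finset.range (m + 1),
        ∑ j ∈ Finset.range (m + 2 + 1), ((-1 : ℝ) ^ (m - k) * m.choose k) *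
          (C i j * ((1 - 0 ^ i) * (1 - 0 ^ j)) * (k : ℝ) ^ (m + 2 - i - j)) =
        ∑ j ∈ Finset.range (m + 2 + 1), C i j * ((1 - 0 ^ i) * (1 - 0 ^ j)) *
          ∑ k ∈ Finset.range (m + 1), ((-1 : ℝ) ^ (m - k) * m.choose k) *
            (k : ℝ) ^ (m + 2 - i - j) := by
      intro i _
      rw [Finset.sum_comm]
      refine Finset.sum_congr rfl fun j _ => ?_
      rw [Finset.mul_sum]
      refine Finset.sum_congr rfl fun k _ => ?_
      ring
    rw [Finset.sum_congr rfl hswap]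
    have hz : ∀ i j : ℕ, ¬ (i = 1 ∧ j = 1) → C i j * ((1 - 0 ^ i) * (1 - 0 ^ j)) *
          ∑ k ∈ Finset.range (m + 1), ((-1 : ℝ) ^ (m - k) * m.choose k) *
            (k : ℝ) ^ (m + 2 - i - j) = 0 := by
      intro i j hij
      rcases Nat.eq_zero_or_pos i with rfl | hi
      · simp
      rcases Nat.eq_zero_or_pos j with rfl | hj
      · simp
      by_cases hn : m + 2 < i + j
      · rw [h.1 i j hn]; simp
      · rw [sum_choose_mul_pow m (by omega), if_neg (by omega), mul_zero]
    rw [Finset.sum_eq_single 1, Finset.sum_eq_single 1]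
    · rw [sum_choose_mul_pow m (by omega), if_pos (by omega)]
      simp [mul_comm]
    · intro j _ hj; exact hz 1 j (by tauto)
    · simp
    · intro i _ hi; exact Finset.sum_eq_zero fun j _ => hz i j (by tauto)
    · simp
  rw [hf] at key
  have : (m.factorial : ℝ) ≠ 0 := by positivity
  refine mul_left_cancel₀ this ?_
  linarith

/-- When the second distinguished body is `K` itself, adding it shifts `k` to `k + 1`. The sum
becomes a difference of order `m + 1` in `k`, and among the terms with `i ≥ 1` only `i = 1` has a
large enough exponent. -/
lemma IsVolumePolynomial.mixedVol₁_eq {m : ℕ} {K A B : ConvexBody (E (m + 2))} {C : ℕ → ℕ → ℝ}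
    (h : IsVolumePolynomial K A B C) : ((m : ℝ) + 2) * mixedVol₁ K A = C 1 0 := by
  have hf : ((m + 2).factorial : ℝ) = ((m : ℝ) + 2) * (m + 1).factorial := by
    rw [Nat.factorial_succ]; push_cast; ring
  have key : ((m + 2).factorial : ℝ) * mixedVol₁ K A = (m + 1).factorial * C 1 0 := by
    rw [BezoutForm.mixedVol₁_eq, mixedVol₂_eq_sum]
    have hbr : ∀ k : ℕ, combVol K A K k 1 1 - combVol K A K k 1 0 - combVol K A K k 0 1
        + combVol K A K k 0 0 = ∑ i ∈ Finset.range (m + 2 + 1),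
          C i 0 * (1 - 0 ^ i) * (((k : ℝ) + 1) ^ (m + 2 - i) - (k : ℝ) ^ (m + 2 - i)) := by
      intro k
      have e1 : ∀ a : ℝ, combVol K A K k a 1 = combVol K A B (k + 1) a 0 := by
        intro a
        simp only [combVol, add_smul_body (Nat.cast_nonneg k) zero_le_one, zero_smul_body, add_zero]
        rw [add_right_comm]
      have e0 : ∀ a : ℝ, combVol K A K k a 0 = combVol K A B k a 0 := by
        intro a
        simp only [combVol, zero_smul_body]
      rw [e1, e1, e0, e0, h.combVol_zero_right (by positivity) zero_le_one,
        h.combVol_zero_right (by positivity) zero_le_one,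
        h.combVol_zero_right (by positivity) le_rfl, h.combVol_zero_right (by positivity) le_rfl]
      simp only [← Finset.sum_sub_distrib, ← Finset.sum_add_distrib]
      refine Finset.sum_congr rfl fun i _ => ?_
      simp only [one_pow]
      ring
    simp_rw [hbr, Finset.mul_sum]
    rw [Finset.sum_comm]
    have hpull : ∀ i ∈ Finset.range (m + 2 + 1), ∑ k ∈ Finset.range (m + 1),
        ((-1 : ℝ) ^ (m - k) * m.choose k) *
          (C i 0 * (1 - 0 ^ i) * (((k : ℝ) + 1) ^ (m + 2 - i) - (k : ℝ) ^ (m + 2 - i))) =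
        C i 0 * (1 - 0 ^ i) * if m + 2 - i = m + 1 then ((m + 1).factorial : ℝ) else 0 := by
      intro i _
      rcases Nat.eq_zero_or_pos i with rfl | hi
      · simp
      rw [← sum_choose_mul_sub_pow m (by omega), Finset.mul_sum]
      refine Finset.sum_congr rfl fun k _ => ?_
      ring
    rw [Finset.sum_congr rfl hpull, Finset.sum_eq_single 1]
    · rw [if_pos (by omega)]; simp [mul_comm]
    · intro i _ hi
      rcases Nat.eq_zero_or_pos i with rfl | hi0
      · simp
      · rw [if_neg (by omega), mul_zero]
    · simp
  rw [hf] at key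
  have : ((m + 1).factorial : ℝ) ≠ 0 := by positivity
  refine mul_left_cancel₀ this ?_
  linarith

lemma exists_isVolumePolynomial (hn : 0 < n) (K A B : ConvexBody (E n))
    (hK : (interior (K : Set (E n))).Nonempty) (hA : (interior (A : Set (E n))).Nonempty)
    (hB : (interior (B : Set (E n))).Nonempty) : ∃ C, IsVolumePolynomial K A B C :=
  exists_volume_polynomial hn K A B hK hA hB

/-- All sums are dilates of `K`, so the alternating sum is the difference of order `m + 2` of `r ↦
|K| r ^ (m + 2)`. -/
lemma mixedVol₀_eq_volume {m : ℕ} (K : ConvexBody (E (m + 2)))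
    (hK : (interior (K : Set (E (m + 2)))).Nonempty) :
    mixedVol₀ K = volume.real (K : Set (E (m + 2))) := by
  obtain ⟨C, h⟩ := exists_isVolumePolynomial (by omega) K K K hK hK hK
  have key : ((m + 2).factorial : ℝ) * mixedVol₀ K = (m + 2).factorial * C 0 0 := by
    rw [mixedVol₀_eq, mixedVol₂_eq_sum]
    have e : ∀ {c a b : ℝ}, 0 ≤ c → 0 ≤ a → 0 ≤ b →
        combVol K K K c a b = C 0 0 * (c + a + b) ^ (m + 2) := by
      intro c a b hc ha hb
      rw [← h.combVol_zero_zero (by positivity)]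
      simp only [combVol, add_smul_body (add_nonneg hc ha) hb, add_smul_body hc ha, zero_smul_body,
        add_zero]
    rw [← sum_choose_mul_second_difference_pow, Finset.sum_mul]
    refine Finset.sum_congr rfl fun k _ => ?_
    rw [e (by positivity) zero_le_one zero_le_one, e (by positivity) zero_le_one le_rfl,
      e (by positivity) le_rfl zero_le_one, e (by positivity) le_rfl le_rfl]
    simp only [add_zero]
    ring
  rw [mul_left_cancel₀ (by positivity) key, h.coeff_zero_zero]

end

section

variable {d : ℕ}

/-! ### Slicing by hyperplanes -/

lemma measurable_inner_const (u : E d) : Measurable fun y : E d => (inner ℝ y u : ℝ) := by fun_prop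

lemma volume_eq_lintegral_slice {u : E d} (hu : ‖u‖ = 1) {S : Set (E d)} (hS : MeasurableSet S) :
    volume S = ∫⁻ s : ℝ, Measure.euclideanHausdorffMeasure (d - 1)
      (S ∩ {y : E d | inner ℝ y u = s}) := by
  have hu0 : u ≠ 0 := by rintro rfl; simp at hu
  have h := EuclideanGeometry.euclideanHausdorffMeasure_eq_lintegral (V := E d) (P := E d) 0 hu0 hS
  rw [InnerProductSpace.euclideanHausdorffMeasure_eq_volume, finrank_euclideanSpace_fin] at h
  have he : ‖u‖ₑ = 1 := by rw [← ofReal_norm, hu, ENNReal.ofReal_one]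
  rw [h, he, one_mul]
  congr 1
  funext s
  congr 2
  ext y
  simp only [vadd_eq_add, add_zero, SetLike.mem_coe, AffineSubspace.mem_mk', vsub_eq_sub,
    Submodule.mem_orthogonal_singleton_iff_inner_left, inner_sub_left, inner_smul_left,
    Set.mem_ofPred_eq, conj_trivial, real_inner_self_eq_norm_sq, hu]
  constructor <;> intro h <;> linarith

/-- The prism of height `ε` in direction `u` over a subset of the hyperplane `⟨·, u⟩ = h`. -/
def prism (u : E d) (h ε : ℝ) (R : Set (E d)) : Set (E d) :=
  {y | h < inner ℝ y u ∧ inner ℝ y u ≤ h + ε ∧ y - ((inner ℝ y u - h : ℝ)) • u ∈ R}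

lemma measurableSet_prism (u : E d) (h ε : ℝ) {R : Set (E d)} (hR : MeasurableSet R) :
    MeasurableSet (prism u h ε R) := by
  refine (measurableSet_lt measurable_const (measurable_inner_const u)).inter
    ((measurableSet_le (measurable_inner_const u) measurable_const).inter ?_)
  have : Continuous fun y : E d => y - ((inner ℝ y u - h : ℝ)) • u := by fun_prop
  exact this.measurable hR

lemma volume_prism {u : E d} (hu : ‖u‖ = 1) {h ε : ℝ} {R : Set (E d)}
    (hR : MeasurableSet R) (hRh : ∀ x ∈ R, inner ℝ x u = h) :
    volume (prism u h ε R) = ENNReal.ofReal ε * Measure.euclideanHausdorffMeasure (d - 1) R := by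
  rw [volume_eq_lintegral_slice hu (measurableSet_prism u h ε hR)]
  have hslice : ∀ s : ℝ, Measure.euclideanHausdorffMeasure (d - 1)
      (prism u h ε R ∩ {y : E d | inner ℝ y u = s}) =
      (Set.Ioc h (h + ε)).indicator
        (fun _ => Measure.euclideanHausdorffMeasure (d - 1) R) s := by
    intro s
    by_cases hs : s ∈ Set.Ioc h (h + ε)
    · rw [Set.indicator_of_mem hs]
      have : prism u h ε R ∩ {y : E d | inner ℝ y u = s} = ((s - h) • u) +ᵥ R := by
        ext y
        rw [Set.mem_vadd_set_iff_neg_vadd_mem]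
        simp only [prism, Set.mem_inter_iff, Set.mem_ofPred_eq, vadd_eq_add]
        constructor
        · rintro ⟨⟨_, _, h3⟩, h4⟩
          rw [h4] at h3
          rwa [neg_add_eq_sub]
        · intro h3
          rw [neg_add_eq_sub] at h3
          have h4 := hRh _ h3
          rw [inner_sub_left, inner_smul_left, real_inner_self_eq_norm_sq, hu] at h4
          have h5 : inner ℝ y u = s := by simp at h4; linarith
          exact ⟨⟨h5 ▸ hs.1, h5 ▸ hs.2, by rwa [h5]⟩, h5⟩
      rw [this, measure_vadd]
    · rw [Set.indicator_of_notMem hs]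
      have : prism u h ε R ∩ {y : E d | inner ℝ y u = s} = ∅ := by
        refine Set.eq_empty_of_forall_notMem ?_
        rintro y ⟨⟨h1, h2, _⟩, h4⟩
        rw [Set.mem_ofPred_eq] at h4
        rw [h4] at h1 h2
        exact hs ⟨h1, h2⟩
      rw [this, measure_empty]
  simp_rw [hslice]
  rw [lintegral_indicator measurableSet_Ioc, setLIntegral_const, Real.volume_Ioc, add_sub_cancel_left,
    mul_comm]

/-- The part with heights in `(a, b]` of the cone with apex `0` over a subset of the hyperplane
`⟨·, u⟩ = h`. -/
def coneSlab (u : E d) (h a b : ℝ) (R : Set (E d)) : Set (E d) :=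
  {y | a < inner ℝ y u ∧ inner ℝ y u ≤ b ∧ ((h / inner ℝ y u : ℝ)) • y ∈ R}

lemma measurableSet_coneSlab (u : E d) (h a b : ℝ) {R : Set (E d)} (hR : MeasurableSet R) :
    MeasurableSet (coneSlab u h a b R) := by
  refine (measurableSet_lt measurable_const (measurable_inner_const u)).inter
    ((measurableSet_le (measurable_inner_const u) measurable_const).inter ?_)
  have : Measurable fun y : E d => ((h / inner ℝ y u : ℝ)) • y := by fun_prop
  exact this hR

lemma volume_coneSlab {u : E d} (hu : ‖u‖ = 1) {h a b : ℝ} (hh : 0 < h) (ha : 0 ≤ a)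
    {R : Set (E d)} (hR : MeasurableSet R) (hRh : ∀ x ∈ R, inner ℝ x u = h) :
    volume (coneSlab u h a b R) = (∫⁻ s in Set.Ioc a b, ENNReal.ofReal ((s / h) ^ (d - 1))) *
      Measure.euclideanHausdorffMeasure (d - 1) R := by
  rw [volume_eq_lintegral_slice hu (measurableSet_coneSlab u h a b hR)]
  have hslice : ∀ s : ℝ, Measure.euclideanHausdorffMeasure (d - 1)
      (coneSlab u h a b R ∩ {y : E d | inner ℝ y u = s}) =
      (Set.Ioc a b).indicator (fun s => ENNReal.ofReal ((s / h) ^ (d - 1)) *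
        Measure.euclideanHausdorffMeasure (d - 1) R) s := by
    intro s
    by_cases hs : s ∈ Set.Ioc a b
    · rw [Set.indicator_of_mem hs]
      have hs0 : 0 < s := ha.trans_lt hs.1
      have hsh : 0 < s / h := div_pos hs0 hh
      have : coneSlab u h a b R ∩ {y : E d | inner ℝ y u = s} = (s / h) • R := by
        ext y
        rw [Set.mem_smul_set_iff_inv_smul_mem₀ hsh.ne', inv_div]
        simp only [coneSlab, Set.mem_inter_iff, Set.mem_ofPred_eq]
        constructor
        · rintro ⟨⟨_, _, h3⟩, h4⟩
          rwa [h4] at h3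
        · intro h3
          have h4 := hRh _ h3
          rw [inner_smul_left, conj_trivial] at h4
          have h5 : inner ℝ y u = s := by field_simp at h4; linarith
          exact ⟨⟨h5 ▸ hs.1, h5 ▸ hs.2, by rwa [h5]⟩, h5⟩
      rw [this, Measure.euclideanHausdorffMeasure_smul₀ (d - 1) hsh.ne', ENNReal.smul_def,
        smul_eq_mul]
      congr 1
      rw [ENNReal.ofReal_pow hsh.le, ENNReal.coe_pow, Real.nnnorm_of_nonneg hsh.le,
        ENNReal.ofReal, Real.toNNReal_of_nonneg hsh.le]
    · rw [Set.indicator_of_notMem hs]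
      have : coneSlab u h a b R ∩ {y : E d | inner ℝ y u = s} = ∅ := by
        refine Set.eq_empty_of_forall_notMem ?_
        rintro y ⟨⟨h1, h2, _⟩, h4⟩
        rw [Set.mem_ofPred_eq] at h4
        rw [h4] at h1 h2
        exact hs ⟨h1, h2⟩
      rw [this, measure_empty]
  simp_rw [hslice]
  rw [lintegral_indicator measurableSet_Ioc, lintegral_mul_const]
  fun_prop

lemma volume_coneSlab_le {u : E d} (hu : ‖u‖ = 1) {h a b : ℝ} (hh : 0 < h) (ha : 0 ≤ a)
    {R : Set (E d)} (hR : MeasurableSet R) (hRh : ∀ x ∈ R, inner ℝ x u = h) :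
    volume (coneSlab u h a b R) ≤ ENNReal.ofReal ((b - a) * (b / h) ^ (d - 1)) *
      Measure.euclideanHausdorffMeasure (d - 1) R := by
  rw [volume_coneSlab hu hh ha hR hRh]
  gcongr
  rcases le_or_gt b a with hba | hab
  · simp [Set.Ioc_eq_empty (not_lt.2 hba)]
  calc ∫⁻ s in Set.Ioc a b, ENNReal.ofReal ((s / h) ^ (d - 1))
      ≤ ∫⁻ s in Set.Ioc a b, ENNReal.ofReal ((b / h) ^ (d - 1)) := by
        refine setLIntegral_mono' measurableSet_Ioc fun s hs => ENNReal.ofReal_le_ofReal ?_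
        have hs0 : 0 ≤ s := ha.trans hs.1.le
        have := hs.2
        gcongr
    _ = ENNReal.ofReal ((b - a) * (b / h) ^ (d - 1)) := by
        rw [setLIntegral_const, Real.volume_Ioc, mul_comm, ENNReal.ofReal_mul (by linarith)]

lemma volume_cone {u : E d} (hu : ‖u‖ = 1) {h : ℝ} (hh : 0 < h)
    {R : Set (E d)} (hR : MeasurableSet R) (hRh : ∀ x ∈ R, inner ℝ x u = h) :
    volume (coneSlab u h 0 h R) = ENNReal.ofReal (h / d) *
      Measure.euclideanHausdorffMeasure (d - 1) R := by
  have hd : 0 < d := by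
    rcases Nat.eq_zero_or_pos d with rfl | h0
    · have : u = 0 := Subsingleton.elim _ _
      rw [this] at hu; simp at hu
    · exact h0
  rw [volume_coneSlab hu hh le_rfl hR hRh]
  congr 1
  rw [← ofReal_integral_eq_lintegral_ofReal]
  · congr 1
    rw [← intervalIntegral.integral_of_le hh.le]
    simp only [div_pow]
    rw [intervalIntegral.integral_div, integral_pow]
    have h1 : d - 1 + 1 = d := Nat.sub_add_cancel hd
    have h2 : ((d - 1 : ℕ) : ℝ) + 1 = d := by exact_mod_cast h1
    rw [h1, h2, zero_pow hd.ne', sub_zero]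
    nth_rw 1 [← h1]
    rw [pow_succ]
    field_simp
  · exact (Continuous.integrableOn_Ioc (by fun_prop))
  · refine (ae_restrict_iff' measurableSet_Ioc).2 (Eventually.of_forall fun s hs => ?_)
    have := hs.1
    simp only [Pi.zero_apply]
    positivity

/-! ### Supporting hyperplanes, exit points and the nearest-point projection -/

/-- The last parameter in `[0, 1]` at which the segment from `y` to `z` is still in `B`; at an
interior point of `B` the segment could be continued. -/
lemma exists_exit {B : Set (E d)} (hB : IsClosed B) {y z : E d} (hy : y ∈ B) (hz : z ∉ B) :
    ∃ t : ℝ, 0 ≤ t ∧ t < 1 ∧ y + t • (z - y) ∈ frontier B := by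
  set T : Set ℝ := Set.Icc 0 1 ∩ (fun t : ℝ => y + t • (z - y)) ⁻¹' B with hT
  have hcont : Continuous fun t : ℝ => y + t • (z - y) := by fun_prop
  have hcomp : IsCompact T := isCompact_Icc.inter_right (hB.preimage hcont)
  obtain ⟨t, ⟨⟨ht0, ht1⟩, htB⟩, hmax⟩ := hcomp.exists_isGreatest ⟨0, by simp [hT, hy]⟩
  have ht1' : t < 1 := by
    refine lt_of_le_of_ne ht1 fun h => hz ?_
    have : y + t • (z - y) ∈ B := htB
    rwa [h, one_smul, add_sub_cancel] at this
  refine ⟨t, ht0, ht1', ?_⟩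
  rw [hB.frontier_eq]
  refine ⟨htB, fun hint => ?_⟩
  have h1 : ∀ᶠ s in 𝓝 t, y + s • (z - y) ∈ interior B :=
    hcont.continuousAt (isOpen_interior.mem_nhds hint)
  have h2 : ∀ᶠ s in 𝓝[>] t, y + s • (z - y) ∈ interior B ∧ s < 1 :=
    (h1.filter_mono nhdsWithin_le_nhds).and ((eventually_lt_nhds ht1').filter_mono nhdsWithin_le_nhds)
  obtain ⟨s, ⟨hs1, hs2⟩, hs3⟩ := (h2.and self_mem_nhdsWithin).exists
  have hs3' : t < s := hs3
  exact absurd (hmax ⟨⟨ht0.trans hs3'.le, hs2.le⟩, Set.mem_preimage.2 (interior_subset (s := B) hs1)⟩) (not_le.2 hs3')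

lemma exists_radial {S : Set (E d)} (hS : IsClosed S) (h0 : 0 ∈ interior S) {x : E d} (hx : x ∉ S) :
    ∃ y ∈ frontier S, ∃ β : ℝ, 0 < β ∧ x = (1 + β) • y := by
  obtain ⟨t, ht0, ht1, hfr⟩ := exists_exit hS (interior_subset h0) hx
  rw [sub_zero, zero_add] at hfr
  have htpos : 0 < t := by
    refine lt_of_le_of_ne ht0 fun h => ?_
    rw [← h, zero_smul] at hfr
    exact hfr.2 h0
  refine ⟨t • x, hfr, t⁻¹ - 1, sub_pos.2 ((one_lt_inv₀ htpos).2 ht1), ?_⟩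
  rw [add_sub_cancel, smul_smul, inv_mul_cancel₀ htpos.ne', one_smul]

lemma exists_unit_normal {A : Set (E d)} (hA : Convex ℝ A) (hint : (interior A).Nonempty) {y : E d}
    (hy : y ∉ interior A) : ∃ v : E d, ‖v‖ = 1 ∧ ∀ z ∈ A, inner ℝ z v ≤ (inner ℝ y v : ℝ) := by
  obtain ⟨f, hf⟩ := geometric_hahn_banach_open_point hA.interior isOpen_interior hy
  set w := (InnerProductSpace.toDual ℝ (E d)).symm f with hw
  have hfw : ∀ z, f z = inner ℝ z w := fun z => by
    rw [real_inner_comm, hw, InnerProductSpace.toDual_symm_apply]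
  have hw0 : w ≠ 0 := by
    intro h0
    obtain ⟨z, hz⟩ := hint
    have := hf z hz
    rw [hfw, hfw, h0] at this
    simp at this
  have hle : ∀ z ∈ A, f z ≤ f y := by
    intro z hz
    have hz' : z ∈ closure (interior A) := by
      rw [hA.closure_interior_eq_closure_of_nonempty_interior hint]
      exact subset_closure hz
    have : closure (interior A) ⊆ {z | f z ≤ f y} :=
      closure_minimal (fun z hz => (hf z hz).le) (isClosed_le f.continuous continuous_const)
    exact this hz'
  refine ⟨‖w‖⁻¹ • w, norm_smul_inv_norm hw0, fun z hz => ?_⟩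
  rw [inner_smul_right, inner_smul_right, ← hfw, ← hfw]
  exact mul_le_mul_of_nonneg_left (hle z hz) (by positivity)

/-- The nearest-point map. Its values are pinned down by the obtuse-angle criterion, and comparing
this criterion at two points gives the Lipschitz bound. -/
lemma exists_projection {A : Set (E d)} (hA : Convex ℝ A) (hcl : IsClosed A) (hne : A.Nonempty) :
    ∃ π : E d → E d, LipschitzWith 1 π ∧
      ∀ x y, y ∈ A → (∀ w ∈ A, inner ℝ (x - y) (w - y) ≤ (0 : ℝ)) → π x = y := by
  have hex : ∀ x : E d, ∃ y ∈ A, ∀ w ∈ A, inner ℝ (x - y) (w - y) ≤ (0 : ℝ) := by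
    intro x
    obtain ⟨y, hy, hmin⟩ := exists_norm_eq_iInf_of_complete_convex hne hcl.isComplete hA x
    exact ⟨y, hy, (norm_eq_iInf_iff_real_inner_le_zero hA hy).1 hmin⟩
  choose π hπ hπi using hex
  have key : ∀ x x' y y', y ∈ A → y' ∈ A → (∀ w ∈ A, inner ℝ (x - y) (w - y) ≤ (0 : ℝ)) →
      (∀ w ∈ A, inner ℝ (x' - y') (w - y') ≤ (0 : ℝ)) → ‖y - y'‖ ≤ ‖x - x'‖ := by
    intro x x' y y' hy hy' h h'
    have h1 := h y' hy'
    have h2 := h' y hy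
    have h3 : ‖y - y'‖ ^ 2 ≤ inner ℝ (x - x') (y - y') := by
      have e : inner ℝ (x - x') (y - y') - ‖y - y'‖ ^ 2 =
          -(inner ℝ (x - y) (y' - y) + inner ℝ (x' - y') (y - y') : ℝ) := by
        rw [← real_inner_self_eq_norm_sq]
        simp only [inner_sub_left, inner_sub_right, real_inner_comm]
        ring
      linarith
    have h4 := h3.trans (real_inner_le_norm _ _)
    rcases eq_or_lt_of_le (norm_nonneg (y - y')) with h5 | h5
    · rw [← h5]; exact norm_nonneg _
    · nlinarith
  refine ⟨π, LipschitzWith.of_dist_le_mul fun x x' => ?_, fun x y hy h => ?_⟩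
  · rw [dist_eq_norm, dist_eq_norm, NNReal.coe_one, one_mul]
    exact key x x' _ _ (hπ x) (hπ x') (hπi x) (hπi x')
  · have := key x x _ _ (hπ x) hy (hπi x) h
    rw [sub_self, norm_zero] at this
    exact sub_eq_zero.1 (norm_le_zero_iff.1 this)

/-- The surface area is monotone with respect to inclusion of convex sets. -/
lemma euclideanHausdorffMeasure_frontier_mono {A B : Set (E d)} (hA : Convex ℝ A) (hcl : IsClosed A)
    (hint : (interior A).Nonempty) (hB : IsCompact B) (hAB : A ⊆ B) (k : ℕ) :
    Measure.euclideanHausdorffMeasure k (frontier A) ≤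
      Measure.euclideanHausdorffMeasure k (frontier B) := by
  obtain ⟨π, hπ, hπ'⟩ := exists_projection hA hcl (hint.mono interior_subset)
  -- The ray from `y` along an outer normal of `A` leaves `B` at a boundary point, and the nearest
  -- point of `A` to that point is `y`. A 1-Lipschitz map does not increase Hausdorff measure.
  have hsub : frontier A ⊆ π '' frontier B := by
    intro y hy
    have hyA : y ∈ A := hcl.frontier_subset hy
    obtain ⟨v, hv, hv'⟩ := exists_unit_normal hA hint hy.2
    obtain ⟨R, hR⟩ := hB.isBounded.exists_norm_le
    have hR0 : 0 ≤ R := (norm_nonneg _).trans (hR y (hAB hyA))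
    have hout : y + (2 * R + 1) • v ∉ B := by
      intro h
      have h1 := hR _ h
      have h2 := hR y (hAB hyA)
      have h3 := norm_sub_le (y + (2 * R + 1) • v) y
      rw [add_sub_cancel_left, norm_smul, hv, Real.norm_of_nonneg (by positivity)] at h3
      linarith
    obtain ⟨t, ht0, -, hfr⟩ := exists_exit hB.isClosed (hAB hyA) hout
    refine ⟨_, hfr, hπ' _ y hyA fun w hw => ?_⟩
    rw [add_sub_cancel_left, add_sub_cancel_left, smul_smul, inner_smul_left, inner_sub_right,
      real_inner_comm, real_inner_comm y v]
    have := hv' w hw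
    exact mul_nonpos_of_nonneg_of_nonpos (by simp only [conj_trivial]; positivity) (by linarith)
  refine (measure_mono hsub).trans ?_
  rw [Measure.euclideanHausdorffMeasure_def, Measure.smul_apply, Measure.smul_apply]
  have := hπ.hausdorffMeasure_image_le (d := (k : ℝ)) (Nat.cast_nonneg k) (frontier B)
  rw [ENNReal.coe_one, ENNReal.one_rpow, one_mul] at this
  rw [ENNReal.smul_def, ENNReal.smul_def, smul_eq_mul, smul_eq_mul]
  exact mul_le_mul' le_rfl this

end

section

variable {d : ℕ}

/-! ### Circumscribed polytopes -/

/-- The polyhedron `⋂ i, {x : ⟨x, u i⟩ ≤ h i}`. -/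
def hPoly {N : ℕ} (u : Fin N → E d) (h : Fin N → ℝ) : Set (E d) :=
  {x | ∀ i, inner ℝ x (u i) ≤ h i}

section

variable {N : ℕ} (u : Fin N → E d) (h : Fin N → ℝ)

lemma convex_hPoly : Convex ℝ (hPoly u h) := by
  intro x hx y hy a b ha hb hab i
  rw [inner_add_left, inner_smul_left, inner_smul_left]
  simp only [conj_trivial]
  calc a * inner ℝ x (u i) + b * inner ℝ y (u i) ≤ a * h i + b * h i := by
        gcongr
        exacts [hx i, hy i]
    _ = h i := by rw [← add_mul, hab, one_mul]

lemma isClosed_hPoly : IsClosed (hPoly u h) := by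
  have : hPoly u h = ⋂ i, {x : E d | inner ℝ x (u i) ≤ h i} := by ext; simp [hPoly]
  rw [this]
  exact isClosed_iInter fun i => isClosed_le (by fun_prop) continuous_const

lemma exists_eq_of_mem_frontier_hPoly {x : E d} (hx : x ∈ frontier (hPoly u h)) :
    ∃ i, inner ℝ x (u i) = h i := by
  by_contra! hne
  have hxQ : x ∈ hPoly u h := (isClosed_hPoly u h).frontier_subset hx
  refine hx.2 (mem_interior.2 ⟨⋂ i, {x : E d | inner ℝ x (u i) < h i}, ?_, ?_, ?_⟩)
  · intro y hy i
    exact (Set.mem_iInter.1 hy i).le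
  · exact isOpen_iInter_of_finite fun i => isOpen_lt (by fun_prop) continuous_const
  · exact Set.mem_iInter.2 fun i => lt_of_le_of_ne (hxQ i) (hne i)

/-- Disjoint measurable pieces of the boundary of a polytope, one for each facet. -/
def facetPiece (i : Fin N) : Set (E d) :=
  {x | x ∈ frontier (hPoly u h) ∧ inner ℝ x (u i) = h i ∧ ∀ j < i, inner ℝ x (u j) ≠ h j}

lemma measurableSet_facetPiece (i : Fin N) : MeasurableSet (facetPiece u h i) := by
  have : facetPiece u h i = frontier (hPoly u h) ∩ ({x : E d | inner ℝ x (u i) = h i} ∩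
      ⋂ j, ⋂ (_ : j < i), {x : E d | inner ℝ x (u j) = h j}ᶜ) := by
    ext x; simp only [facetPiece, Set.mem_inter_iff, Set.mem_iInter, Set.mem_compl_iff]; rfl
  rw [this]
  have hm : ∀ j, MeasurableSet {x : E d | inner ℝ x (u j) = h j} := fun j =>
    (isClosed_eq (by fun_prop) continuous_const).measurableSet
  exact isClosed_frontier.measurableSet.inter ((hm i).inter
    (MeasurableSet.iInter fun j => MeasurableSet.iInter fun _ => (hm j).compl))

lemma disjoint_facetPiece : Pairwise (Function.onFun Disjoint (facetPiece u h)) := by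
  intro i j hij
  refine Set.disjoint_left.2 fun x hi hj => ?_
  rcases lt_or_gt_of_ne hij with hlt | hlt
  · exact hj.2.2 i hlt hi.2.1
  · exact hi.2.2 j hlt hj.2.1

lemma iUnion_facetPiece : ⋃ i, facetPiece u h i = frontier (hPoly u h) := by
  refine subset_antisymm (Set.iUnion_subset fun i x hx => hx.1) fun x hx => ?_
  obtain ⟨i, hi, hmin⟩ := WellFounded.has_min (wellFounded_lt (α := Fin N))
    {i | inner ℝ x (u i) = h i} (exists_eq_of_mem_frontier_hPoly u h hx)
  exact Set.mem_iUnion.2 ⟨i, hx, hi, fun j hj hj' => hmin j hj' hj⟩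

lemma sum_facetPiece (k : ℕ) : ∑ i, Measure.euclideanHausdorffMeasure k (facetPiece u h i) =
    Measure.euclideanHausdorffMeasure k (frontier (hPoly u h)) := by
  rw [← iUnion_facetPiece, measure_iUnion (disjoint_facetPiece u h) (measurableSet_facetPiece u h),
    tsum_fintype]

end

/-- Each point of `∂(s K)` is strictly cut off from `K` by a half-space, and by compactness finitely
many cuts suffice. A point of the resulting polyhedron outside `s K` would give a point of `∂(s K)`
on its segment to `0` that violates one of the cuts. -/
lemma exists_hPoly {K : Set (E d)} (hK : IsCompact K) (hconv : Convex ℝ K) (h0 : 0 ∈ interior K)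
    {s : ℝ} (hs : 1 < s) : ∃ (N : ℕ) (u : Fin N → E d) (h : Fin N → ℝ), (∀ i, ‖u i‖ = 1) ∧
      (∀ i, 0 < h i) ∧ K ⊆ hPoly u h ∧ hPoly u h ⊆ s • K := by
  have h0K : (0 : E d) ∈ K := interior_subset h0
  have hsub : K ⊆ interior (s • K) := by
    have := hconv.subset_interior_image_homothety_of_one_lt h0 s hs
    have e : AffineMap.homothety (0 : E d) s '' K = s • K := by
      ext x; simp [AffineMap.homothety_apply, Set.mem_smul_set]
    rwa [e] at this
  have hsK : IsCompact (s • K) := hK.smul s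
  have hfr : IsCompact (frontier (s • K)) :=
    hsK.of_isClosed_subset isClosed_frontier hsK.isClosed.frontier_subset
  have hsep : ∀ x : E d, x ∈ frontier (s • K) → ∃ (v : E d) (c : ℝ), ‖v‖ = 1 ∧ 0 < c ∧
      (∀ z ∈ K, inner ℝ z v ≤ c) ∧ c < inner ℝ x v := by
    intro x hx
    have hxK : x ∉ K := fun h => hx.2 (hsub h)
    obtain ⟨f, c, hf1, hf2⟩ := geometric_hahn_banach_closed_point hconv hK.isClosed hxK
    set w := (InnerProductSpace.toDual ℝ (E d)).symm f with hw
    have hfw : ∀ z, f z = inner ℝ z w := fun z => by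
      rw [real_inner_comm, hw, InnerProductSpace.toDual_symm_apply]
    have hc : 0 < c := by simpa using hf1 0 h0K
    have hw0 : w ≠ 0 := by
      intro h0
      rw [hfw, h0, inner_zero_right] at hf2
      exact absurd hf2 (not_lt.2 hc.le)
    have hwn : 0 < ‖w‖⁻¹ := inv_pos.2 (norm_pos_iff.2 hw0)
    refine ⟨‖w‖⁻¹ • w, ‖w‖⁻¹ * c, norm_smul_inv_norm hw0, mul_pos hwn hc, fun z hz => ?_, ?_⟩
    · rw [inner_smul_right, ← hfw]
      exact mul_le_mul_of_nonneg_left (hf1 z hz).le hwn.le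
    · rw [inner_smul_right, ← hfw]
      exact mul_lt_mul_of_pos_left hf2 hwn
  choose! v c hv hc hle hlt using hsep
  obtain ⟨T, hT, hTcov⟩ := hfr.elim_nhds_subcover (fun x => {y : E d | c x < inner ℝ y (v x)})
    (fun x hx => (isOpen_lt continuous_const (by fun_prop)).mem_nhds (hlt x hx))
  let e := T.equivFin.symm
  have heT : ∀ i, (e i : E d) ∈ frontier (s • K) := fun i => hT _ (e i).2
  refine ⟨T.card, fun i => v (e i), fun i => c (e i), fun i => hv _ (heT i), fun i => hc _ (heT i),
    fun z hz i => hle _ (heT i) z hz, fun x hx => ?_⟩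
  by_contra hxs
  obtain ⟨t, ht0, ht1, hfrt⟩ := exists_exit hsK.isClosed (interior_subset (hsub h0K)) hxs
  rw [sub_zero, zero_add] at hfrt
  obtain ⟨x', hx', hx'2⟩ := Set.mem_iUnion₂.1 (hTcov hfrt)
  have h1 := hx (e.symm ⟨x', hx'⟩)
  simp only [Equiv.apply_symm_apply] at h1
  have h2 : c x' < inner ℝ (t • x) (v x') := hx'2
  rw [inner_smul_left, conj_trivial] at h2
  have h3 := hc x' (hT x' hx')
  nlinarith

/-- The outward prisms of height `b` over the facet pieces are pairwise disjoint, disjoint from the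
polyhedron, and contained in its parallel body. -/
lemma volume_add_frontier_le_hPoly {N : ℕ} {u : Fin N → E d} {h : Fin N → ℝ} (hu : ∀ i, ‖u i‖ = 1)
    {b : ℝ} (hb : 0 ≤ b) :
    volume (hPoly u h) + ENNReal.ofReal b *
      Measure.euclideanHausdorffMeasure (d - 1) (frontier (hPoly u h)) ≤
      volume (hPoly u h + Metric.closedBall 0 b) := by
  set Q := hPoly u h
  set Pr : Fin N → Set (E d) := fun i => prism (u i) (h i) b (facetPiece u h i)
  have hPm : ∀ i, MeasurableSet (Pr i) := fun i =>
    measurableSet_prism _ _ _ (measurableSet_facetPiece u h i)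
  have hPd : Pairwise (Function.onFun Disjoint Pr) := by
    intro i j hij
    refine Set.disjoint_left.2 fun y hi hj => hij ?_
    obtain ⟨hi1, -, hi3⟩ := hi
    obtain ⟨hj1, -, hj3⟩ := hj
    set s := inner ℝ y (u i) - h i
    set s' := inner ℝ y (u j) - h j
    have hs : 0 < s := sub_pos.2 hi1
    have hs' : 0 < s' := sub_pos.2 hj1
    set x := y - s • u i with hx
    set x' := y - s' • u j with hx'
    have hxQ : x ∈ Q := (isClosed_hPoly u h).frontier_subset hi3.1
    have hxQ' : x' ∈ Q := (isClosed_hPoly u h).frontier_subset hj3.1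
    have e1 : x - x' = s' • u j - s • u i := by rw [hx, hx']; abel
    -- Both feet lie in `Q` and each maximizes its own normal direction over `Q`, so the right side
    -- is nonpositive and the feet coincide. The facet pieces are disjoint, so the two indices
    -- agree.
    have e2 : (inner ℝ (x - x') (x - x') : ℝ) =
        s' * (inner ℝ x (u j) - inner ℝ x' (u j)) - s * (inner ℝ x (u i) - inner ℝ x' (u i)) := by
      nth_rw 2 [e1]
      rw [inner_sub_right, inner_smul_right, inner_smul_right, inner_sub_left x x' (u j),
        inner_sub_left x x' (u i)]
    have h1 := hxQ j
    have h2 := hxQ' i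
    have h3 := hi3.2.1
    have h4 := hj3.2.1
    have hle : (inner ℝ (x - x') (x - x') : ℝ) ≤ 0 := by
      rw [e2, h3, h4]
      nlinarith
    have hxx : x = x' := sub_eq_zero.1 (inner_self_eq_zero.1 (le_antisymm hle real_inner_self_nonneg))
    by_contra hne
    exact Set.disjoint_left.1 (disjoint_facetPiece u h hne) hi3 (hxx ▸ hj3)
  have hQd : Disjoint Q (⋃ i, Pr i) := by
    rw [Set.disjoint_iUnion_right]
    exact fun i => Set.disjoint_left.2 fun y hy hyP => absurd (hy i) (not_le.2 hyP.1)
  have hsub : Q ∪ ⋃ i, Pr i ⊆ Q + Metric.closedBall 0 b := by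
    refine Set.union_subset (fun y hy => ⟨y, hy, 0, by simpa using hb, add_zero y⟩) ?_
    refine Set.iUnion_subset fun i y hy => ?_
    refine ⟨_, (isClosed_hPoly u h).frontier_subset hy.2.2.1,
      (inner ℝ y (u i) - h i : ℝ) • u i, ?_, by simp⟩
    rw [mem_closedBall_zero_iff, norm_smul, hu i, mul_one, Real.norm_of_nonneg (by linarith [hy.1])]
    linarith [hy.2.1]
  refine le_trans (le_of_eq ?_) (measure_mono hsub)
  rw [measure_union hQd (MeasurableSet.iUnion hPm), measure_iUnion hPd hPm, tsum_fintype,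
    ← sum_facetPiece u h (d - 1), Finset.mul_sum]
  congr 1
  refine Finset.sum_congr rfl fun i _ => ?_
  rw [volume_prism (hu i) (measurableSet_facetPiece u h i) fun x hx => hx.2.1]

/-- A point of the parallel body outside `Q` projects radially to a facet piece, so the added part
is covered by slabs of cones with apex `0`. The inradius `r` bounds every `h i` from below, so
sections of a slab exceed the facet piece by a factor at most `(1 + b / r) ^ (d - 1)`. -/
lemma volume_add_closedBall_hPoly_le {N : ℕ} {u : Fin N → E d} {h : Fin N → ℝ}
    (hu : ∀ i, ‖u i‖ = 1) {r : ℝ} (hr : 0 < r) (hrQ : Metric.closedBall 0 r ⊆ hPoly u h) {b : ℝ}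
    (hb : 0 ≤ b) :
    volume (hPoly u h + Metric.closedBall 0 b) ≤ volume (hPoly u h) +
      ENNReal.ofReal (b * (1 + b / r) ^ (d - 1)) *
      Measure.euclideanHausdorffMeasure (d - 1) (frontier (hPoly u h)) := by
  set Q := hPoly u h
  have hrh : ∀ i, r ≤ h i := by
    intro i
    have h1 : r • u i ∈ Q := hrQ (by
      rw [mem_closedBall_zero_iff, norm_smul, hu i, mul_one, Real.norm_of_nonneg hr.le])
    have h2 := h1 i
    rw [inner_smul_left, real_inner_self_eq_norm_sq, hu i] at h2
    simpa using h2
  have h0 : (0 : E d) ∈ interior Q :=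
    mem_interior_iff_mem_nhds.2 (mem_of_superset (Metric.closedBall_mem_nhds 0 hr) hrQ)
  have hsub : Q + Metric.closedBall 0 b ⊆
      Q ∪ ⋃ i, coneSlab (u i) (h i) (h i) (h i + b) (facetPiece u h i) := by
    rintro x ⟨q, hq, w, hw, rfl⟩
    by_cases hx : q + w ∈ Q
    · exact Or.inl hx
    right
    obtain ⟨y, hy, β, hβ, hxy⟩ := exists_radial (isClosed_hPoly u h) h0 hx
    rw [← iUnion_facetPiece] at hy
    obtain ⟨i, hi⟩ := Set.mem_iUnion.1 hy
    refine Set.mem_iUnion.2 ⟨i, ?_⟩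
    have hhi : 0 < h i := hr.trans_le (hrh i)
    have e1 : inner ℝ (q + w) (u i) = (1 + β) * h i := by
      rw [hxy, inner_smul_left, hi.2.1]; simp
    refine ⟨by rw [e1]; nlinarith, ?_, ?_⟩
    · rw [inner_add_left]
      have h1 := hq i
      have h2 := real_inner_le_norm w (u i)
      rw [hu i, mul_one] at h2
      have h3 := mem_closedBall_zero_iff.1 hw
      linarith
    · change (h i / inner ℝ (q + w) (u i) : ℝ) • (q + w) ∈ _
      rw [e1, hxy, smul_smul]
      have : h i / ((1 + β) * h i) * (1 + β) = 1 := by field_simp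
      rwa [this, one_smul]
  calc volume (Q + Metric.closedBall 0 b)
      ≤ volume Q + ∑ i, volume (coneSlab (u i) (h i) (h i) (h i + b) (facetPiece u h i)) := by
        refine (measure_mono hsub).trans ((measure_union_le _ _).trans ?_)
        gcongr
        exact (measure_iUnion_le _).trans (tsum_fintype _).le
    _ ≤ volume Q + ∑ i, ENNReal.ofReal (b * (1 + b / r) ^ (d - 1)) *
          Measure.euclideanHausdorffMeasure (d - 1) (facetPiece u h i) := by
        gcongr with i
        have hhi : 0 < h i := hr.trans_le (hrh i)
        refine (volume_coneSlab_le (hu i) hhi hhi.le (measurableSet_facetPiece u h i)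
          fun x hx => hx.2.1).trans ?_
        gcongr ENNReal.ofReal ?_ * _
        rw [add_sub_cancel_left, add_div, div_self hhi.ne']
        have := hrh i
        gcongr
    _ = _ := by rw [← Finset.mul_sum, sum_facetPiece]

lemma smul_frontier_measure {K : Set (E d)} {s : ℝ} (hs : 0 < s) (k : ℕ) :
    Measure.euclideanHausdorffMeasure k (frontier (s • K)) =
      ENNReal.ofReal (s ^ k) * Measure.euclideanHausdorffMeasure k (frontier K) := by
  have : frontier (s • K) = s • frontier K :=
    ((Homeomorph.smulOfNeZero s hs.ne').image_frontier K).symm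
  rw [this, Measure.euclideanHausdorffMeasure_smul₀ k hs.ne', ENNReal.smul_def, smul_eq_mul,
    ENNReal.ofReal_pow hs.le, ENNReal.coe_pow, Real.nnnorm_of_nonneg hs.le, ENNReal.ofReal,
    Real.toNNReal_of_nonneg hs.le]

lemma tendsto_ofReal_pow_one (k : ℕ) :
    Tendsto (fun s : ℝ => ENNReal.ofReal (s ^ k)) (𝓝[>] 1) (𝓝 1) := by
  have h1 : Tendsto (fun s : ℝ => s ^ k) (𝓝[>] 1) (𝓝 (1 ^ k)) :=
    ((continuous_pow k).tendsto 1).mono_left nhdsWithin_le_nhds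
  have := ENNReal.tendsto_ofReal h1
  simpa using this

/-- The outer parallel volume of a convex body is bounded below by its surface area. -/
theorem volume_add_frontier_le {K : Set (E d)} (hK : IsCompact K) (hconv : Convex ℝ K)
    (h0 : 0 ∈ interior K) {b : ℝ} (hb : 0 ≤ b) :
    volume K + ENNReal.ofReal b * Measure.euclideanHausdorffMeasure (d - 1) (frontier K) ≤
      volume (K + Metric.closedBall 0 b) := by
  -- A polytope between `K` and `s K` transfers the polyhedral bound, using monotonicity of surface
  -- area; then `s → 1`.
  have hstep : ∀ s : ℝ, 1 < s →
      volume K + ENNReal.ofReal b * Measure.euclideanHausdorffMeasure (d - 1) (frontier K) ≤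
      ENNReal.ofReal (s ^ d) * volume (K + Metric.closedBall 0 b) := by
    intro s hs
    have hs0 : 0 < s := one_pos.trans hs
    obtain ⟨N, u, h, hu, -, hKQ, hQK⟩ := exists_hPoly hK hconv h0 hs
    have hQc : IsCompact (hPoly u h) := (hK.smul s).of_isClosed_subset (isClosed_hPoly u h) hQK
    calc volume K + ENNReal.ofReal b * Measure.euclideanHausdorffMeasure (d - 1) (frontier K)
        ≤ volume (hPoly u h) + ENNReal.ofReal b *
            Measure.euclideanHausdorffMeasure (d - 1) (frontier (hPoly u h)) := by
          gcongr ?_ + _ * ?_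
          · exact measure_mono hKQ
          · exact euclideanHausdorffMeasure_frontier_mono hconv hK.isClosed ⟨0, h0⟩ hQc hKQ _
      _ ≤ volume (hPoly u h + Metric.closedBall 0 b) := volume_add_frontier_le_hPoly hu hb
      _ ≤ volume (s • (K + Metric.closedBall 0 b)) := by
          refine measure_mono ?_
          rw [smul_add]
          refine Set.add_subset_add hQK ?_
          rw [smul_closedBall _ _ hb, smul_zero]
          refine Metric.closedBall_subset_closedBall ?_
          rw [Real.norm_of_nonneg hs0.le]
          exact le_mul_of_one_le_left hb hs.le
      _ = ENNReal.ofReal (s ^ d) * volume (K + Metric.closedBall 0 b) := by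
          rw [Measure.addHaar_smul, finrank_euclideanSpace_fin, abs_of_pos (pow_pos hs0 d)]
  have hfin : volume (K + Metric.closedBall 0 b) ≠ ⊤ :=
    (hK.add (isCompact_closedBall 0 b)).measure_lt_top.ne
  have hlim : Tendsto (fun s : ℝ => ENNReal.ofReal (s ^ d) * volume (K + Metric.closedBall 0 b))
      (𝓝[>] 1) (𝓝 (volume (K + Metric.closedBall 0 b))) := by
    have := ENNReal.Tendsto.mul_const (tendsto_ofReal_pow_one d)
      (Or.inr hfin)
    simpa using this
  exact ge_of_tendsto hlim (eventually_nhdsWithin_of_forall fun s hs => hstep s hs)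

lemma euclideanHausdorffMeasure_frontier_lt_top {K : Set (E d)} (hK : IsCompact K)
    (hconv : Convex ℝ K) (h0 : 0 ∈ interior K) :
    Measure.euclideanHausdorffMeasure (d - 1) (frontier K) < ⊤ := by
  have h1 := volume_add_frontier_le hK hconv h0 zero_le_one
  rw [ENNReal.ofReal_one, one_mul] at h1
  exact (le_add_self.trans h1).trans_lt (hK.add (isCompact_closedBall 0 1)).measure_lt_top

/-- The outer parallel volume of a convex body is bounded above, to first order, by its surface
area. -/
theorem volume_add_closedBall_le {K : Set (E d)} (hK : IsCompact K) (hconv : Convex ℝ K) {r : ℝ}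
    (hr : 0 < r) (hrK : Metric.closedBall 0 r ⊆ K) {b : ℝ} (hb : 0 ≤ b) :
    volume (K + Metric.closedBall 0 b) ≤ volume K + ENNReal.ofReal (b * (1 + b / r) ^ (d - 1)) *
      Measure.euclideanHausdorffMeasure (d - 1) (frontier K) := by
  have h0 : (0 : E d) ∈ interior K :=
    mem_interior_iff_mem_nhds.2 (mem_of_superset (Metric.closedBall_mem_nhds 0 hr) hrK)
  set A := Measure.euclideanHausdorffMeasure (d - 1) (frontier K)
  have hA : A ≠ ⊤ := (euclideanHausdorffMeasure_frontier_lt_top hK hconv h0).ne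
  set m := ENNReal.ofReal (b * (1 + b / r) ^ (d - 1))
  have hstep : ∀ s : ℝ, 1 < s → volume (K + Metric.closedBall 0 b) ≤
      ENNReal.ofReal (s ^ d) * volume K + m * (ENNReal.ofReal (s ^ (d - 1)) * A) := by
    intro s hs
    have hs0 : 0 < s := one_pos.trans hs
    obtain ⟨N, u, h, hu, -, hKQ, hQK⟩ := exists_hPoly hK hconv h0 hs
    have hQint : (interior (hPoly u h)).Nonempty := ⟨0, interior_mono hKQ h0⟩
    calc volume (K + Metric.closedBall 0 b)
        ≤ volume (hPoly u h + Metric.closedBall 0 b) := measure_mono (Set.add_subset_add_right hKQ)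
      _ ≤ volume (hPoly u h) + m *
            Measure.euclideanHausdorffMeasure (d - 1) (frontier (hPoly u h)) :=
          volume_add_closedBall_hPoly_le hu hr (hrK.trans hKQ) hb
      _ ≤ ENNReal.ofReal (s ^ d) * volume K + m * (ENNReal.ofReal (s ^ (d - 1)) * A) := by
          gcongr ?_ + _ * ?_
          · refine (measure_mono hQK).trans_eq ?_
            rw [Measure.addHaar_smul, finrank_euclideanSpace_fin, abs_of_pos (pow_pos hs0 d)]
          · rw [← smul_frontier_measure hs0]
            exact euclideanHausdorffMeasure_frontier_mono (convex_hPoly u h) (isClosed_hPoly u h)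
              hQint (hK.smul s) hQK _
  have hlim : Tendsto (fun s : ℝ => ENNReal.ofReal (s ^ d) * volume K +
      m * (ENNReal.ofReal (s ^ (d - 1)) * A)) (𝓝[>] 1) (𝓝 (volume K + m * A)) := by
    have h1 := ENNReal.Tendsto.mul_const (tendsto_ofReal_pow_one d)
      (b := volume K) (Or.inr hK.measure_lt_top.ne)
    have h2 := ENNReal.Tendsto.mul_const (tendsto_ofReal_pow_one (d - 1)) (Or.inr hA)
    have h3 := ENNReal.Tendsto.const_mul h2 (a := m) (Or.inr ENNReal.ofReal_ne_top)
    rw [one_mul] at h1 h3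
    exact h1.add h3
  exact ge_of_tendsto hlim (eventually_nhdsWithin_of_forall fun s hs => hstep s hs)

end

section

variable {n : ℕ}

/-! ### Support functions and Wulff shapes -/

lemma bddAbove_inner (K : ConvexBody (E n)) (u : E n) :
    BddAbove ((fun y : E n => (inner ℝ y u : ℝ)) '' (K : Set (E n))) :=
  (K.isCompact.image (by fun_prop)).bddAbove

lemma inner_le_supportFunction (K : ConvexBody (E n)) (u : E n) {y : E n} (hy : y ∈ K) :
    inner ℝ y u ≤ supportFunction K u :=
  le_csSup (bddAbove_inner K u) ⟨y, hy, rfl⟩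

lemma supportFunction_le (K : ConvexBody (E n)) (u : E n) {c : ℝ}
    (h : ∀ y ∈ K, inner ℝ y u ≤ c) : supportFunction K u ≤ c := by
  refine csSup_le (K.nonempty.image _) ?_
  rintro _ ⟨y, hy, rfl⟩
  exact h y hy

lemma supportFunction_eq_of_isMax (K : ConvexBody (E n)) (u : E n) {y : E n} (hy : y ∈ K)
    (h : ∀ z ∈ K, inner ℝ z u ≤ (inner ℝ y u : ℝ)) : supportFunction K u = inner ℝ y u :=
  le_antisymm (supportFunction_le K u h) (inner_le_supportFunction K u hy)

lemma mem_supportFace_iff {K : ConvexBody (E n)} {u y : E n} :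
    y ∈ supportFace K u ↔ y ∈ K ∧ inner ℝ y u = supportFunction K u := by
  constructor
  · rintro ⟨hy, h⟩
    exact ⟨hy, (supportFunction_eq_of_isMax K u hy h).symm⟩
  · rintro ⟨hy, h⟩
    exact ⟨hy, fun z hz => h ▸ inner_le_supportFunction K u hz⟩

lemma exists_mem_eq_supportFunction (K : ConvexBody (E n)) (u : E n) :
    ∃ y ∈ K, inner ℝ y u = supportFunction K u := by
  obtain ⟨y, hy, h⟩ := K.isCompact.exists_isMaxOn K.nonempty
    (f := fun y : E n => (inner ℝ y u : ℝ)) (by fun_prop)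
  exact ⟨y, hy, (supportFunction_eq_of_isMax K u hy fun z hz => h hz).symm⟩

lemma isCompact_supportFace (K : ConvexBody (E n)) (u : E n) : IsCompact (supportFace K u) := by
  have : supportFace K u = (K : Set (E n)) ∩ {y | inner ℝ y u = supportFunction K u} := by
    ext y; exact mem_supportFace_iff
  rw [this]
  exact K.isCompact.inter_right (isClosed_eq (by fun_prop) continuous_const)

lemma convex_supportFace (K : ConvexBody (E n)) (u : E n) : Convex ℝ (supportFace K u) := by
  intro x hx y hy a b ha hb hab
  rw [mem_supportFace_iff] at hx hy ⊢
  refine ⟨K.convex hx.1 hy.1 ha hb hab, ?_⟩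
  rw [inner_add_left, inner_smul_left, inner_smul_left, hx.2, hy.2]
  simp only [conj_trivial]
  rw [← add_mul, hab, one_mul]

lemma nonempty_supportFace (K : ConvexBody (E n)) (u : E n) : (supportFace K u).Nonempty := by
  obtain ⟨y, hy, h⟩ := exists_mem_eq_supportFunction K u
  exact ⟨y, mem_supportFace_iff.2 ⟨hy, h⟩⟩

lemma supportFunction_ge_of_closedBall_subset {K : ConvexBody (E n)} {r : ℝ} (hr : 0 ≤ r)
    (hK : Metric.closedBall 0 r ⊆ (K : Set (E n))) {u : E n} (hu : ‖u‖ = 1) :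
    r ≤ supportFunction K u := by
  have h1 : r • u ∈ K := hK (by
    rw [mem_closedBall_zero_iff, norm_smul, hu, mul_one, Real.norm_of_nonneg hr])
  have := inner_le_supportFunction K u h1
  rw [inner_smul_left, real_inner_self_eq_norm_sq, hu] at this
  simpa using this

lemma isClosed_wulffShape (g : Metric.sphere (0 : E n) 1 → ℝ) : IsClosed (wulffShape g) := by
  have : wulffShape g = ⋂ u : Metric.sphere (0 : E n) 1, {x : E n | inner ℝ x (u : E n) ≤ g u} := by
    ext; simp [wulffShape]
  rw [this]
  exact isClosed_iInter fun i => isClosed_le (by fun_prop) continuous_const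

lemma convex_wulffShape (g : Metric.sphere (0 : E n) 1 → ℝ) : Convex ℝ (wulffShape g) := by
  intro x hx y hy a b ha hb hab u
  rw [inner_add_left, inner_smul_left, inner_smul_left]
  simp only [conj_trivial]
  calc a * inner ℝ x (u : E n) + b * inner ℝ y (u : E n) ≤ a * g u + b * g u := by
        gcongr
        exacts [hx u, hy u]
    _ = g u := by rw [← add_mul, hab, one_mul]

/-- The Wulff shape of `h_K + τ f`. -/
def wulffPerturb (K : ConvexBody (E n)) (f : Metric.sphere (0 : E n) 1 → ℝ) (τ : ℝ) : Set (E n) :=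
  wulffShape fun u => supportFunction K u + τ * f u

section

variable {K : ConvexBody (E n)} {f : Metric.sphere (0 : E n) 1 → ℝ} {τ : ℝ}

lemma subset_wulffPerturb (hf : ∀ u, 0 ≤ f u) (hτ : 0 ≤ τ) :
    (K : Set (E n)) ⊆ wulffPerturb K f τ := by
  intro x hx u
  have := inner_le_supportFunction K u hx
  have := mul_nonneg hτ (hf u)
  linarith

/-- At the boundary point `y` where the ray to `x` leaves `K`, take an outer normal `v`. The single
constraint of the Wulff shape at `v` bounds the radial excess `β`; in particular there is no excess
where `f v = 0` and `h_K v > 0`. -/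
lemma exists_radial_wulffPerturb (h0 : 0 ∈ interior (K : Set (E n))) {x : E n}
    (hx : x ∈ wulffPerturb K f τ) (hxK : x ∉ K) :
    ∃ y ∈ K, ∃ v : Metric.sphere (0 : E n) 1, inner ℝ y (v : E n) = supportFunction K v ∧
      ∃ β : ℝ, 0 < β ∧ x = (1 + β) • y ∧ β * supportFunction K v ≤ τ * f v := by
  obtain ⟨y, hy, β, hβ, hxy⟩ := exists_radial K.isClosed h0 hxK
  obtain ⟨v, hv, hv'⟩ := exists_unit_normal K.convex ⟨0, h0⟩ hy.2
  have hyK : y ∈ K := K.isClosed.frontier_subset hy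
  have hsup := supportFunction_eq_of_isMax K v hyK hv'
  refine ⟨y, hyK, ⟨v, by simpa using hv⟩, hsup.symm, β, hβ, hxy, ?_⟩
  have h1 := hx ⟨v, by simpa using hv⟩
  rw [hxy, inner_smul_left, conj_trivial] at h1
  simp only at h1
  rw [← hsup] at h1
  linarith

lemma smul_mem_of_le {y : E n} (h0 : (0 : E n) ∈ K) (hy : y ∈ K) {s t : ℝ} (hs : 0 ≤ s)
    (hst : s ≤ t) : s • y ∈ t • (K : Set (E n)) := by
  rcases eq_or_lt_of_le (hs.trans hst) with h | h
  · have hs0 : s = 0 := le_antisymm (h ▸ hst) hs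
    rw [hs0, zero_smul]
    exact ⟨0, h0, smul_zero _⟩
  · refine ⟨(s / t) • y, ?_, ?_⟩
    · exact K.convex.smul_mem_of_zero_mem h0 hy ⟨by positivity, (div_le_one h).2 hst⟩
    · change t • (s / t) • y = _
      rw [smul_smul, mul_div_cancel₀ _ h.ne']

lemma wulffPerturb_subset_smul {r : ℝ} (hr : 0 < r)
    (hK : Metric.closedBall 0 r ⊆ (K : Set (E n))) (hf1 : ∀ u, f u ≤ 1) (hτ : 0 ≤ τ) :
    wulffPerturb K f τ ⊆ (1 + τ / r) • (K : Set (E n)) := by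
  have h0 : 0 ∈ interior (K : Set (E n)) :=
    mem_interior_iff_mem_nhds.2 (mem_of_superset (Metric.closedBall_mem_nhds 0 hr) hK)
  have h0K : (0 : E n) ∈ K := interior_subset h0
  intro x hx
  by_cases hxK : x ∈ K
  · have := smul_mem_of_le (s := 1) (t := 1 + τ / r) h0K hxK zero_le_one
      (le_add_of_nonneg_right (by positivity))
    rwa [one_smul] at this
  · obtain ⟨y, hy, v, hv, β, hβ, rfl, hle⟩ := exists_radial_wulffPerturb h0 hx hxK
    refine smul_mem_of_le h0K hy (by positivity) ?_
    gcongr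
    rw [le_div_iff₀ hr]
    have h1 := supportFunction_ge_of_closedBall_subset hr.le hK (u := v) (by simp)
    nlinarith [hf1 v]

/-- The Wulff shape of `h_K + τ f` as a convex body. -/
lemma exists_wulffBody {r : ℝ} (hr : 0 < r)
    (hK : Metric.closedBall 0 r ⊆ (K : Set (E n))) (hf : ∀ u, 0 ≤ f u) (hf1 : ∀ u, f u ≤ 1)
    (hτ : 0 ≤ τ) : ∃ A : ConvexBody (E n), (A : Set (E n)) = wulffPerturb K f τ :=
  ⟨⟨wulffPerturb K f τ, convex_wulffShape _,
    (K.isCompact.smul (1 + τ / r)).of_isClosed_subset (isClosed_wulffShape _)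
      (wulffPerturb_subset_smul hr hK hf1 hτ), K.nonempty.mono (subset_wulffPerturb hf hτ)⟩, rfl⟩

end

/-! ### Cones over the part of the boundary with prescribed normals, and the volume added by a Wulff
perturbation. -/

/-- The union of the segments from `0` to the boundary points of `K` having an outer normal
in `U`. -/
def normalCone (K : ConvexBody (E n)) (U : Set (Metric.sphere (0 : E n) 1)) : Set (E n) :=
  {x | ∃ s ∈ Set.Icc (0 : ℝ) 1, ∃ y ∈ K, ∃ u ∈ U, (∀ z ∈ K, inner ℝ z (u : E n) ≤ (inner ℝ y (u : E n) : ℝ)) ∧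
    x = s • y}

/-- Triples consisting of a scaling factor, a boundary point and an outer normal at that point. -/
def normalTriples (K : ConvexBody (E n)) : Set (ℝ × E n × Metric.sphere (0 : E n) 1) :=
  (Set.Icc 0 1 ×ˢ ((K : Set (E n)) ×ˢ Set.univ)) ∩
    ⋂ z ∈ K, {p | inner ℝ z (p.2.2 : E n) ≤ (inner ℝ p.2.1 (p.2.2 : E n) : ℝ)}

lemma isCompact_normalTriples (K : ConvexBody (E n)) : IsCompact (normalTriples K) := by
  refine (isCompact_Icc.prod (K.isCompact.prod isCompact_univ)).inter_right ?_
  exact isClosed_biInter fun z _ => isClosed_le (by fun_prop) (by fun_prop)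

lemma mem_normalTriples {K : ConvexBody (E n)} {p : ℝ × E n × Metric.sphere (0 : E n) 1} :
    p ∈ normalTriples K ↔ p.1 ∈ Set.Icc (0 : ℝ) 1 ∧ p.2.1 ∈ K ∧
      ∀ z ∈ K, inner ℝ z (p.2.2 : E n) ≤ (inner ℝ p.2.1 (p.2.2 : E n) : ℝ) := by
  simp only [normalTriples, Set.mem_inter_iff, Set.mem_prod, Set.mem_univ, and_true, Set.mem_iInter,
    and_assoc]
  rfl

lemma normalCone_eq_image (K : ConvexBody (E n)) (U : Set (Metric.sphere (0 : E n) 1)) :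
    normalCone K U = (fun p : ℝ × E n × Metric.sphere (0 : E n) 1 => p.1 • p.2.1) ''
      (normalTriples K ∩ (fun p => p.2.2) ⁻¹' U) := by
  ext x
  constructor
  · rintro ⟨s, hs, y, hy, u, hu, h, rfl⟩
    exact ⟨(s, y, u), ⟨mem_normalTriples.2 ⟨hs, hy, h⟩, hu⟩, rfl⟩
  · rintro ⟨⟨s, y, u⟩, ⟨hp, hu⟩, rfl⟩
    obtain ⟨hs, hy, h⟩ := mem_normalTriples.1 hp
    exact ⟨s, hs, y, hy, u, hu, h, rfl⟩

lemma isCompact_normalCone (K : ConvexBody (E n)) {U : Set (Metric.sphere (0 : E n) 1)}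
    (hU : IsClosed U) : IsCompact (normalCone K U) := by
  rw [normalCone_eq_image]
  exact ((isCompact_normalTriples K).inter_right (hU.preimage (by fun_prop))).image (by fun_prop)

/-- Upper semicontinuity of the normal correspondence: the triples whose scaled point misses `O`
form a compact set, so their normals form a closed set, and `u₀` is not in it. -/
lemma exists_nhds_normalCone_subset (K : ConvexBody (E n)) (u₀ : Metric.sphere (0 : E n) 1)
    {O : Set (E n)} (hO : IsOpen O) (h : normalCone K {u₀} ⊆ O) :
    ∃ U ∈ 𝓝 u₀, normalCone K U ⊆ O := by
  set Bad := normalTriples K ∩ (fun p : ℝ × E n × Metric.sphere (0 : E n) 1 => p.1 • p.2.1) ⁻¹' Oᶜ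
  have hBad : IsCompact Bad :=
    (isCompact_normalTriples K).inter_right (hO.isClosed_compl.preimage (by fun_prop))
  have hcl : IsClosed ((fun p : ℝ × E n × Metric.sphere (0 : E n) 1 => p.2.2) '' Bad) :=
    (hBad.image (by fun_prop)).isClosed
  refine ⟨_, hcl.isOpen_compl.mem_nhds ?_, ?_⟩
  · rintro ⟨⟨s, y, u⟩, ⟨hp, hp'⟩, rfl⟩
    obtain ⟨hs, hy, hn⟩ := mem_normalTriples.1 hp
    exact hp' (h ⟨s, hs, y, hy, _, rfl, hn, rfl⟩)
  · rintro _ ⟨s, hs, y, hy, u, hu, hn, rfl⟩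
    by_contra hO'
    exact hu ⟨(s, y, u), ⟨mem_normalTriples.2 ⟨hs, hy, hn⟩, hO'⟩, rfl⟩

lemma volume_normalCone_singleton_le (hn : 0 < n) (K : ConvexBody (E n))
    (u₀ : Metric.sphere (0 : E n) 1) (hpos : 0 < supportFunction K u₀) :
    volume (normalCone K {u₀}) ≤ ENNReal.ofReal (supportFunction K u₀ / n) *
      Measure.euclideanHausdorffMeasure (n - 1) (supportFace K u₀) := by
  have hu : ‖(u₀ : E n)‖ = 1 := by simp
  rw [← volume_cone hu hpos (isCompact_supportFace K u₀).isClosed.measurableSet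
    fun x hx => (mem_supportFace_iff.1 hx).2]
  set h := supportFunction K u₀
  have hsub : normalCone K {u₀} ⊆ {0} ∪ coneSlab (u₀ : E n) h 0 h (supportFace K u₀) := by
    rintro _ ⟨s, hs, y, hy, u, rfl, hn, rfl⟩
    rcases eq_or_lt_of_le hs.1 with hs0 | hs0
    · left; simp [← hs0]
    right
    have hyF : y ∈ supportFace K (u : E n) := ⟨hy, hn⟩
    have hyu := (mem_supportFace_iff.1 hyF).2
    have e : inner ℝ (s • y) (u : E n) = s * h := by
      rw [inner_smul_left, hyu]; simp [h]
    refine ⟨?_, ?_, ?_⟩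
    · rw [e]; positivity
    · rw [e]; exact mul_le_of_le_one_left hpos.le hs.2
    · rw [e, smul_smul]
      have : h / (s * h) * s = 1 := by field_simp
      rwa [this, one_smul]
  refine (measure_mono hsub).trans ((measure_union_le _ _).trans ?_)
  have : Nontrivial (E n) := by
    have : Nonempty (Fin n) := ⟨⟨0, hn⟩⟩
    infer_instance
  rw [measure_singleton, zero_add]

/-- The cone for the single normal `u₀` is the cone over the face, of volume `h |F| / n`. Outer
regularity and semicontinuity extend the bound to nearby normals with an error `ε`. One maximizing
point at `u₀` gives the lower bound on the support function. -/
lemma exists_nhds_volume_normalCone_le (hn : 0 < n) (K : ConvexBody (E n))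
    (u₀ : Metric.sphere (0 : E n) 1) (hpos : 0 < supportFunction K u₀)
    (hF : Measure.euclideanHausdorffMeasure (n - 1) (supportFace K u₀) ≠ ⊤) {ε : ℝ} (hε : 0 < ε) :
    ∃ U ∈ 𝓝 u₀, IsClosed U ∧
      volume.real (normalCone K U) ≤ supportFunction K u₀ / n *
        (Measure.euclideanHausdorffMeasure (n - 1)).real (supportFace K u₀) + ε ∧
      ∀ u ∈ U, supportFunction K u₀ - ε ≤ supportFunction K u := by
  have hlt : volume (normalCone K {u₀}) < ENNReal.ofReal (supportFunction K u₀ / n) *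
      Measure.euclideanHausdorffMeasure (n - 1) (supportFace K u₀) + ENNReal.ofReal ε := by
    refine (volume_normalCone_singleton_le hn K u₀ hpos).trans_lt ?_
    exact ENNReal.lt_add_right (ENNReal.mul_ne_top ENNReal.ofReal_ne_top hF)
      (by simpa using hε)
  obtain ⟨O, hO, hOo, hOlt⟩ := Set.exists_isOpen_lt_of_lt _ _ hlt
  obtain ⟨U₁, hU₁, hU₁O⟩ := exists_nhds_normalCone_subset K u₀ hOo hO
  obtain ⟨y, hy, hyu⟩ := exists_mem_eq_supportFunction K u₀
  have hU₂ : {u : Metric.sphere (0 : E n) 1 | supportFunction K u₀ - ε < inner ℝ y (u : E n)} ∈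
      𝓝 u₀ := by
    refine (isOpen_lt continuous_const (by fun_prop)).mem_nhds ?_
    change supportFunction K u₀ - ε < inner ℝ y (u₀ : E n)
    rw [hyu]; linarith
  obtain ⟨U, hU, hUcl, hUsub⟩ := exists_mem_nhds_isClosed_subset (inter_mem hU₁ hU₂)
  refine ⟨U, hU, hUcl, ?_, fun u hu => ?_⟩
  · have h1 : volume (normalCone K U) ≤ ENNReal.ofReal (supportFunction K u₀ / n) *
      Measure.euclideanHausdorffMeasure (n - 1) (supportFace K u₀) + ENNReal.ofReal ε := by
      refine le_trans (measure_mono ?_) hOlt.le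
      refine subset_trans ?_ hU₁O
      rintro _ ⟨s, hs, y, hy, u, hu, h, rfl⟩
      exact ⟨s, hs, y, hy, u, (hUsub hu).1, h, rfl⟩
    have h2 := ENNReal.toReal_mono (ENNReal.add_ne_top.2
      ⟨ENNReal.mul_ne_top ENNReal.ofReal_ne_top hF, ENNReal.ofReal_ne_top⟩) h1
    rw [ENNReal.toReal_add (ENNReal.mul_ne_top ENNReal.ofReal_ne_top hF) ENNReal.ofReal_ne_top,
      ENNReal.toReal_mul, ENNReal.toReal_ofReal (by positivity), ENNReal.toReal_ofReal hε.le] at h2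
    exact h2
  · exact (le_of_lt (hUsub hu).2).trans (inner_le_supportFunction K u hy)

/-- Points gained by the perturbation lie radially over boundary points with a normal in `U`, and
the radial factor is at most `ρ = 1 + τ / η`. They all lie in `ρ Z \ Z`, where `Z` is the
star-shaped cone of these normals. -/
lemma volume_wulffPerturb_le {K : ConvexBody (E n)} (h0 : 0 ∈ interior (K : Set (E n)))
    {U : Set (Metric.sphere (0 : E n) 1)} (hU : IsClosed U) {η : ℝ} (hη : 0 < η)
    (hUη : ∀ u ∈ U, η ≤ supportFunction K u) {f : Metric.sphere (0 : E n) 1 → ℝ}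
    (hf1 : ∀ u, f u ≤ 1) (hfU : ∀ u, u ∉ U → f u = 0) {τ : ℝ} (hτ : 0 ≤ τ) :
    volume.real (wulffPerturb K f τ) ≤
      volume.real (K : Set (E n)) + ((1 + τ / η) ^ n - 1) * volume.real (normalCone K U) := by
  have h0K : (0 : E n) ∈ K := interior_subset h0
  set Z := normalCone K U
  have hZ : IsCompact Z := isCompact_normalCone K hU
  set ρ := 1 + τ / η with hρdef
  have hρ : 1 ≤ ρ := le_add_of_nonneg_right (by positivity)
  have hρ0 : 0 < ρ := one_pos.trans_le hρ
  have hstar : ∀ x ∈ Z, ∀ s ∈ Set.Icc (0 : ℝ) 1, s • x ∈ Z := by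
    rintro _ ⟨s, hs, y, hy, u, hu, h, rfl⟩ s' hs'
    exact ⟨s' * s, ⟨mul_nonneg hs'.1 hs.1, mul_le_one₀ hs'.2 hs.1 hs.2⟩, y, hy, u, hu, h,
      smul_smul _ _ _⟩
  have hZK : Z ⊆ (K : Set (E n)) := by
    rintro _ ⟨s, hs, y, hy, u, hu, h, rfl⟩
    exact K.convex.smul_mem_of_zero_mem h0K hy hs
  have hZρ : Z ⊆ ρ • Z := fun x hx => ⟨ρ⁻¹ • x,
    hstar x hx _ ⟨by positivity, inv_le_one_of_one_le₀ hρ⟩, smul_inv_smul₀ hρ0.ne' x⟩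
  have hsub : wulffPerturb K f τ ⊆ (K : Set (E n)) ∪ (ρ • Z \ Z) := by
    intro x hx
    by_cases hxK : x ∈ K
    · exact Or.inl hxK
    right
    refine ⟨?_, fun h => hxK (hZK h)⟩
    obtain ⟨y, hy, v, hv, β, hβ, rfl, hle⟩ := exists_radial_wulffPerturb h0 hx hxK
    have hn : ∀ z ∈ K, inner ℝ z (v : E n) ≤ (inner ℝ y (v : E n) : ℝ) := fun z hz =>
      hv ▸ inner_le_supportFunction K v hz
    have hvU : v ∈ U := by
      by_contra hvU
      rw [hfU v hvU, mul_zero] at hle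
      obtain ⟨r, hr, hrK⟩ := Metric.nhds_basis_closedBall.mem_iff.1 (mem_interior_iff_mem_nhds.1 h0)
      have h1 := supportFunction_ge_of_closedBall_subset hr.le hrK (u := v) (by simp)
      have := mul_pos hβ (hr.trans_le h1)
      linarith
    have hβρ : 1 + β ≤ ρ := by
      rw [hρdef]
      gcongr
      rw [le_div_iff₀ hη]
      have := hUη v hvU
      nlinarith [hf1 v]
    refine ⟨((1 + β) / ρ) • y, ⟨(1 + β) / ρ, ⟨by positivity, (div_le_one hρ0).2 hβρ⟩, y, hy, v, hvU,
      hn, rfl⟩, ?_⟩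
    change ρ • ((1 + β) / ρ) • y = _
    rw [smul_smul, mul_div_cancel₀ _ hρ0.ne']
  have hfinK := K.isCompact.measure_lt_top (μ := (volume : Measure (E n))).ne
  have hfinZ := (hZ.smul ρ).measure_lt_top (μ := (volume : Measure (E n))).ne
  calc volume.real (wulffPerturb K f τ)
      ≤ volume.real ((K : Set (E n)) ∪ (ρ • Z \ Z)) :=
        measureReal_mono hsub (measure_union_ne_top hfinK
          (measure_ne_top_of_subset Set.sdiff_subset hfinZ))
    _ ≤ volume.real (K : Set (E n)) + volume.real (ρ • Z \ Z) := measureReal_union_le _ _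
    _ = _ := by
        rw [measureReal_sdiff hZρ hZ.isClosed.measurableSet hfinZ]
        congr 1
        rw [measureReal_def, Measure.addHaar_smul, finrank_euclideanSpace_fin, ENNReal.toReal_mul,
          ENNReal.toReal_ofReal (abs_nonneg _), abs_of_pos (by positivity), ← measureReal_def]
        ring

end

section

variable {n : ℕ}

/-! ### Charts of facets -/

lemma intrinsicFrontier_eq_frontier {C : Set (E n)} (hC : IsClosed C)
    (hspan : affineSpan ℝ C = ⊤) : intrinsicFrontier ℝ C = frontier C := by
  refine subset_antisymm intrinsicFrontier_subset_frontier ?_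
  have hint : intrinsicInterior ℝ C ⊆ interior C := by
    have hopen : IsOpen ((affineSpan ℝ C : AffineSubspace ℝ (E n)) : Set (E n)) := by
      rw [hspan]; exact isOpen_univ
    refine interior_maximal intrinsicInterior_subset ?_
    exact hopen.isOpenMap_subtype_val _ isOpen_interior
  rw [← closure_sdiff_intrinsicInterior, hC.frontier_eq, hC.closure_eq]
  exact Set.sdiff_subset_sdiff_right hint

lemma affineSpan_eq_top_of_interior_nonempty {C : Set (E n)} (h : (interior C).Nonempty) :
    affineSpan ℝ C = ⊤ :=
  top_unique ((isOpen_interior.affineSpan_eq_top h).ge.trans (affineSpan_mono ℝ interior_subset))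

lemma affineDim_of_interior_nonempty {C : Set (E n)} (h : (interior C).Nonempty) :
    affineDim C = n := by
  have h1 := affineSpan_eq_top_of_interior_nonempty h
  rw [affineDim, ← direction_affineSpan, h1, AffineSubspace.direction_top, finrank_top,
    finrank_euclideanSpace_fin]

lemma isop_of_interior_nonempty {C : Set (E n)} (hC : IsClosed C) (h : (interior C).Nonempty) :
    isop C = (Measure.euclideanHausdorffMeasure (n - 1)).real (frontier C) /
      (n * volume.real C) := by
  rw [isop, affineDim_of_interior_nonempty h, intrinsicFrontier_eq_frontier hC
    (affineSpan_eq_top_of_interior_nonempty h), EuclideanSpace.euclideanHausdorffMeasure_eq_volume]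

lemma exists_orthogonal_chart {d : ℕ} {u : E (d + 1)} (hu : ‖u‖ = 1) :
    ∃ ι : E d →ₗᵢ[ℝ] E (d + 1), (∀ z, inner ℝ (ι z) u = (0 : ℝ)) ∧
      ∀ w, inner ℝ w u = (0 : ℝ) → ∃ z, ι z = w := by
  have hu0 : u ≠ 0 := by rintro rfl; simp at hu
  have hfin : Module.finrank ℝ (ℝ ∙ u)ᗮ = d := by
    have := Submodule.finrank_add_finrank_orthogonal (ℝ ∙ u)
    rw [finrank_span_singleton hu0, finrank_euclideanSpace_fin] at this
    omega
  let e : E d ≃ₗᵢ[ℝ] (ℝ ∙ u)ᗮ := ((stdOrthonormalBasis ℝ (ℝ ∙ u)ᗮ).reindex (finCongr hfin)).repr.symm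
  refine ⟨((ℝ ∙ u)ᗮ).subtypeₗᵢ.comp e.toLinearIsometry, fun z => ?_, fun w hw => ?_⟩
  · exact Submodule.mem_orthogonal_singleton_iff_inner_left.1 (e z).2
  · exact ⟨e.symm ⟨w, Submodule.mem_orthogonal_singleton_iff_inner_left.2 hw⟩, by simp⟩

/-- An isometric parametrization of a facet by a full-dimensional convex body. -/
lemma exists_facet_chart {d : ℕ} (K : ConvexBody (E (d + 1))) {u : E (d + 1)} (hu : ‖u‖ = 1)
    (hdim : affineDim (supportFace K u) = d) :
    ∃ (y₀ : E (d + 1)) (ι : E d →ₗᵢ[ℝ] E (d + 1)) (C : Set (E d)),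
      (∀ z, inner ℝ (ι z) u = (0 : ℝ)) ∧ (∀ w, inner ℝ w u = (0 : ℝ) → ∃ z, ι z = w) ∧
      IsCompact C ∧ Convex ℝ C ∧ 0 ∈ interior C ∧
      supportFace K u = (fun z => y₀ + ι z) '' C := by
  obtain ⟨ι, hι, hι'⟩ := exists_orthogonal_chart hu
  set F := supportFace K u
  obtain ⟨y₁, hy₁⟩ := nonempty_supportFace K u
  have hFu : ∀ y ∈ F, inner ℝ (y - y₁) u = (0 : ℝ) := fun y hy => by
    rw [inner_sub_left, (mem_supportFace_iff.1 hy).2, (mem_supportFace_iff.1 hy₁).2, sub_self]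
  let φ : E d →ᵃⁱ[ℝ] E (d + 1) :=
    (AffineIsometryEquiv.constVAdd ℝ (E (d + 1)) y₁).toAffineIsometry.comp ι.toAffineIsometry
  have hφ : ∀ z, φ z = y₁ + ι z := fun z => rfl
  set C₀ : Set (E d) := φ ⁻¹' F with hC₀
  have himg : φ '' C₀ = F := by
    refine subset_antisymm (Set.image_preimage_subset _ _) fun y hy => ?_
    obtain ⟨z, hz⟩ := hι' _ (hFu y hy)
    have : φ z = y := by rw [hφ, hz, add_sub_cancel]
    exact ⟨z, by rw [hC₀, Set.mem_preimage, this]; exact hy, this⟩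
  have hconv₀ : Convex ℝ C₀ := (convex_supportFace K u).affine_preimage φ.toAffineMap
  have hcomp₀ : IsCompact C₀ :=
    φ.isometry.isClosedEmbedding.isCompact_preimage (isCompact_supportFace K u)
  have hspan : affineSpan ℝ C₀ = ⊤ := by
    have hne : C₀.Nonempty := by
      rw [← Set.image_nonempty (f := φ), himg]; exact ⟨y₁, hy₁⟩
    rw [AffineSubspace.affineSpan_eq_top_iff_vectorSpan_eq_top_of_nonempty ℝ _ _ hne]
    refine Submodule.eq_top_of_finrank_eq ?_
    rw [finrank_euclideanSpace_fin]
    have h1 : vectorSpan ℝ F = (vectorSpan ℝ C₀).map φ.toAffineMap.linear := by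
      rw [← himg]; exact (AffineMap.map_vectorSpan φ.toAffineMap).symm
    have h2 : Module.finrank ℝ (vectorSpan ℝ F) = d := hdim
    rw [h1] at h2
    exact (Submodule.equivMapOfInjective φ.toAffineMap.linear φ.linearIsometry.injective
      _).finrank_eq.trans h2
  obtain ⟨z₀, hz₀⟩ := hconv₀.interior_nonempty_iff_affineSpan_eq_top.2 hspan
  -- Recentring at an interior point `z₀` of the facet puts `0` in the interior of the parametrizing
  -- body.
  refine ⟨y₁ + ι z₀, ι, -z₀ +ᵥ C₀, hι, hι', hcomp₀.vadd _, hconv₀.vadd _, ?_, ?_⟩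
  · have h1 := (Homeomorph.addLeft (-z₀)).image_interior C₀
    have h2 : (Homeomorph.addLeft (-z₀)) '' C₀ = -z₀ +ᵥ C₀ := rfl
    rw [← h2, ← h1]
    exact ⟨z₀, hz₀, by simp⟩
  · rw [← himg, ← Set.image_vadd, Set.image_image]
    refine Set.image_congr fun z _ => ?_
    rw [hφ, vadd_eq_add, map_add, map_neg]
    abel

section

variable {d : ℕ} {y₀ : E (d + 1)} {ι : E d →ₗᵢ[ℝ] E (d + 1)} {C : Set (E d)}

lemma isometry_chart (y₀ : E (d + 1)) (ι : E d →ₗᵢ[ℝ] E (d + 1)) :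
    Isometry fun z => y₀ + ι z :=
  (isometry_add_left y₀).comp ι.isometry

lemma euclideanHausdorffMeasure_chart (S : Set (E d)) :
    Measure.euclideanHausdorffMeasure d ((fun z => y₀ + ι z) '' S) = volume S := by
  rw [(isometry_chart y₀ ι).euclideanHausdorffMeasure_image,
    EuclideanSpace.euclideanHausdorffMeasure_eq_volume]

lemma isop_chart (hC : IsCompact C) (hint : (interior C).Nonempty) :
    isop ((fun z => y₀ + ι z) '' C) =
      (Measure.euclideanHausdorffMeasure (d - 1)).real (frontier C) / (d * volume.real C) := by
  let φ : E d →ᵃⁱ[ℝ] E (d + 1) :=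
    (AffineIsometryEquiv.constVAdd ℝ (E (d + 1)) y₀).toAffineIsometry.comp ι.toAffineIsometry
  have hφ : (fun z => y₀ + ι z) = φ := rfl
  have hdim : affineDim (φ '' C) = d := by
    have h1 : vectorSpan ℝ (φ '' C) = (vectorSpan ℝ C).map φ.toAffineMap.linear :=
      (AffineMap.map_vectorSpan φ.toAffineMap).symm
    rw [affineDim, h1]
    exact (Submodule.equivMapOfInjective φ.toAffineMap.linear φ.linearIsometry.injective
      _).finrank_eq.symm.trans (affineDim_of_interior_nonempty hint)
  rw [isop, hφ, hdim, φ.intrinsicFrontier_image, intrinsicFrontier_eq_frontier hC.isClosed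
    (affineSpan_eq_top_of_interior_nonempty hint), measureReal_def, measureReal_def,
    φ.isometry.euclideanHausdorffMeasure_image, φ.isometry.euclideanHausdorffMeasure_image,
    EuclideanSpace.euclideanHausdorffMeasure_eq_volume]
  rfl

end

end

section

variable {n : ℕ}

/-! ### Estimates for the volume polynomials -/

/-- The perturbed body rises by almost `t` over an interior point of the facet. Near `u₀` the
constraints hold because `f > 1 - ε`; away from `u₀` the disc of radius `ρ` around `y₀` in the facet
leaves a margin in the support function that dominates a small `t`. -/
lemma eventually_mem_wulffPerturb {K : ConvexBody (E n)} {u₀ : Metric.sphere (0 : E n) 1} {y₀ : E n}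
    {ρ : ℝ} (hρ : 0 < ρ) (hy₀ : ∀ w, inner ℝ w (u₀ : E n) = (0 : ℝ) → ‖w‖ ≤ ρ → y₀ + w ∈ K)
    (f : C(Metric.sphere (0 : E n) 1, ℝ)) (hf : ∀ u, 0 ≤ f u) (hfu : f u₀ = 1) {ε : ℝ}
    (hε : 0 < ε) (hε1 : ε < 1) :
    ∀ᶠ t : ℝ in 𝓝[>] 0, y₀ + ((1 - ε) * t) • (u₀ : E n) ∈ wulffPerturb K f t := by
  have hev : ∀ᶠ u in 𝓝 u₀, 1 - ε < f u :=
    f.continuous.continuousAt.eventually_const_lt (by rw [hfu]; linarith)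
  obtain ⟨η, hη, hball⟩ := Metric.eventually_nhds_iff.1 hev
  have hsmall : ∀ᶠ t : ℝ in 𝓝[>] 0, t < ρ * η / 2 :=
    (eventually_lt_nhds (by positivity)).filter_mono nhdsWithin_le_nhds
  filter_upwards [hsmall, self_mem_nhdsWithin] with t ht ht0 u
  have ht0 : 0 < t := ht0
  set c : ℝ := inner ℝ (u₀ : E n) (u : E n) with hc
  have hu : ‖(u : E n)‖ = 1 := by simp
  have hu₀ : ‖(u₀ : E n)‖ = 1 := by simp
  have huu : (inner ℝ (u : E n) (u : E n) : ℝ) = 1 := by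
    rw [real_inner_self_eq_norm_sq, hu, one_pow]
  have huu₀ : (inner ℝ (u₀ : E n) (u₀ : E n) : ℝ) = 1 := by
    rw [real_inner_self_eq_norm_sq, hu₀, one_pow]
  have hcomm : (inner ℝ (u : E n) (u₀ : E n) : ℝ) = c := real_inner_comm _ _
  have hc1 : c ≤ 1 := by
    have := real_inner_le_norm (u₀ : E n) (u : E n)
    rwa [hu, hu₀, one_mul] at this
  set w : E n := (u : E n) - c • (u₀ : E n) with hw
  have hwu₀ : (inner ℝ w (u₀ : E n) : ℝ) = 0 := by
    rw [hw, inner_sub_left, inner_smul_left, huu₀, hcomm]; simp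
  have hwu : (inner ℝ w (u : E n) : ℝ) = ‖w‖ ^ 2 := by
    rw [← real_inner_self_eq_norm_sq]
    nth_rw 3 [hw]
    rw [inner_sub_right, inner_smul_right, hwu₀, mul_zero, sub_zero]
  have hwn : ‖w‖ ^ 2 = 1 - c ^ 2 := by
    rw [← hwu, hw, inner_sub_left, inner_smul_left, huu, ← hc]
    simp only [conj_trivial]; ring
  have hh : inner ℝ y₀ (u : E n) + ρ * ‖w‖ ≤ supportFunction K u := by
    have h1 := hy₀ ((ρ / ‖w‖) • w) (by rw [inner_smul_left, hwu₀, mul_zero]) (by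
      rw [norm_smul, norm_div, norm_norm, Real.norm_of_nonneg hρ.le]
      rcases eq_or_ne ‖w‖ 0 with h | h
      · rw [h]; simpa using hρ.le
      · rw [div_mul_cancel₀ _ h])
    have h2 := inner_le_supportFunction K (u : E n) h1
    rw [inner_add_left, inner_smul_left, hwu] at h2
    refine le_trans (le_of_eq ?_) h2
    simp only [conj_trivial]
    rcases eq_or_ne ‖w‖ 0 with h | h
    · simp [h]
    · field_simp
  rw [inner_add_left, inner_smul_left, ← hc]
  simp only [conj_trivial]
  have hwρ := mul_nonneg hρ.le (norm_nonneg w)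
  have htf := mul_nonneg ht0.le (hf u)
  by_cases hd : dist u u₀ < η
  · have h1 := hball hd
    have h2 : (1 - ε) * t * c ≤ t * f u := by
      have : (1 - ε) * t * c ≤ (1 - ε) * t := mul_le_of_le_one_right (by nlinarith) hc1
      nlinarith
    linarith
  · push Not at hd
    rcases le_or_gt c 0 with hc0 | hc0
    · have : (1 - ε) * t * c ≤ 0 := mul_nonpos_of_nonneg_of_nonpos (by nlinarith) hc0
      linarith
    · have h1 : dist u u₀ ^ 2 = 2 - 2 * c := by
        rw [Subtype.dist_eq, dist_eq_norm, ← real_inner_self_eq_norm_sq, inner_sub_left,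
          inner_sub_right, inner_sub_right, huu, huu₀, hcomm, ← hc]
        ring
      -- For `c > 0`, `‖w‖² = 1 - c² ≥ 1 - c`, which is half the squared distance from `u` to `u₀`.
      have h2 : η / 2 ≤ ‖w‖ := by
        refine le_of_sq_le_sq ?_ (norm_nonneg _)
        rw [hwn]
        nlinarith [mul_self_le_mul_self hη.le hd]
      have h3 : ρ * (η / 2) ≤ ρ * ‖w‖ := mul_le_mul_of_nonneg_left h2 hρ.le
      have h4 : (1 - ε) * t * c ≤ t := by
        have : (1 - ε) * t ≤ t := by nlinarith
        exact (mul_le_of_le_one_right (by nlinarith) hc1).trans this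
      linarith

/-- The half-ball as a convex body. -/
lemma exists_halfBallBody (u : Metric.sphere (0 : E n) 1) :
    ∃ B : ConvexBody (E n), (B : Set (E n)) = halfBall u ∧ (interior (B : Set (E n))).Nonempty := by
  have e : halfBall u = Metric.closedBall 0 1 ∩ {x : E n | inner ℝ x (u : E n) ≤ 0} := by
    ext x; simp [halfBall]
  have hconv : Convex ℝ (halfBall u) := by
    rw [e]
    refine (convex_closedBall 0 1).inter ?_
    intro x hx y hy a b ha hb hab
    simp only [Set.mem_ofPred_eq] at hx hy ⊢
    rw [inner_add_left, inner_smul_left, inner_smul_left]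
    simp only [conj_trivial]
    nlinarith
  have hcomp : IsCompact (halfBall u) := by
    rw [e]
    exact (isCompact_closedBall 0 1).inter_right (isClosed_le (by fun_prop) continuous_const)
  refine ⟨⟨halfBall u, hconv, hcomp, ⟨0, by simp [halfBall]⟩⟩, rfl, ?_⟩
  have hu : ‖(u : E n)‖ = 1 := by simp
  refine ⟨-((1 / 2 : ℝ)) • (u : E n), mem_interior.2
    ⟨Metric.ball 0 1 ∩ {x : E n | inner ℝ x (u : E n) < 0}, ?_, ?_, ?_, ?_⟩⟩
  · rintro x ⟨h1, h2⟩
    exact ⟨(mem_ball_zero_iff.1 h1).le, h2.le⟩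
  · exact Metric.isOpen_ball.inter (isOpen_lt (by fun_prop) continuous_const)
  · rw [mem_ball_zero_iff, norm_smul, hu]; norm_num
  · change inner ℝ (-((1 / 2 : ℝ)) • (u : E n)) (u : E n) < (0 : ℝ)
    rw [inner_smul_left, real_inner_self_eq_norm_sq, hu]; norm_num

lemma mem_combination {K A B : ConvexBody (E n)} {c a b : ℝ} {x : E n} :
    x ∈ ((c • K + a • A + b • B : ConvexBody (E n)) : Set (E n)) ↔
      ∃ k ∈ K, ∃ y ∈ A, ∃ z ∈ B, x = c • k + a • y + b • z := by
  constructor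
  · rintro ⟨_, ⟨_, ⟨k, hk, rfl⟩, _, ⟨y, hy, rfl⟩, rfl⟩, _, ⟨z, hz, rfl⟩, rfl⟩
    exact ⟨k, hk, y, hy, z, hz, rfl⟩
  · rintro ⟨k, hk, y, hy, z, hz, rfl⟩
    exact ⟨_, ⟨_, ⟨k, hk, rfl⟩, _, ⟨y, hy, rfl⟩, rfl⟩, _, ⟨z, hz, rfl⟩, rfl⟩

lemma volume_body_ne_top (K : ConvexBody (E n)) : volume (K : Set (E n)) ≠ ⊤ :=
  K.isCompact.measure_lt_top.ne

lemma combVol_le_of_subset {K A B : ConvexBody (E n)} {c a b : ℝ} {S : Set (E n)}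
    (hS : IsCompact S)
    (h : ((c • K + a • A + b • B : ConvexBody (E n)) : Set (E n)) ⊆ S) :
    combVol K A B c a b ≤ volume.real S :=
  measureReal_mono h hS.measure_lt_top.ne

/-- Replacing a summand `K` by a body `A ⊇ K` reaching height `s` over the facet increases the
volume of `K + a K + b B` by at least `a s` times a lower bound for the area of the facet. -/
lemma combVol_add_prism_le {d : ℕ} {K A B : ConvexBody (E (d + 1))}
    {u : Metric.sphere (0 : E (d + 1)) 1}
    {y₀ : E (d + 1)} {ι : E d →ₗᵢ[ℝ] E (d + 1)} {C : Set (E d)}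
    (hι : ∀ z, inner ℝ (ι z) (u : E (d + 1)) = (0 : ℝ)) (hC : IsCompact C) (hconv : Convex ℝ C)
    (h0 : 0 ∈ interior C) (hF : supportFace K (u : E (d + 1)) = (fun z => y₀ + ι z) '' C)
    (hKA : (K : Set (E (d + 1))) ⊆ A) (hB : (B : Set (E (d + 1))) = halfBall u) {s : ℝ}
    (hs : 0 ≤ s) (hA : y₀ + s • (u : E (d + 1)) ∈ A) {a b : ℝ} (ha : 0 ≤ a) (hb : 0 ≤ b) :
    combVol K K B 1 a b + a * s * (volume.real C +
      b * (Measure.euclideanHausdorffMeasure (d - 1)).real (frontier C)) ≤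
      combVol K A B 1 a b := by
  have hu : ‖(u : E (d + 1))‖ = 1 := by simp
  set h := supportFunction K (u : E (d + 1)) with hh
  have hC0 : (0 : E d) ∈ C := interior_subset h0
  have hface : ∀ z ∈ C, y₀ + ι z ∈ K ∧ inner ℝ (y₀ + ι z) (u : E (d + 1)) = h := fun z hz =>
    mem_supportFace_iff.1 (hF ▸ ⟨z, hz, rfl⟩)
  have hy₀ : y₀ ∈ K ∧ inner ℝ y₀ (u : E (d + 1)) = h := by simpa using hface 0 hC0
  set D : Set (E d) := C + Metric.closedBall 0 b
  have hD : IsCompact D := hC.add (isCompact_closedBall 0 b)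
  set R : Set (E (d + 1)) := (fun z => (1 + a) • y₀ + ι z) '' D
  have hRcomp : IsCompact R := hD.image (isometry_chart _ ι).continuous
  have hR : ∀ x ∈ R, inner ℝ x (u : E (d + 1)) = (1 + a) * h := by
    rintro _ ⟨z, -, rfl⟩
    rw [inner_add_left, inner_smul_left, hι, hy₀.2]; simp
  set Pr := prism (u : E (d + 1)) ((1 + a) * h) (a * s) R
  have hPrm : MeasurableSet Pr := measurableSet_prism _ _ _ hRcomp.isClosed.measurableSet
  have hPrv : volume Pr = ENNReal.ofReal (a * s) * volume D := by
    rw [volume_prism hu hRcomp.isClosed.measurableSet hR, Nat.add_sub_cancel,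
      euclideanHausdorffMeasure_chart]
  set S₁ : Set (E (d + 1)) :=
    (((1 : ℝ) • K + a • K + b • B : ConvexBody (E (d + 1))) : Set (E (d + 1)))
  set S₂ : Set (E (d + 1)) :=
    (((1 : ℝ) • K + a • A + b • B : ConvexBody (E (d + 1))) : Set (E (d + 1)))
  -- The half-ball has no positive height in direction `u`, so `K + a K + b B` stays at height at
  -- most `(1 + a) h`, where the prism begins.
  have hdisj : Disjoint S₁ Pr := by
    refine Set.disjoint_left.2 fun x hx hxP => ?_
    obtain ⟨k, hk, k', hk', z, hz, rfl⟩ := mem_combination.1 hx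
    have h1 := hxP.1
    have hz' : z ∈ halfBall u := hB ▸ hz
    rw [inner_add_left, inner_add_left, inner_smul_left, inner_smul_left, inner_smul_left] at h1
    simp only [conj_trivial, one_mul] at h1
    have h2 := inner_le_supportFunction K (u : E (d + 1)) hk
    have h3 := mul_le_mul_of_nonneg_left (inner_le_supportFunction K (u : E (d + 1)) hk') ha
    have h4 := mul_nonpos_of_nonneg_of_nonpos hb hz'.2
    linarith
  have hsub₁ : S₁ ⊆ S₂ := by
    intro x hx
    obtain ⟨k, hk, k', hk', z, hz, rfl⟩ := mem_combination.1 hx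
    exact mem_combination.2 ⟨k, hk, k', hKA hk', z, hz, rfl⟩
  have hsub₂ : Pr ⊆ S₂ := by
    intro x hx
    obtain ⟨hx1, hx2, hx3⟩ := hx
    set θ := inner ℝ x (u : E (d + 1)) - (1 + a) * h with hθ
    obtain ⟨_, ⟨z, hz, w, hw, rfl⟩, hzw⟩ := hx3
    have hθ0 : 0 < θ := sub_pos.2 hx1
    have hθs : θ ≤ a * s := by linarith
    have ha0 : 0 < a := by
      rcases eq_or_lt_of_le ha with h | h
      · rw [← h, zero_mul] at hθs; linarith
      · exact h
    have hs0 : 0 < s := by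
      rcases eq_or_lt_of_le hs with h | h
      · rw [← h, mul_zero] at hθs; linarith
      · exact h
    -- The prism point splits as a point of the facet, `a` times a raised point of `A`, and a
    -- horizontal vector of `b B`. The whole height `θ` is carried by `A`.
    have hp : y₀ + (θ / a) • (u : E (d + 1)) ∈ A := by
      have h1 := A.convex.add_smul_mem (hKA hy₀.1) hA (t := θ / a / s)
        ⟨by positivity, by rw [div_div, div_le_one (by positivity)]; exact hθs⟩
      rwa [smul_smul, div_mul_cancel₀ _ hs0.ne'] at h1
    have hwB : b⁻¹ • ι w ∈ B := by
      change b⁻¹ • ι w ∈ (B : Set (E (d + 1)))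
      rw [hB]
      refine ⟨?_, by rw [inner_smul_left, hι, mul_zero]⟩
      rw [norm_smul, LinearIsometry.norm_map, norm_inv, Real.norm_of_nonneg hb]
      exact inv_mul_le_one_of_le₀ (mem_closedBall_zero_iff.1 hw) hb
    refine mem_combination.2 ⟨_, (hface z hz).1, _, hp, _, hwB, ?_⟩
    -- At `b = 0` the inverse is `0`, but then `w = 0` as well.
    have hbw : b • b⁻¹ • ι w = ι w := by
      rcases eq_or_ne b 0 with h | h
      · have : w = 0 := by
          have := mem_closedBall_zero_iff.1 hw
          rw [h] at this
          exact norm_le_zero_iff.1 this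
        rw [this]; simp
      · exact smul_inv_smul₀ h _
    have hx : x = (1 + a) • y₀ + ι (z + w) + θ • (u : E (d + 1)) := by
      have : (1 + a) • y₀ + ι (z + w) = x - θ • (u : E (d + 1)) := hzw
      rw [this, sub_add_cancel]
    rw [hx, hbw, smul_add a, smul_smul, mul_div_cancel₀ _ ha0.ne', map_add, add_smul, one_smul,
      one_smul]
    abel
  have hvol : volume.real S₁ + volume.real Pr ≤ volume.real S₂ := by
    rw [← measureReal_union hdisj hPrm (volume_body_ne_top _)
      (measure_ne_top_of_subset hsub₂ (volume_body_ne_top _))]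
    exact measureReal_mono (Set.union_subset hsub₁ hsub₂) (volume_body_ne_top _)
  have hDv : volume.real C + b * (Measure.euclideanHausdorffMeasure (d - 1)).real (frontier C) ≤
      volume.real D := by
    have h1 := volume_add_frontier_le hC hconv h0 hb
    have hfin := (euclideanHausdorffMeasure_frontier_lt_top hC hconv h0).ne
    have h2 := ENNReal.toReal_mono hD.measure_lt_top.ne h1
    rw [ENNReal.toReal_add hC.measure_lt_top.ne (ENNReal.mul_ne_top ENNReal.ofReal_ne_top hfin),
      ENNReal.toReal_mul, ENNReal.toReal_ofReal hb] at h2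
    exact h2
  have hPr' : volume.real Pr = a * s * volume.real D := by
    rw [measureReal_def, hPrv, ENNReal.toReal_mul, ENNReal.toReal_ofReal (by positivity),
      measureReal_def]
  rw [hPr'] at hvol
  have := mul_le_mul_of_nonneg_left hDv (mul_nonneg ha hs)
  change volume.real S₁ + _ ≤ volume.real S₂
  linarith

/-- Adding the constraints defining `K` and `A` puts `K + a A` inside `1 + a` times the Wulff shape
of `h_K + a t / (1 + a) f`, so the volume bound for a single perturbation applies. -/
lemma combVol_wulff_le {K A B : ConvexBody (E n)} (h0 : 0 ∈ interior (K : Set (E n)))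
    {U : Set (Metric.sphere (0 : E n) 1)} (hU : IsClosed U) {η : ℝ} (hη : 0 < η)
    (hUη : ∀ u ∈ U, η ≤ supportFunction K u) {f : Metric.sphere (0 : E n) 1 → ℝ}
    (hf : ∀ u, 0 ≤ f u) (hf1 : ∀ u, f u ≤ 1) (hfU : ∀ u, u ∉ U → f u = 0) {t : ℝ} (ht : 0 ≤ t)
    (hA : (A : Set (E n)) = wulffPerturb K f t) {a : ℝ} (ha : 0 ≤ a) :
    combVol K A B 1 a 0 ≤ (1 + a) ^ n * (volume.real (K : Set (E n)) +
      ((1 + a * t / (1 + a) / η) ^ n - 1) * volume.real (normalCone K U)) := by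
  have ha1 : 0 < 1 + a := by positivity
  obtain ⟨r, hr, hrK⟩ := Metric.nhds_basis_closedBall.mem_iff.1 (mem_interior_iff_mem_nhds.1 h0)
  set τ := a * t / (1 + a)
  have hτ : 0 ≤ τ := by positivity
  obtain ⟨W, hW⟩ := exists_wulffBody hr hrK hf hf1 hτ
  have hsub : ((1 : ℝ) • K + a • A + (0 : ℝ) • B : ConvexBody (E n)) ≤ (1 + a) • W := by
    intro x hx
    obtain ⟨k, hk, y, hy, z, hz, rfl⟩ := mem_combination.1 hx
    refine ⟨(1 + a)⁻¹ • (k + a • y), ?_, ?_⟩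
    · rw [hW]
      have hy' : y ∈ wulffPerturb K f t := hA ▸ hy
      intro u
      have h1 := inner_le_supportFunction K (u : E n) hk
      have h2 := mul_le_mul_of_nonneg_left (hy' u) ha
      rw [inner_smul_left, inner_add_left, inner_smul_left]
      simp only [conj_trivial]
      rw [inv_mul_le_iff₀ ha1]
      have : (1 + a) * (supportFunction K u + τ * f u) =
          supportFunction K u + a * (supportFunction K u + t * f u) := by
        simp only [τ]; field_simp; ring
      rw [this]
      linarith
    · simp only [one_smul, zero_smul, add_zero]
      exact smul_inv_smul₀ ha1.ne' _
  refine (measureReal_mono hsub (volume_body_ne_top _)).trans ?_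
  rw [ConvexBody.coe_smul, measureReal_def, Measure.addHaar_smul, finrank_euclideanSpace_fin,
    ENNReal.toReal_mul, ENNReal.toReal_ofReal (abs_nonneg _), abs_of_pos (by positivity), hW,
    ← measureReal_def]
  exact mul_le_mul_of_nonneg_left (volume_wulffPerturb_le h0 hU hη hUη hf1 hfU hτ) (by positivity)

lemma combVol_le_of_subset_smul {K A B : ConvexBody (E n)} {c : ℝ}
    (hA : (A : Set (E n)) ⊆ c • (K : Set (E n))) (a b : ℝ) :
    combVol K A B 1 a b ≤ combVol K K B 1 (a * c) b := by
  refine measureReal_mono ?_ (volume_body_ne_top _)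
  intro x hx
  obtain ⟨k, hk, y, hy, z, hz, rfl⟩ := mem_combination.1 hx
  obtain ⟨k', hk', rfl⟩ := hA hy
  exact mem_combination.2 ⟨k, hk, k', hk', z, hz, by simp only [smul_smul]⟩

lemma combVol_self_le {K B : ConvexBody (E n)} (hB : (0 : E n) ∈ B) {a b : ℝ} (ha : 0 ≤ a) :
    combVol K K B 1 a b ≤ (1 + a) ^ n * combVol K K B 1 0 b := by
  have ha1 : 0 < 1 + a := by positivity
  have hsub : ((1 : ℝ) • K + a • K + b • B : ConvexBody (E n)) ≤
      (1 + a) • ((1 : ℝ) • K + (0 : ℝ) • K + b • B) := by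
    intro x hx
    obtain ⟨k, hk, k', hk', z, hz, rfl⟩ := mem_combination.1 hx
    refine ⟨(1 + a)⁻¹ • ((1 : ℝ) • k + a • k' + b • z), mem_combination.2
      ⟨(1 + a)⁻¹ • k + (a * (1 + a)⁻¹) • k', ?_, k, hk, (1 + a)⁻¹ • z, ?_, ?_⟩,
      smul_inv_smul₀ ha1.ne' _⟩
    · refine K.convex hk hk' (by positivity) (by positivity) ?_
      field_simp
    · exact B.convex.smul_mem_of_zero_mem hB hz ⟨by positivity, inv_le_one_of_one_le₀ (by linarith)⟩
    · simp only [smul_add, smul_smul, one_smul, zero_smul, add_zero, mul_comm, one_mul]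
  refine (measureReal_mono hsub (volume_body_ne_top _)).trans_eq ?_
  rw [ConvexBody.coe_smul, measureReal_def, Measure.addHaar_smul, finrank_euclideanSpace_fin,
    ENNReal.toReal_mul, ENNReal.toReal_ofReal (abs_nonneg _), abs_of_pos (by positivity),
    ← measureReal_def, combVol]

lemma combVol_parallel_le {K A B : ConvexBody (E n)} {r : ℝ} (hr : 0 < r)
    (hrK : Metric.closedBall 0 r ⊆ (K : Set (E n))) (hB : (B : Set (E n)) ⊆ Metric.closedBall 0 1)
    {b : ℝ} (hb : 0 ≤ b) :
    combVol K A B 1 0 b ≤ volume.real (K : Set (E n)) + b * (1 + b / r) ^ (n - 1) *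
      (Measure.euclideanHausdorffMeasure (n - 1)).real (frontier (K : Set (E n))) := by
  have h0 : 0 ∈ interior (K : Set (E n)) :=
    mem_interior_iff_mem_nhds.2 (mem_of_superset (Metric.closedBall_mem_nhds 0 hr) hrK)
  have hfin := (euclideanHausdorffMeasure_frontier_lt_top K.isCompact K.convex h0).ne
  have h1 := volume_add_closedBall_le K.isCompact K.convex hr hrK hb
  have h2 := ENNReal.toReal_mono (ENNReal.add_ne_top.2 ⟨volume_body_ne_top K,
    ENNReal.mul_ne_top ENNReal.ofReal_ne_top hfin⟩) h1
  rw [ENNReal.toReal_add (volume_body_ne_top K) (ENNReal.mul_ne_top ENNReal.ofReal_ne_top hfin),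
    ENNReal.toReal_mul, ENNReal.toReal_ofReal (by positivity)] at h2
  refine le_trans ?_ h2
  refine combVol_le_of_subset (K.isCompact.add (isCompact_closedBall 0 b)) ?_
  intro x hx
  obtain ⟨k, hk, k', hk', z, hz, rfl⟩ := mem_combination.1 hx
  refine ⟨k, hk, b • z, ?_, by simp⟩
  have := mem_closedBall_zero_iff.1 (hB hz)
  rw [mem_closedBall_zero_iff, norm_smul, Real.norm_of_nonneg hb]
  exact mul_le_of_le_one_right hb this

end

section

variable {n : ℕ}

/-! ### Comparison of first-order coefficients -/

lemma hasDerivAt_le_of_le {p q : ℝ → ℝ} {p' q' : ℝ} (hp : HasDerivAt p p' 0)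
    (hq : HasDerivAt q q' 0) (h0 : p 0 = q 0) (h : ∀ a, 0 < a → p a ≤ q a) : p' ≤ q' := by
  refine le_of_tendsto_of_tendsto hp.tendsto_slope_zero_right hq.tendsto_slope_zero_right ?_
  filter_upwards [self_mem_nhdsWithin] with a ha
  have ha : 0 < a := ha
  rw [zero_add, h0, smul_eq_mul, smul_eq_mul]
  exact mul_le_mul_of_nonneg_left (sub_le_sub_right (h a ha) _) (inv_pos.2 ha).le

/-- A polynomial is controlled by its first-order Taylor polynomial and its supremum on `[0, 1]`. -/
lemma exists_sum_pow_le (n : ℕ) : ∃ M : ℝ, 0 ≤ M ∧ ∀ (g : ℕ → ℝ) (Y : ℝ),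
    (∀ b ∈ Set.Icc (0 : ℝ) 1, |∑ j ∈ Finset.range (n + 2), g j * b ^ j| ≤ Y) →
    ∀ b ∈ Set.Icc (0 : ℝ) 1,
      ∑ j ∈ Finset.range (n + 2), g j * b ^ j ≤ g 0 + g 1 * b + M * Y * b ^ 2 := by
  -- Values at `n + 2` distinct nodes in `[0, 1]` determine the coefficients through the inverse
  -- Vandermonde matrix, so `M` depends on `n` only and not on the polynomial.
  set x : Fin (n + 2) → ℝ := fun k => (k : ℝ) / (n + 2) with hx
  set V := Matrix.vandermonde x with hV
  have hinj : Function.Injective x := by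
    intro i j hij
    have : (0 : ℝ) < n + 2 := by positivity
    have h1 : ((i : ℕ) : ℝ) = (j : ℕ) := by
      simpa [hx, div_left_inj' this.ne'] using hij
    exact Fin.ext (by exact_mod_cast h1)
  have hdet : IsUnit V.det := (Matrix.det_vandermonde_ne_zero_iff.2 hinj).isUnit
  refine ⟨∑ i, ∑ k, |V⁻¹ i k|, by positivity, fun g Y hg b hb => ?_⟩
  have hY : 0 ≤ Y := (abs_nonneg _).trans (hg 0 (by simp))
  have hval : ∀ k, |(V.mulVec fun i => g i) k| ≤ Y := by
    intro k
    have h1 := hg (x k) ⟨by positivity, by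
      rw [hx, div_le_one (by positivity)]
      have : (k : ℕ) < n + 2 := k.2
      exact_mod_cast this.le⟩
    rw [Finset.sum_range] at h1
    convert h1 using 2
    simp only [Matrix.mulVec, dotProduct, hV, Matrix.vandermonde_apply, mul_comm]
  have hcoef : ∀ i : Fin (n + 2), |g i| ≤ (∑ k, |V⁻¹ i k|) * Y := by
    intro i
    have h1 : g i = ∑ k, V⁻¹ i k * (V.mulVec fun i => g i) k := by
      have : V⁻¹.mulVec (V.mulVec fun i : Fin (n + 2) => g i) = fun i : Fin (n + 2) => g i := by
        rw [Matrix.mulVec_mulVec, Matrix.nonsing_inv_mul _ hdet, Matrix.one_mulVec]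
      exact (congrFun this i).symm
    rw [h1, Finset.sum_mul]
    refine (Finset.abs_sum_le_sum_abs _ _).trans (Finset.sum_le_sum fun k _ => ?_)
    rw [abs_mul]
    exact mul_le_mul_of_nonneg_left (hval k) (abs_nonneg _)
  have htail : ∑ j ∈ Finset.range n, g (j + 2) * b ^ (j + 2) ≤
      ∑ j ∈ Finset.range n, |g (j + 2)| * b ^ 2 := by
    refine Finset.sum_le_sum fun j _ => ?_
    refine mul_le_mul (le_abs_self _) ?_ (pow_nonneg hb.1 _) (abs_nonneg _)
    exact pow_le_pow_of_le_one hb.1 hb.2 (by omega)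
  have hsum : ∑ j ∈ Finset.range n, |g (j + 2)| ≤ (∑ i, ∑ k, |V⁻¹ i k|) * Y := by
    calc ∑ j ∈ Finset.range n, |g (j + 2)| ≤ ∑ j ∈ Finset.range (n + 2), |g j| := by
          rw [Finset.sum_range_succ', Finset.sum_range_succ']
          have := abs_nonneg (g 0)
          have := abs_nonneg (g (0 + 1))
          linarith
      _ = ∑ i : Fin (n + 2), |g i| := Finset.sum_range fun j => |g j|
      _ ≤ ∑ i, (∑ k, |V⁻¹ i k|) * Y := Finset.sum_le_sum fun i _ => hcoef i
      _ = _ := by rw [Finset.sum_mul]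
  rw [Finset.sum_range_succ', Finset.sum_range_succ']
  rw [← Finset.sum_mul] at htail
  have := mul_le_mul_of_nonneg_right hsum (sq_nonneg b)
  simp only [zero_add, pow_zero, mul_one, pow_one]
  linarith

section

variable {K A B : ConvexBody (E n)} {C : ℕ → ℕ → ℝ}

lemma combVol_self_eq {a b : ℝ} (ha : 0 ≤ a) :
    combVol K K B 1 a b = combVol K A B (1 + a) 0 b := by
  rw [combVol, combVol, add_smul_body zero_le_one ha, zero_smul_body, add_zero]

lemma IsVolumePolynomial.combVol_zero_mid (h : IsVolumePolynomial K A B C) {c b : ℝ} (hc : 0 ≤ c)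
    (hb : 0 ≤ b) : combVol K A B c 0 b = ∑ j ∈ Finset.range (n + 1), C 0 j * b ^ j * c ^ (n - j) := by
  have h1 : combVol K A B c 0 b = combVol K B A c b 0 := by simp only [combVol, add_right_comm]
  rw [h1, h.swap.combVol_zero_right hc hb]

/-- The coefficients of the first-order gap between `|K + a A + b B|` and `|K + a K + b B|`. -/
def gapCoeff (n : ℕ) (C : ℕ → ℕ → ℝ) (j : ℕ) : ℝ := C 1 j - ((n - j : ℕ) : ℝ) * C 0 j

/-- The first-order coefficient of `|(1 + a) K + b B|` in `a`. -/
def selfSlope (n : ℕ) (C : ℕ → ℕ → ℝ) (b : ℝ) : ℝ :=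
  ∑ j ∈ Finset.range (n + 1), ((n - j : ℕ) : ℝ) * C 0 j * b ^ j

lemma hasDerivAt_combSum (hn : 0 < n) (C : ℕ → ℕ → ℝ) (b : ℝ) :
    HasDerivAt (fun a : ℝ => ∑ i ∈ Finset.range (n + 1), ∑ j ∈ Finset.range (n + 1),
      C i j * a ^ i * b ^ j) (∑ j ∈ Finset.range (n + 1), C 1 j * b ^ j) 0 := by
  have h1 : HasDerivAt (fun a : ℝ => ∑ i ∈ Finset.range (n + 1), ∑ j ∈ Finset.range (n + 1),
      C i j * a ^ i * b ^ j) (∑ i ∈ Finset.range (n + 1), ∑ j ∈ Finset.range (n + 1),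
      C i j * ((i : ℝ) * 0 ^ (i - 1)) * b ^ j) 0 :=
    HasDerivAt.fun_sum fun i _ => HasDerivAt.fun_sum fun j _ =>
      ((hasDerivAt_pow i 0).const_mul _).mul_const _
  refine h1.congr_deriv ?_
  rw [Finset.sum_eq_single 1]
  · simp
  · intro i _ hi
    refine Finset.sum_eq_zero fun j _ => ?_
    rcases Nat.eq_zero_or_pos i with h | h
    · simp [h]
    · simp [show i - 1 ≠ 0 by omega]
  · intro h; simp at h; omega

lemma hasDerivAt_selfSum (C : ℕ → ℕ → ℝ) (b : ℝ) :
    HasDerivAt (fun a : ℝ => ∑ j ∈ Finset.range (n + 1), C 0 j * b ^ j * (1 + a) ^ (n - j))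
      (selfSlope n C b) 0 := by
  have h1 : HasDerivAt (fun a : ℝ => ∑ j ∈ Finset.range (n + 1), C 0 j * b ^ j * (1 + a) ^ (n - j))
      (∑ j ∈ Finset.range (n + 1),
        C 0 j * b ^ j * (((n - j : ℕ) : ℝ) * (1 + 0) ^ (n - j - 1) * 1)) 0 :=
    HasDerivAt.fun_sum fun j _ =>
      ((((hasDerivAt_id' (0 : ℝ)).const_add 1)).fun_pow (n - j)).const_mul _
  refine h1.congr_deriv (Finset.sum_congr rfl fun j _ => ?_)
  simp only [add_zero, one_pow]; ring

lemma sum_gapCoeff (C : ℕ → ℕ → ℝ) (b : ℝ) :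
    ∑ j ∈ Finset.range (n + 1), gapCoeff n C j * b ^ j =
      ∑ j ∈ Finset.range (n + 1), C 1 j * b ^ j - selfSlope n C b := by
  simp only [gapCoeff, selfSlope, sub_mul, Finset.sum_sub_distrib]

lemma IsVolumePolynomial.combVol_one (h : IsVolumePolynomial K A B C) {a b : ℝ} (ha : 0 ≤ a)
    (hb : 0 ≤ b) : combVol K A B 1 a b = ∑ i ∈ Finset.range (n + 1),
      ∑ j ∈ Finset.range (n + 1), C i j * a ^ i * b ^ j := by
  rw [h.2 1 a b zero_le_one ha hb]; simp only [one_pow, mul_one]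

lemma IsVolumePolynomial.combVol_self (h : IsVolumePolynomial K A B C) {a b : ℝ} (ha : 0 ≤ a)
    (hb : 0 ≤ b) : combVol K K B 1 a b =
      ∑ j ∈ Finset.range (n + 1), C 0 j * b ^ j * (1 + a) ^ (n - j) := by
  rw [combVol_self_eq (A := A) ha, h.combVol_zero_mid (by positivity) hb]

lemma IsVolumePolynomial.sum_at_zero (h : IsVolumePolynomial K A B C) {b : ℝ} (hb : 0 ≤ b) :
    ∑ i ∈ Finset.range (n + 1), ∑ j ∈ Finset.range (n + 1), C i j * (0 : ℝ) ^ i * b ^ j =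
      ∑ j ∈ Finset.range (n + 1), C 0 j * b ^ j * (1 + 0) ^ (n - j) := by
  rw [← h.combVol_one le_rfl hb, ← h.combVol_self le_rfl hb, combVol, combVol, zero_smul_body,
    zero_smul_body]

/-- Both sides of `hle` agree at `a = 0`, so the inequality passes to the derivatives there, and the
derivatives differ by the gap polynomial. -/
lemma IsVolumePolynomial.le_sum_gapCoeff (hn : 0 < n) (h : IsVolumePolynomial K A B C) {b κ : ℝ}
    (hb : 0 ≤ b) (hle : ∀ a, 0 ≤ a → combVol K K B 1 a b + a * κ ≤ combVol K A B 1 a b) :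
    κ ≤ ∑ j ∈ Finset.range (n + 1), gapCoeff n C j * b ^ j := by
  rw [sum_gapCoeff]
  have h1 := (hasDerivAt_selfSum (n := n) C b).fun_add ((hasDerivAt_id' (0 : ℝ)).mul_const κ)
  have := hasDerivAt_le_of_le h1 (hasDerivAt_combSum hn C b) (by
    rw [h.sum_at_zero hb]; simp) fun a ha => by
      rw [← h.combVol_self ha.le hb, ← h.combVol_one ha.le hb]; exact hle a ha.le
  linarith

lemma IsVolumePolynomial.sum_gapCoeff_le (hn : 0 < n) (h : IsVolumePolynomial K A B C) {b c : ℝ}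
    (hb : 0 ≤ b) (hc : 0 ≤ c)
    (hle : ∀ a, 0 ≤ a → combVol K A B 1 a b ≤ combVol K K B 1 (a * (1 + c)) b) :
    ∑ j ∈ Finset.range (n + 1), gapCoeff n C j * b ^ j ≤ c * selfSlope n C b := by
  rw [sum_gapCoeff]
  have h1 : HasDerivAt (fun a : ℝ => ∑ j ∈ Finset.range (n + 1),
      C 0 j * b ^ j * (1 + a * (1 + c)) ^ (n - j)) (selfSlope n C b * (1 * (1 + c))) 0 :=
    HasDerivAt.comp (𝕜 := ℝ) 0 (h := fun a : ℝ => a * (1 + c))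
      (h₂ := fun a : ℝ => ∑ j ∈ Finset.range (n + 1), C 0 j * b ^ j * (1 + a) ^ (n - j))
      (by simpa using hasDerivAt_selfSum (n := n) C b) ((hasDerivAt_id' (0 : ℝ)).mul_const (1 + c))
  have := hasDerivAt_le_of_le (hasDerivAt_combSum hn C b) h1 (by
    rw [h.sum_at_zero hb]; simp) fun a ha => by
      rw [← h.combVol_self (by positivity) hb, ← h.combVol_one ha.le hb]; exact hle a ha.le
  linarith

lemma IsVolumePolynomial.selfSlope_le (h : IsVolumePolynomial K A B C) (hB : (0 : E n) ∈ B) {b : ℝ}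
    (hb : 0 ≤ b) : selfSlope n C b ≤ n * combVol K K B 1 0 b := by
  have h1 := (((hasDerivAt_id' (0 : ℝ)).const_add 1).fun_pow n).mul_const (combVol K K B 1 0 b)
  have := hasDerivAt_le_of_le (hasDerivAt_selfSum (n := n) C b) h1 (by
    rw [h.combVol_self le_rfl hb]; simp) fun a ha => by
      rw [← h.combVol_self ha.le hb]; exact combVol_self_le hB ha.le
  simpa using this

lemma selfSlope_zero (C : ℕ → ℕ → ℝ) : selfSlope n C 0 = n * C 0 0 := by
  rw [selfSlope, Finset.sum_range_succ']
  simp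

/-- The bound has slope `n |K| + n τ z` at `a = 0`. The first summand is the slope for `A = K`, and
the gap removes it. -/
lemma IsVolumePolynomial.gapCoeff_zero_le (hn : 0 < n) (h : IsVolumePolynomial K A B C) {τ z : ℝ}
    (hle : ∀ a, 0 ≤ a → combVol K A B 1 a 0 ≤
      (1 + a) ^ n * (volume.real (K : Set (E n)) + ((1 + a * τ) ^ n - 1) * z)) :
    gapCoeff n C 0 ≤ n * τ * z := by
  have e : gapCoeff n C 0 = ∑ j ∈ Finset.range (n + 1), gapCoeff n C j * (0 : ℝ) ^ j := by
    rw [Finset.sum_range_succ']; simp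
  rw [e, sum_gapCoeff]
  set v := volume.real (K : Set (E n))
  have h1 : HasDerivAt (fun a : ℝ => (1 + a) ^ n * (v + ((1 + a * τ) ^ n - 1) * z))
      (n * v + n * τ * z) 0 := by
    have h2 := ((hasDerivAt_id' (0 : ℝ)).const_add 1).fun_pow n
    have h3 := ((((((hasDerivAt_id' (0 : ℝ)).mul_const τ).const_add 1).fun_pow n).sub_const
      1).mul_const z).const_add v
    refine (h2.fun_mul h3).congr_deriv ?_
    simp
  have h2 := hasDerivAt_le_of_le (hasDerivAt_combSum hn C 0) h1 (by
    rw [← h.combVol_one le_rfl le_rfl, h.combVol_zero_zero zero_le_one, h.coeff_zero_zero]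
    simp [v]) fun a ha => by
      rw [← h.combVol_one ha.le le_rfl]; exact hle a ha.le
  rw [selfSlope_zero, h.coeff_zero_zero]
  linarith

lemma IsVolumePolynomial.coeff_zero_one_le (hn : 0 < n) (h : IsVolumePolynomial K A B C) {r P : ℝ}
    (hle : ∀ b, 0 ≤ b → combVol K A B 1 0 b ≤
      volume.real (K : Set (E n)) + b * (1 + b / r) ^ (n - 1) * P) : C 0 1 ≤ P := by
  have h1 : HasDerivAt (fun b : ℝ => ∑ j ∈ Finset.range (n + 1), C 0 j * b ^ j) (C 0 1) 0 := by
    have h2 : HasDerivAt (fun b : ℝ => ∑ j ∈ Finset.range (n + 1), C 0 j * b ^ j)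
        (∑ j ∈ Finset.range (n + 1), C 0 j * ((j : ℝ) * 0 ^ (j - 1))) 0 :=
      HasDerivAt.fun_sum fun j _ => (hasDerivAt_pow j 0).const_mul _
    refine h2.congr_deriv ?_
    rw [Finset.sum_eq_single 1]
    · simp
    · intro j _ hj
      rcases Nat.eq_zero_or_pos j with h | h
      · simp [h]
      · simp [show j - 1 ≠ 0 by omega]
    · intro h; simp at h; omega
  set v := volume.real (K : Set (E n)) with hv
  have h3 : HasDerivAt (fun b : ℝ => v + b * (1 + b / r) ^ (n - 1) * P) P 0 := by
    have h4 := ((hasDerivAt_id' (0 : ℝ)).fun_mul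
      ((((hasDerivAt_id' (0 : ℝ)).div_const r).const_add 1).fun_pow (n - 1)))
    refine ((h4.mul_const P).const_add v).congr_deriv ?_
    simp
  refine hasDerivAt_le_of_le h1 h3 ?_ fun b hb => ?_
  · have := h.combVol_zero_mid (c := 1) (b := 0) zero_le_one le_rfl
    rw [h.combVol_zero_zero zero_le_one, h.coeff_zero_zero] at this
    simp only [one_pow, mul_one] at this
    rw [← this]; simp [hv]
  · have := h.combVol_zero_mid (c := 1) zero_le_one hb.le
    simp only [one_pow, mul_one] at this
    rw [← this]; exact hle b hb.le

end

end

section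

variable {n : ℕ}

/-! ### The form near a facet of large isoperimetric ratio -/

lemma volume_real_pos {C : Set (E n)} (hC : IsCompact C) (h : (interior C).Nonempty) :
    0 < volume.real C :=
  ENNReal.toReal_pos (Measure.measure_pos_of_nonempty_interior volume h).ne' hC.measure_lt_top.ne

/-- Substituting `C 1 0 = g 0 + n C 0 0` and `C 1 1 = g 1 + (n - 1) C 0 1`, where `g` denotes the
gap coefficients and `n = m + 2`, the terms coming from `A = K` cancel. -/
lemma IsVolumePolynomial.bezoutForm_eq {m : ℕ} {K A B : ConvexBody (E (m + 2))} {C : ℕ → ℕ → ℝ}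
    (h : IsVolumePolynomial K A B C) (hK : (interior (K : Set (E (m + 2)))).Nonempty) :
    ((m : ℝ) + 2) ^ 2 * (m + 1) * bezoutForm K A B =
      (m + 1) * gapCoeff (m + 2) C 0 * C 0 1 -
        (m + 2) * volume.real (K : Set (E (m + 2))) * gapCoeff (m + 2) C 1 := by
  have h1 := h.mixedVol₁_eq
  have h2 := h.swap.mixedVol₁_eq
  have h3 := h.mixedVol₂_eq
  have e1 : ((m + 2 - 0 : ℕ) : ℝ) = m + 2 := by push_cast; rfl
  have e2 : ((m + 2 - 1 : ℕ) : ℝ) = m + 1 := by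
    rw [show m + 2 - 1 = m + 1 by omega]; push_cast; rfl
  rw [bezoutForm, mixedVol₀_eq_volume K hK, gapCoeff, gapCoeff, e1, e2, h.coeff_zero_zero, ← h1,
    ← h3]
  rw [← h2]
  ring

/-- The geometric part of the estimate: the sign of the form follows from a numerical inequality
involving the volume of the part of `K` seen by the normals in `U`. -/
lemma bezoutForm_neg_of_estimate {m : ℕ} {K A B : ConvexBody (E (m + 2))} {C : ℕ → ℕ → ℝ}
    (h : IsVolumePolynomial K A B C) (hK : (interior (K : Set (E (m + 2)))).Nonempty)
    {P φ H ε t b M X μ : ℝ} (ht : 0 < t) (hb : 0 < b) (hP : 0 ≤ P)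
    (hφ : 0 ≤ φ) (hε : ε < 1)
    (hlow : ∀ b, 0 ≤ b → (1 - ε) * t * (φ + b * H) ≤
      ∑ j ∈ Finset.range (m + 2 + 1), gapCoeff (m + 2) C j * b ^ j)
    (hupp : ∑ j ∈ Finset.range (m + 2 + 1), gapCoeff (m + 2) C j * b ^ j ≤
      gapCoeff (m + 2) C 0 + gapCoeff (m + 2) C 1 * b + M * (t * X) * b ^ 2)
    (hg : gapCoeff (m + 2) C 0 ≤ t * μ) (hC : C 0 1 ≤ P)
    (hnum : (m + 1) * μ * P * b < (m + 2) * volume.real (K : Set (E (m + 2))) *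
      ((1 - ε) * (φ + b * H) - μ - M * X * b ^ 2)) :
    bezoutForm K A B < 0 := by
  have hg0 : 0 ≤ gapCoeff (m + 2) C 0 := by
    have h1 := hlow 0 le_rfl
    rw [Finset.sum_range_succ'] at h1
    simp only [zero_mul, add_zero, pow_zero, mul_one, ne_eq, Nat.add_eq_zero_iff, one_ne_zero,
      and_false, not_false_eq_true, zero_pow, mul_zero, Finset.sum_const_zero, zero_add] at h1
    exact le_trans (by have : 0 < 1 - ε := by linarith
                       positivity) h1
  set v := volume.real (K : Set (E (m + 2)))
  have hv : 0 < v := volume_real_pos K.isCompact hK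
  set g0 := gapCoeff (m + 2) C 0
  set g1 := gapCoeff (m + 2) C 1
  have h1 := (hlow b hb.le).trans hupp
  -- Comparing the lower and upper bounds at this one value of `b` isolates `g1`; the bound `g0 ≤ t
  -- μ` removes the constant term.
  have h2 : t * ((1 - ε) * (φ + b * H) - μ - M * X * b ^ 2) ≤ g1 * b := by nlinarith
  have h3 : g0 * C 0 1 ≤ t * μ * P :=
    (mul_le_mul_of_nonneg_left hC hg0).trans (mul_le_mul_of_nonneg_right hg hP)
  have h4 : (m + 1) * (g0 * C 0 1) * b < (m + 2) * v * (g1 * b) :=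
    calc (m + 1) * (g0 * C 0 1) * b ≤ (m + 1) * (t * μ * P) * b := by gcongr
      _ = t * ((m + 1) * μ * P * b) := by ring
      _ < t * ((m + 2) * v * ((1 - ε) * (φ + b * H) - μ - M * X * b ^ 2)) := by gcongr
      _ = (m + 2) * v * (t * ((1 - ε) * (φ + b * H) - μ - M * X * b ^ 2)) := by ring
      _ ≤ (m + 2) * v * (g1 * b) := by gcongr
  have h5 : ((m : ℝ) + 2) ^ 2 * (m + 1) * bezoutForm K A B < 0 := by
    rw [h.bezoutForm_eq hK]
    have : ((m + 1) * g0 * C 0 1 - (m + 2) * v * g1) * b < 0 := by nlinarith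
    exact neg_of_mul_neg_left this hb.le
  exact neg_of_mul_neg_right h5 (by positivity)

/-- Choice of the parameters: a small translation length and a small angular error. -/
lemma exists_parameters {m v φ H P h Y : ℝ} (hh : 0 < h)
    (hiso : (m + 1) * φ * P < (m + 2) * v * H) :
    ∃ b ∈ Set.Ioc (0 : ℝ) 1, ∃ ε ∈ Set.Ioo (0 : ℝ) 1, ε < h ∧
      (m + 1) * ((h * φ + (m + 2) * ε) / (h - ε)) * P * b < (m + 2) * v *
        ((1 - ε) * (φ + b * H) - (h * φ + (m + 2) * ε) / (h - ε) - Y * b ^ 2) := by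
  have hδ : 0 < (m + 2) * v * H - (m + 1) * φ * P := by linarith
  set δ := (m + 2) * v * H - (m + 1) * φ * P
  -- First `b` is fixed so small that the quadratic loss is below the isoperimetric surplus `δ`. At
  -- `ε = 0` the quotient equals `φ` and the inequality is strict; continuity then gives a small
  -- positive `ε`.
  have hb : ∀ᶠ b in 𝓝[>] (0 : ℝ), (m + 2) * v * Y * b < δ := by
    refine Filter.Tendsto.eventually_lt_const (v := 0) hδ ?_
    refine tendsto_nhdsWithin_of_tendsto_nhds ?_
    have : Continuous fun b : ℝ => (m + 2) * v * Y * b := by fun_prop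
    simpa using this.tendsto 0
  obtain ⟨b, hb1, hb2⟩ := (hb.and (Ioc_mem_nhdsGT (zero_lt_one' ℝ))).exists
  refine ⟨b, hb2, ?_⟩
  have hμ : ContinuousAt (fun ε : ℝ => (h * φ + (m + 2) * ε) / (h - ε)) 0 :=
    ContinuousAt.div (by fun_prop) (by fun_prop) (by simpa using hh.ne')
  have hc1 : ContinuousAt (fun ε : ℝ => (m + 1) * ((h * φ + (m + 2) * ε) / (h - ε)) * P * b) 0 := by
    fun_prop
  have hc2 : ContinuousAt (fun ε : ℝ => (m + 2) * v *
        ((1 - ε) * (φ + b * H) - (h * φ + (m + 2) * ε) / (h - ε) - Y * b ^ 2)) 0 := by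
    fun_prop
  have hlt : (m + 1) * ((h * φ + (m + 2) * 0) / (h - 0)) * P * b < (m + 2) * v *
        ((1 - 0) * (φ + b * H) - (h * φ + (m + 2) * 0) / (h - 0) - Y * b ^ 2) := by
    have e : (h * φ + (m + 2) * 0) / (h - 0) = φ := by
      rw [mul_zero, add_zero, sub_zero, mul_div_cancel_left₀ _ hh.ne']
    rw [e]
    have : 0 < (δ - (m + 2) * v * Y * b) * b := mul_pos (by linarith) hb2.1
    simp only [δ] at this
    nlinarith
  have hev := (hc1.eventually_lt hc2 hlt).filter_mono (nhdsWithin_le_nhds (s := Set.Ioi 0))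
  have hpos : 0 < min 1 h := lt_min one_pos hh
  obtain ⟨ε, hε1, hε2⟩ := (hev.and (Ioo_mem_nhdsGT hpos)).exists
  exact ⟨ε, ⟨hε2.1, hε2.2.trans_le (min_le_left _ _)⟩, hε2.2.trans_le (min_le_right _ _), hε1⟩

lemma combVol_self_mono {K B : ConvexBody (E n)} (hB : (0 : E n) ∈ B) {b : ℝ} (hb : 0 ≤ b)
    (hb1 : b ≤ 1) : combVol K K B 1 0 b ≤ combVol K K B 1 0 1 := by
  refine measureReal_mono ?_ (volume_body_ne_top _)
  intro x hx
  obtain ⟨k, hk, k', hk', z, hz, rfl⟩ := mem_combination.1 hx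
  exact mem_combination.2 ⟨k, hk, k', hk', b • z, B.convex.smul_mem_of_zero_mem hB hz ⟨hb, hb1⟩,
    by simp⟩

/-- The order of choices matters: `M` and `X` do not depend on the perturbation, then `b` and `ε`
are fixed, then `U` from `ε`, and only then `f` and `t`. Every estimate on the gap is linear in `t`,
so `t` cancels from the final inequality. -/
theorem exists_nhds_bezoutForm_neg_of_zero_mem_interior {m : ℕ} {K : ConvexBody (E (m + 1 + 1))}
    (h0 : 0 ∈ interior (K : Set (E (m + 1 + 1)))) {u₀ : Metric.sphere (0 : E (m + 1 + 1)) 1}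
    (hdim : affineDim (supportFace K (u₀ : E (m + 1 + 1))) = m + 1)
    (hIsop : isop (K : Set (E (m + 1 + 1))) < isop (supportFace K (u₀ : E (m + 1 + 1)))) :
    ∃ U ∈ 𝓝 u₀, ∀ f : C(Metric.sphere (0 : E (m + 1 + 1)) 1, ℝ),
      (∀ u, 0 ≤ f u) → (∀ u, f u ≤ 1) → f u₀ = 1 → (∀ u, u ∉ U → f u = 0) →
      ∀ᶠ t : ℝ in 𝓝[>] 0, ∃ A B : ConvexBody (E (m + 1 + 1)),
        (A : Set (E (m + 1 + 1))) = wulffPerturb K f t ∧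
        (B : Set (E (m + 1 + 1))) = halfBall u₀ ∧ bezoutForm K A B < 0 := by
  have hu : ‖(u₀ : E (m + 1 + 1))‖ = 1 := by simp
  obtain ⟨y₀, ι, C, hι, hι', hC, hconv, hC0, hF⟩ := exists_facet_chart K hu hdim
  obtain ⟨r, hr, hrK⟩ := Metric.nhds_basis_closedBall.mem_iff.1 (mem_interior_iff_mem_nhds.1 h0)
  obtain ⟨ρ, hρ, hρC⟩ := Metric.nhds_basis_closedBall.mem_iff.1 (mem_interior_iff_mem_nhds.1 hC0)
  obtain ⟨B, hB, hBint⟩ := exists_halfBallBody u₀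
  have hB0 : (0 : E (m + 1 + 1)) ∈ B := by
    change (0 : E (m + 1 + 1)) ∈ (B : Set (E (m + 1 + 1)))
    rw [hB]; simp [halfBall]
  have hB1 : (B : Set (E (m + 1 + 1))) ⊆ Metric.closedBall 0 1 := by
    rw [hB]; intro x hx; exact mem_closedBall_zero_iff.2 hx.1
  set v := volume.real (K : Set (E (m + 1 + 1)))
  set φ := volume.real C with hφ
  set H := (Measure.euclideanHausdorffMeasure (m + 1 - 1) : Measure (E (m + 1))).real (frontier C)
    with hH
  set P := (Measure.euclideanHausdorffMeasure (m + 1 + 1 - 1) : Measure (E (m + 1 + 1))).real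
    (frontier (K : Set (E (m + 1 + 1)))) with hP
  set h := supportFunction K (u₀ : E (m + 1 + 1))
  have hv : 0 < v := volume_real_pos K.isCompact ⟨0, h0⟩
  have hφ0 : 0 < φ := volume_real_pos hC ⟨0, hC0⟩
  have hh : 0 < h := hr.trans_le (supportFunction_ge_of_closedBall_subset hr.le hrK hu)
  have hiso : ((m : ℝ) + 1) * φ * P < (m + 2) * v * H := by
    rw [hF, isop_chart hC ⟨0, hC0⟩, isop_of_interior_nonempty K.isClosed ⟨0, h0⟩,
      div_lt_div_iff₀ (by positivity) (by positivity)] at hIsop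
    push_cast at hIsop
    have h1 : P * ((m + 1) * φ) < H * ((m + 1 + 1) * v) := hIsop
    linarith
  obtain ⟨M, -, hM⟩ := exists_sum_pow_le (m + 1)
  -- Since `A ⊆ (1 + t / r) K`, the gap polynomial is at most `t / r` times the slope of `|(1 + a) K
  -- + b B|` at `a = 0`, which is at most `n |K + B|` for `b ≤ 1`.
  set X := ((m : ℝ) + 2) / r * combVol K K B 1 0 1
  obtain ⟨b, hb, ε, hε, hεh, hnum⟩ :=
    exists_parameters (Y := M * X) hh hiso
  have hFa : Measure.euclideanHausdorffMeasure (m + 1 + 1 - 1)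
      (supportFace K (u₀ : E (m + 1 + 1))) = volume C := by
    rw [hF]; exact euclideanHausdorffMeasure_chart C
  obtain ⟨U, hU, hUc, hUz, hUh⟩ := exists_nhds_volume_normalCone_le (by omega) K u₀ hh
    (by rw [hFa]; exact hC.measure_lt_top.ne) hε.1
  refine ⟨U, hU, fun f hf hf1 hfu hfU => ?_⟩
  have hev := eventually_mem_wulffPerturb hρ (K := K) (u₀ := u₀) (y₀ := y₀) (fun w hw hwρ => by
    obtain ⟨z, rfl⟩ := hι' w hw
    have : y₀ + ι z ∈ supportFace K (u₀ : E (m + 1 + 1)) := by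
      rw [hF]
      exact ⟨z, hρC (by rwa [mem_closedBall_zero_iff, ← ι.norm_map]), rfl⟩
    exact this.1) f hf hfu hε.1 hε.2
  filter_upwards [hev, self_mem_nhdsWithin] with t hAt ht
  have ht : 0 < t := ht
  obtain ⟨A, hA⟩ := exists_wulffBody hr hrK hf hf1 ht.le
  refine ⟨A, B, hA, hB, ?_⟩
  have hKA : (K : Set (E (m + 1 + 1))) ⊆ A := hA ▸ subset_wulffPerturb hf ht.le
  have hAint : (interior (A : Set (E (m + 1 + 1)))).Nonempty := ⟨0, interior_mono hKA h0⟩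
  obtain ⟨c, hc⟩ := exists_isVolumePolynomial (by omega) K A B ⟨0, h0⟩ hAint hBint
  have hlow : ∀ b, 0 ≤ b → (1 - ε) * t * (φ + b * H) ≤
      ∑ j ∈ Finset.range (m + 2 + 1), gapCoeff (m + 2) c j * b ^ j := by
    intro b hb
    refine hc.le_sum_gapCoeff (by omega) hb fun a ha => ?_
    have h1 := combVol_add_prism_le (s := (1 - ε) * t) hι hC hconv hC0 hF hKA hB
      (mul_nonneg (by linarith [hε.2]) ht.le) (by
        change _ ∈ (A : Set (E (m + 1 + 1))); rw [hA]; exact hAt) ha hb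
    rwa [mul_assoc a] at h1
  have hsub : (A : Set (E (m + 1 + 1))) ⊆ (1 + t / r) • (K : Set (E (m + 1 + 1))) :=
    hA ▸ wulffPerturb_subset_smul hr hrK hf1 ht.le
  have habs : ∀ b ∈ Set.Icc (0 : ℝ) 1,
      |∑ j ∈ Finset.range (m + 1 + 2), gapCoeff (m + 2) c j * b ^ j| ≤ t * X := by
    intro b hb
    have hH0 : 0 ≤ H := measureReal_nonneg
    have h1 : 0 ≤ ∑ j ∈ Finset.range (m + 1 + 2), gapCoeff (m + 2) c j * b ^ j :=
      le_trans (mul_nonneg (mul_nonneg (by linarith [hε.2]) ht.le)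
        (add_nonneg hφ0.le (mul_nonneg hb.1 hH0))) (hlow b hb.1)
    rw [abs_of_nonneg h1]
    refine (hc.sum_gapCoeff_le (c := t / r) (by omega) hb.1 (by positivity) fun a ha =>
      combVol_le_of_subset_smul hsub a b).trans ?_
    have h2 := (hc.selfSlope_le hB0 hb.1).trans
      (mul_le_mul_of_nonneg_left (combVol_self_mono hB0 hb.1 hb.2) (Nat.cast_nonneg _))
    refine (mul_le_mul_of_nonneg_left h2 (by positivity)).trans_eq ?_
    simp only [X]; push_cast; ring
  have hupp := hM (gapCoeff (m + 2) c) (t * X) habs b ⟨hb.1.le, hb.2⟩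
  have hη : 0 < h - ε := by linarith
  -- This is `n * (t / (h - ε)) * (h φ / n + ε)`, where `h - ε` bounds the support function below on
  -- `U` and the last factor bounds the volume of the cone.
  have hg : gapCoeff (m + 2) c 0 ≤ t * ((h * φ + (m + 2) * ε) / (h - ε)) := by
    have h1 := hc.gapCoeff_zero_le (τ := t / (h - ε)) (z := volume.real (normalCone K U)) (by omega)
      fun a ha => (combVol_wulff_le h0 hUc hη hUh hf hf1 hfU ht.le hA ha).trans (by
        have h2 : a * t / (1 + a) / (h - ε) ≤ a * (t / (h - ε)) := by
          rw [← mul_div_assoc]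
          gcongr
          exact div_le_self (by positivity) (by linarith)
        gcongr)
    refine h1.trans ?_
    have h2 : volume.real (normalCone K U) ≤ h / (m + 2) * φ + ε := by
      refine hUz.trans_eq ?_
      rw [measureReal_def, hFa, ← measureReal_def]; push_cast; ring
    calc ((m + 1 + 1 : ℕ) : ℝ) * (t / (h - ε)) * volume.real (normalCone K U)
        ≤ ((m + 1 + 1 : ℕ) : ℝ) * (t / (h - ε)) * (h / (m + 2) * φ + ε) := by gcongr
      _ = _ := by push_cast; field_simp; ring
  have hC01 : c 0 1 ≤ P := hc.coeff_zero_one_le (by omega) fun b hb =>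
    combVol_parallel_le hr hrK hB1 hb
  exact bezoutForm_neg_of_estimate hc ⟨0, h0⟩ ht hb.1 measureReal_nonneg hφ0.le hε.2 hlow hupp hg
    hC01 hnum

end

section

variable {n : ℕ}

/-! ### Translation invariance -/

/-- A one-point convex body. -/
def pointBody (x : E n) : ConvexBody (E n) :=
  ⟨{x}, convex_singleton x, isCompact_singleton, Set.singleton_nonempty x⟩

lemma coe_add_pointBody (L : ConvexBody (E n)) (x : E n) :
    ((L + pointBody x : ConvexBody (E n)) : Set (E n)) = x +ᵥ (L : Set (E n)) := by
  have : ((L + pointBody x : ConvexBody (E n)) : Set (E n)) = (L : Set (E n)) + {x} := rfl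
  rw [this, add_comm, Set.singleton_add]; rfl

lemma mem_add_pointBody {L : ConvexBody (E n)} {x y : E n} :
    y ∈ L + pointBody x ↔ y - x ∈ L := by
  change y ∈ ((L + pointBody x : ConvexBody (E n)) : Set (E n)) ↔ _
  rw [coe_add_pointBody, Set.mem_vadd_set_iff_neg_vadd_mem, vadd_eq_add, neg_add_eq_sub]
  rfl

lemma exists_eq_add_pointBody (L : ConvexBody (E n)) (x : E n) :
    ∃ L₀ : ConvexBody (E n), L = L₀ + pointBody x :=
  ⟨L + pointBody (-x), ConvexBody.ext (Set.ext fun y => by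
    change y ∈ L ↔ y ∈ L + pointBody (-x) + pointBody x
    rw [mem_add_pointBody, mem_add_pointBody]; simp)⟩

lemma sum_pointBody {ι : Type*} (J : Finset ι) (x : ι → E n) :
    ∑ i ∈ J, pointBody (x i) = pointBody (∑ i ∈ J, x i) := by
  classical
  induction J using Finset.induction_on with
  | empty => rfl
  | insert i J hi ih =>
    rw [Finset.sum_insert hi, Finset.sum_insert hi, ih]
    exact ConvexBody.ext (Set.singleton_add_singleton)

/-- Each partial Minkowski sum is merely translated, so every volume in the polarization formula is
unchanged. -/
lemma mixedVolume_add_pointBody (L : Fin n → ConvexBody (E n)) (x : Fin n → E n) :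
    (mixedVolume fun i => L i + pointBody (x i)) = mixedVolume L := by
  simp only [mixedVolume, Finset.sum_add_distrib, sum_pointBody, coe_add_pointBody,
    measureReal_def, measure_vadd]

lemma bezoutForm_add_pointBody (K A B : ConvexBody (E n)) (x y : E n) :
    bezoutForm (K + pointBody x) (A + pointBody y) B = bezoutForm K A B := by
  have hB : B = B + pointBody 0 := ConvexBody.ext (by rw [coe_add_pointBody, zero_vadd])
  have h0 : mixedVol₀ (K + pointBody x) = mixedVol₀ K := mixedVolume_add_pointBody _ _
  have h1 : ∀ (A : ConvexBody (E n)) y,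
      mixedVol₁ (K + pointBody x) (A + pointBody y) = mixedVol₁ K A := fun A y => by
    rw [mixedVol₁, mixedVol₁, ← mixedVolume_add_pointBody (fun i : Fin n => if i.val = 0 then A else K)
      fun i => if i.val = 0 then y else x]
    congr 1; ext1 i; split_ifs <;> rfl
  have h2 : mixedVol₂ (K + pointBody x) (A + pointBody y) (B + pointBody 0) = mixedVol₂ K A B := by
    rw [mixedVol₂, mixedVol₂, ← mixedVolume_add_pointBody
      (fun i : Fin n => if i.val = 0 then A else if i.val = 1 then B else K)
      fun i => if i.val = 0 then y else if i.val = 1 then 0 else x]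
    congr 1; ext1 i; split_ifs <;> rfl
  rw [hB, bezoutForm, h0, h1, h1, h2, ← hB, bezoutForm]

lemma affineDim_vadd (x : E n) (C : Set (E n)) : affineDim (x +ᵥ C) = affineDim C := by
  rw [affineDim, vectorSpan_vadd, affineDim]

lemma isop_vadd (x : E n) (C : Set (E n)) : isop (x +ᵥ C) = isop C := by
  have h : x +ᵥ C = (AffineIsometryEquiv.constVAdd ℝ (E n) x).toAffineIsometry '' C := rfl
  rw [isop, affineDim_vadd, h, AffineIsometry.intrinsicFrontier_image, isop, measureReal_def,
    measureReal_def, (AffineIsometry.isometry _).euclideanHausdorffMeasure_image,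
    (AffineIsometry.isometry _).euclideanHausdorffMeasure_image, measureReal_def, measureReal_def]

lemma supportFace_add_pointBody (K : ConvexBody (E n)) (x u : E n) :
    supportFace (K + pointBody x) u = x +ᵥ supportFace K u := by
  ext y
  rw [Set.mem_vadd_set_iff_neg_vadd_mem, vadd_eq_add, neg_add_eq_sub]
  simp only [supportFace, Set.mem_ofPred_eq, mem_add_pointBody]
  refine and_congr_right fun _ => ⟨fun h z hz => ?_, fun h z hz => ?_⟩
  · have := h (z + x) (by rwa [add_sub_cancel_right])
    rw [inner_add_left] at this
    rw [inner_sub_left]; linarith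
  · have := h (z - x) hz
    rw [inner_sub_left, inner_sub_left] at this
    linarith

lemma supportFunction_add_pointBody (K : ConvexBody (E n)) (x u : E n) :
    supportFunction (K + pointBody x) u = supportFunction K u + inner ℝ x u := by
  obtain ⟨y, hy, h⟩ := exists_mem_eq_supportFunction K u
  rw [← h, ← inner_add_left]
  refine supportFunction_eq_of_isMax _ u (mem_add_pointBody.2 (by rwa [add_sub_cancel_right]))
    fun z hz => ?_
  have := inner_le_supportFunction K u (mem_add_pointBody.1 hz)
  rw [← h, inner_sub_left] at this
  rw [inner_add_left]; linarith

lemma wulffPerturb_add_pointBody (K : ConvexBody (E n)) (x : E n)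
    (f : Metric.sphere (0 : E n) 1 → ℝ) (t : ℝ) :
    wulffPerturb (K + pointBody x) f t = x +ᵥ wulffPerturb K f t := by
  ext y
  rw [Set.mem_vadd_set_iff_neg_vadd_mem, vadd_eq_add, neg_add_eq_sub]
  refine forall_congr' fun u => ?_
  beta_reduce
  rw [supportFunction_add_pointBody, inner_sub_left, sub_le_iff_le_add, add_right_comm]

lemma interior_coe_add_pointBody (K : ConvexBody (E n)) (x : E n) :
    interior ((K + pointBody x : ConvexBody (E n)) : Set (E n)) = x +ᵥ interior (K : Set (E n)) := by
  rw [coe_add_pointBody, interior_vadd]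

/-- The cone arguments need `0` in the interior of `K`. Translating `K` translates its Wulff
perturbations by the same vector and leaves the form, the facet dimension and both isoperimetric
ratios unchanged. -/
theorem exists_nhds_bezoutForm_neg {m : ℕ} {K : ConvexBody (E (m + 1 + 1))}
    (hK : (interior (K : Set (E (m + 1 + 1)))).Nonempty) {u₀ : Metric.sphere (0 : E (m + 1 + 1)) 1}
    (hdim : affineDim (supportFace K (u₀ : E (m + 1 + 1))) = m + 1)
    (hIsop : isop (K : Set (E (m + 1 + 1))) < isop (supportFace K (u₀ : E (m + 1 + 1)))) :
    ∃ U ∈ 𝓝 u₀, ∀ f : C(Metric.sphere (0 : E (m + 1 + 1)) 1, ℝ),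
      (∀ u, 0 ≤ f u) → (∀ u, f u ≤ 1) → f u₀ = 1 → (∀ u, u ∉ U → f u = 0) →
      ∀ᶠ t : ℝ in 𝓝[>] 0, ∃ A B : ConvexBody (E (m + 1 + 1)),
        (A : Set (E (m + 1 + 1))) = wulffPerturb K f t ∧
        (B : Set (E (m + 1 + 1))) = halfBall u₀ ∧ bezoutForm K A B < 0 := by
  obtain ⟨x, hx⟩ := hK
  obtain ⟨K, rfl⟩ := exists_eq_add_pointBody K x
  rw [interior_coe_add_pointBody, Set.mem_vadd_set_iff_neg_vadd_mem, vadd_eq_add,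
    neg_add_cancel] at hx
  rw [supportFace_add_pointBody, affineDim_vadd] at hdim
  rw [supportFace_add_pointBody, coe_add_pointBody, isop_vadd, isop_vadd] at hIsop
  obtain ⟨U, hU, h⟩ := exists_nhds_bezoutForm_neg_of_zero_mem_interior hx hdim hIsop
  refine ⟨U, hU, fun f hf hf1 hfu hfU => ?_⟩
  filter_upwards [h f hf hf1 hfu hfU] with t ⟨A, B, hA, hB, hneg⟩
  refine ⟨A + pointBody x, B, ?_, hB, by rwa [bezoutForm_add_pointBody]⟩
  rw [coe_add_pointBody, hA, wulffPerturb_add_pointBody]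

/-! ### Consequences for the Bezout constant -/

/-- The body `A` contains a translate of `s K` with `s > 0`, so `|K + a A| ≥ (1 + a s) ^ n |K|`.
Comparing slopes at `a = 0` gives the lower bound `s |K|`. -/
lemma mixedVol₁_pos {m : ℕ} {K A : ConvexBody (E (m + 2))}
    (hK : (interior (K : Set (E (m + 2)))).Nonempty)
    (hA : (interior (A : Set (E (m + 2)))).Nonempty) : 0 < mixedVol₁ K A := by
  obtain ⟨C, h⟩ := exists_isVolumePolynomial (by omega) K A K hK hA hK
  obtain ⟨x, hx⟩ := hA
  obtain ⟨ρ, hρ, hρA⟩ := Metric.nhds_basis_closedBall.mem_iff.1 (mem_interior_iff_mem_nhds.1 hx)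
  obtain ⟨R, hR, hRK⟩ := K.isCompact.isBounded.exists_pos_norm_le
  have hv := volume_real_pos K.isCompact hK
  set v := volume.real (K : Set (E (m + 2))) with hv'
  set s := ρ / R
  have hs : 0 < s := by positivity
  have hle : ∀ a, 0 ≤ a → (1 + a * s) ^ (m + 2) * v ≤ combVol K A K 1 a 0 := by
    intro a ha
    have h1 : volume.real ((a • x) +ᵥ ((1 + a * s) • (K : Set (E (m + 2))))) =
        (1 + a * s) ^ (m + 2) * v := by
      rw [measureReal_def, measure_vadd, Measure.addHaar_smul, finrank_euclideanSpace_fin,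
        ENNReal.toReal_mul, ENNReal.toReal_ofReal (abs_nonneg _), abs_of_pos (by positivity),
        ← measureReal_def]
    rw [← h1]
    refine measureReal_mono ?_ (volume_body_ne_top _)
    rintro _ ⟨_, ⟨k, hk, rfl⟩, rfl⟩
    refine mem_combination.2 ⟨k, hk, x + s • k, hρA ?_, k, hk, ?_⟩
    · rw [mem_closedBall_iff_norm, add_sub_cancel_left, norm_smul, Real.norm_of_nonneg hs.le]
      calc s * ‖k‖ ≤ s * R := by gcongr; exact hRK k hk
        _ = ρ := div_mul_cancel₀ _ hR.ne'
    · simp only [vadd_eq_add, smul_add, smul_smul, add_smul, one_smul, zero_smul, add_zero]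
      abel
  have h1 := ((((hasDerivAt_id' (0 : ℝ)).mul_const s).const_add 1).fun_pow (m + 2)).mul_const v
  have h2 := hasDerivAt_le_of_le h1 (hasDerivAt_combSum (n := m + 2) (by omega) C 0) (by
    rw [← h.combVol_one le_rfl le_rfl, h.combVol_zero_zero zero_le_one, h.coeff_zero_zero]
    simp [hv']) fun a ha => by
      rw [← h.combVol_one ha.le le_rfl]; exact hle a ha.le
  rw [Finset.sum_range_succ'] at h2
  have h3 : (0 : ℝ) < (m + 2) * mixedVol₁ K A := by
    rw [h.mixedVol₁_eq]
    refine lt_of_lt_of_le ?_ (h2.trans_eq (by simp))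
    simp only [zero_mul, add_zero, one_pow, mul_one, one_mul]
    positivity
  exact (mul_pos_iff_of_pos_left (by positivity)).1 h3

/-- Both mixed volumes in the denominator are positive, so a negative form says exactly that the
quotient for this pair exceeds `1`. -/
lemma one_lt_bezoutConstant {m : ℕ} {K A B : ConvexBody (E (m + 2))}
    (hK : (interior (K : Set (E (m + 2)))).Nonempty)
    (hA : (interior (A : Set (E (m + 2)))).Nonempty)
    (hB : (interior (B : Set (E (m + 2)))).Nonempty) (h : bezoutForm K A B < 0) :
    1 < bezoutConstant K := by
  refine lt_of_lt_of_le ?_ (le_iSup₂ (f := fun L₁ L₂ : ConvexBody (E (m + 2)) =>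
    ((mixedVol₂ K L₁ L₂ * mixedVol₀ K / (mixedVol₁ K L₁ * mixedVol₁ K L₂) : ℝ) : EReal)) A B)
  rw [← EReal.coe_one, EReal.coe_lt_coe_iff, one_lt_div (mul_pos (mixedVol₁_pos hK hA)
    (mixedVol₁_pos hK hB))]
  exact sub_neg.1 h

/-- A bump function on the sphere. -/
lemma exists_bump {X : Type*} [MetricSpace X] {x : X} {U : Set X} (hU : U ∈ 𝓝 x) :
    ∃ f : C(X, ℝ), (∀ u, 0 ≤ f u) ∧ (∀ u, f u ≤ 1) ∧ f x = 1 ∧ ∀ u, u ∉ U → f u = 0 := by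
  obtain ⟨ε, hε, hεU⟩ := Metric.mem_nhds_iff.1 hU
  refine ⟨⟨fun u => max 0 (1 - dist u x / ε), by fun_prop⟩, fun u => le_max_left _ _,
    fun u => max_le zero_le_one (sub_le_self _ (by positivity)), by simp, fun u hu => ?_⟩
  refine max_eq_left (sub_nonpos.2 ((one_le_div hε).2 ?_))
  by_contra hlt
  exact hu (hεU (not_le.1 hlt))

end

end BezoutForm

end

/-! ### Assembly of the three conclusions. -/

theorem theorem1p3 (n : ℕ) (hn : 3 ≤ n)
    (K : ConvexBody (BezoutForm.E n)) (hK : (interior (K : Set (BezoutForm.E n))).Nonempty)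
    (u₀ : Metric.sphere (0 : BezoutForm.E n) 1) (F : Set (BezoutForm.E n))
    (hF : BezoutForm.IsFacet K u₀ F)
    (hIsop : BezoutForm.isop (K : Set (BezoutForm.E n)) < BezoutForm.isop F) :
    -- non-negativity of the form fails, already on bodies with interior points
    (∃ A B : ConvexBody (BezoutForm.E n),
      (interior (A : Set (BezoutForm.E n))).Nonempty ∧
      (interior (B : Set (BezoutForm.E n))).Nonempty ∧
      BezoutForm.bezoutForm K A B < 0) ∧
    -- the Bezout constant exceeds one
    1 < BezoutForm.bezoutConstant K ∧
    -- small Wulff-shape perturbations concentrated near the facet normal, against the half-ball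
    (∃ U ∈ 𝓝 u₀, ∀ f : C(Metric.sphere (0 : BezoutForm.E n) 1, ℝ),
      (∀ u, 0 ≤ f u) → (∀ u, f u ≤ 1) → f u₀ = 1 → (∀ u, u ∉ U → f u = 0) →
      ∀ᶠ t : ℝ in 𝓝[>] 0, ∃ A B : ConvexBody (BezoutForm.E n),
        (A : Set (BezoutForm.E n)) =
          BezoutForm.wulffShape (fun u => BezoutForm.supportFunction K u + t * f u) ∧
        (B : Set (BezoutForm.E n)) = BezoutForm.halfBall u₀ ∧
        BezoutForm.bezoutForm K A B < 0) := by
  obtain ⟨m, rfl⟩ : ∃ m, n = m + 1 + 1 := ⟨n - 2, by omega⟩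
  obtain ⟨rfl, hdim⟩ := hF
  obtain ⟨U, hU, h⟩ := BezoutForm.exists_nhds_bezoutForm_neg hK (Nat.succ_injective hdim) hIsop
  -- A single bump function and one small `t` turn the local statement into a concrete pair, which
  -- serves for the first two conclusions.
  obtain ⟨f, hf, hf1, hfu, hfU⟩ := BezoutForm.exists_bump hU
  obtain ⟨t, ⟨A, B, hA, hB, hneg⟩, ht⟩ :=
    ((h f hf hf1 hfu hfU).and self_mem_nhdsWithin).exists
  have hAint : (interior (A : Set (BezoutForm.E (m + 1 + 1)))).Nonempty :=
    hK.mono (interior_mono (hA ▸ BezoutForm.subset_wulffPerturb hf (le_of_lt ht)))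
  have hBint : (interior (B : Set (BezoutForm.E (m + 1 + 1)))).Nonempty := by
    obtain ⟨B', hB', hint⟩ := BezoutForm.exists_halfBallBody u₀
    rwa [hB, ← hB']
  exact ⟨⟨A, B, hAint, hBint, hneg⟩, BezoutForm.one_lt_bezoutConstant hK hAint hBint hneg,
    U, hU, h⟩
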